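/- Let $\mathbb T=\mathbb R/\mathbb Z$, let $\|\cdot\|$ be the norm of the real space $L^2(\mathbb T)=L^2(0,1)$, and set $$\mathscr H_j=\Big\{q\in L^2(\mathbb T): q^{(j)}\in L^2(\mathbb T),\ \int_0^1 q\,dx=0\Big\},\quad \|q\|_j=\|q^{(j)}\|\quad (j=0,1,2,\dots),$$ with weak derivatives on the circle, and $\mathscr H_{-1}=\{f=g' : g\in\mathscr H_0\}$ (distributions on $\mathbb T$) with $\|f\|_{-1}=\|g\|$. Let $\alpha,\beta>0$ and $A\ge 0$ be constants and let $$P(q)=q'+\alpha q^2+u-c_0,\qquad u=Ae^{-\beta Q},\quad Q(x)=\int_0^x q(t)\,dt,\quad c_0=\int_0^1(\alpha q^2+u)\,dx .$$ A real analytic isomorphism between real Hilbert spaces is a bijection $f$ such that $f$ and $f^{-1}$ are real analytic. (i) For every $j\ge 1$, $P$ maps $\mathscr H_j$ into $\mathscr H_{j-1}$ and is a real analytic isomorphism between $\mathscr H_j$ and $\mathscr H_{j-1}$. For all $q\in\mathscr H_j$, $$\|q'\|^2\le\|P(q)\|^2\le\|q'\|^2+2\alpha^2\|q\|^3\|q'\|+C_*\|q\|^2e^{2\beta\|q\|},\qquad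 C_*=A(\beta+\alpha)(2+\beta A).$$ (ii) $P$ maps $\mathscr H_0$ into $\mathscr H_{-1}$ (with $q'$ taken in the sense of distributions), and $P:\mathscr H_0\to\mathscr H_{-1}$ is real analytic and injective. For all $q\in\mathscr H_0$, $$\|P(q)\|_{-1}\le\|q\|\big(3+2\alpha\|q\|+\beta Ae^{\beta\|q\|}\big);$$ in particular, for $\alpha=1$, $\|P(q)\|_{-1}\le\|q\|(3+2\|q\|+\beta Ae^{\beta\|q\|})$. If moreover $\alpha=1$ and $\beta=4$ (that is, $\alpha=1$ and $\beta=4/m$ with $m=1$), then $P:\mathscr H_0\to\mathscr H_{-1}$ is a real analytic isomorphism between $\mathscr H_0$ and $\mathscr H_{-1}$, and for all $q\in\mathscr H_0$, $$\|q\|^2\le 2\|P(q)\|_{-1}^2\big(1+2\|P(q)\|_{-1}^2\big).$$ -/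

import Mathlib

open MeasureTheory Set
open scoped ContDiff

namespace RiccatiTorus

noncomputable section

/-! ### Functions on the circle `𝕋 = ℝ / ℤ = [0, 1]` and weak derivatives -/

/-- Lebesgue measure on one period `(0, 1]`. -/
abbrev periodMeasure : Measure ℝ := volume.restrict (Ioc (0 : ℝ) 1)

/-- The real space `L²(𝕋) = L²(0, 1)`. -/
abbrev L2T : Type := Lp ℝ 2 periodMeasure

/-- Test functions on the circle: smooth real functions on `ℝ` of period `1`. -/
def TestFn : Submodule ℝ (ℝ → ℝ) where
  carrier := {φ | ContDiff ℝ ∞ φ ∧ Function.Periodic φ 1}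
  add_mem' := fun ha hb => ⟨ha.1.add hb.1, ha.2.add hb.2⟩
  zero_mem' := ⟨contDiff_const, fun _ => rfl⟩
  smul_mem' := fun c _ ha => ⟨contDiff_const.smul ha.1, fun x => by simp [ha.2 x]⟩

/-- `g` is the `j`-th weak derivative on the circle of `q`:
`∫₀¹ q φ⁽ʲ⁾ = (-1)ʲ ∫₀¹ g φ` for all test functions `φ`. -/
def IsWeakDeriv (j : ℕ) (q g : L2T) : Prop :=
  ∀ φ ∈ TestFn, ∫ x in (0 : ℝ)..1, q x * iteratedDeriv j φ x
    = (-1) ^ j * ∫ x in (0 : ℝ)..1, g x * φ x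

/-! ### Helper facts: integrability, uniqueness of weak derivatives -/

lemma TestFn.deriv_mem {φ : ℝ → ℝ} (h : φ ∈ TestFn) : deriv φ ∈ TestFn := by
  refine ⟨(contDiff_infty_iff_deriv.1 h.1).2, fun x => ?_⟩
  rw [← deriv_comp_add_const, funext h.2]

lemma TestFn.iteratedDeriv_mem {φ : ℝ → ℝ} (h : φ ∈ TestFn) (j : ℕ) :
    iteratedDeriv j φ ∈ TestFn := by
  induction j with
  | zero => simpa using h
  | succ j ih => rw [iteratedDeriv_succ]; exact TestFn.deriv_mem ih

lemma intervalIntegrable_L2T (q : L2T) : IntervalIntegrable q volume 0 1 := by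
  rw [intervalIntegrable_iff_integrableOn_Ioc_of_le zero_le_one]
  exact (Lp.memLp q).integrable (by norm_num)

lemma intervalIntegrable_mul (q : L2T) {φ : ℝ → ℝ} (h : Continuous φ) :
    IntervalIntegrable (fun x => q x * φ x) volume 0 1 :=
  (intervalIntegrable_L2T q).mul_continuousOn h.continuousOn

lemma integral_add_mul (q r : L2T) {φ : ℝ → ℝ} (h : Continuous φ) :
    ∫ x in (0 : ℝ)..1, (q + r : L2T) x * φ x
      = (∫ x in (0 : ℝ)..1, q x * φ x) + ∫ x in (0 : ℝ)..1, r x * φ x := by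
  rw [← intervalIntegral.integral_add (intervalIntegrable_mul q h) (intervalIntegrable_mul r h)]
  simp only [intervalIntegral.integral_of_le (zero_le_one' ℝ)]
  refine integral_congr_ae ?_
  filter_upwards [Lp.coeFn_add q r] with x hx
  rw [hx, Pi.add_apply, add_mul]

lemma integral_smul_mul (c : ℝ) (q : L2T) (φ : ℝ → ℝ) :
    ∫ x in (0 : ℝ)..1, (c • q : L2T) x * φ x = c * ∫ x in (0 : ℝ)..1, q x * φ x := by
  rw [← intervalIntegral.integral_const_mul]
  simp only [intervalIntegral.integral_of_le (zero_le_one' ℝ)]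
  refine integral_congr_ae ?_
  filter_upwards [Lp.coeFn_smul c q] with x hx
  rw [hx, Pi.smul_apply, smul_eq_mul, mul_assoc]

lemma integral_zero_mul (φ : ℝ → ℝ) : ∫ x in (0 : ℝ)..1, (0 : L2T) x * φ x = 0 := by
  simpa using integral_smul_mul 0 0 φ

lemma IsWeakDeriv.add {j : ℕ} {q r g h : L2T} (hq : IsWeakDeriv j q g)
    (hr : IsWeakDeriv j r h) : IsWeakDeriv j (q + r) (g + h) := by
  intro φ hφ
  rw [integral_add_mul q r (TestFn.iteratedDeriv_mem hφ j).1.continuous,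
    integral_add_mul g h hφ.1.continuous, hq φ hφ, hr φ hφ, mul_add]

lemma IsWeakDeriv.smul {j : ℕ} {q g : L2T} (c : ℝ) (hq : IsWeakDeriv j q g) :
    IsWeakDeriv j (c • q) (c • g) := by
  intro φ hφ
  rw [integral_smul_mul, integral_smul_mul, hq φ hφ, mul_left_comm]

lemma isWeakDeriv_zero (j : ℕ) : IsWeakDeriv j 0 0 := by
  intro φ _
  rw [integral_zero_mul, integral_zero_mul, mul_zero]

/-- Test functions separate the points of `L²(𝕋)`. -/
lemma eq_zero_of_forall_integral (f : L2T)
    (h : ∀ φ ∈ TestFn, ∫ x in (0 : ℝ)..1, f x * φ x = 0) : f = 0 := by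
  have hc (n : ℤ) : ∫ x in (0 : ℝ)..1, f x * Real.cos (2 * Real.pi * n * x) = 0 := by
    apply h (fun x => Real.cos (2 * Real.pi * n * x))
    refine ⟨by fun_prop, fun x => ?_⟩
    simp only
    rw [← Real.cos_add_int_mul_two_pi (2 * Real.pi * n * x) n]
    congr 1; ring
  have hs (n : ℤ) : ∫ x in (0 : ℝ)..1, f x * Real.sin (2 * Real.pi * n * x) = 0 := by
    apply h (fun x => Real.sin (2 * Real.pi * n * x))
    refine ⟨by fun_prop, fun x => ?_⟩
    simp only
    rw [← Real.sin_add_int_mul_two_pi (2 * Real.pi * n * x) n]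
    congr 1; ring
  have hL2 : MemLp (fun x => (f x : ℂ)) 2 (volume.restrict (Ioc (0 : ℝ) 1)) :=
    (Lp.memLp f).ofReal
  have hF := hasSum_sq_fourierCoeffOn zero_lt_one hL2
  have hi (φ : ℝ → ℝ) (hφ : Continuous φ) :
      IntervalIntegrable (fun x => ((f x * φ x : ℝ) : ℂ)) volume 0 1 := by
    have := intervalIntegrable_mul f hφ
    rw [intervalIntegrable_iff] at this ⊢
    exact this.ofReal
  have h0 (n : ℤ) : fourierCoeffOn zero_lt_one (fun x => (f x : ℂ)) n = 0 := by
    rw [fourierCoeffOn_eq_integral]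
    have e : ∀ x : ℝ, fourier (-n) (x : AddCircle ((1 : ℝ) - 0)) • (f x : ℂ)
        = ((f x * Real.cos (2 * Real.pi * n * x) : ℝ) : ℂ)
          - ((f x * Real.sin (2 * Real.pi * n * x) : ℝ) : ℂ) * Complex.I := by
      intro x
      rw [fourier_coe_apply]
      have : (2 * Real.pi * Complex.I * ((-n : ℤ) : ℂ) * x / (((1 : ℝ) - 0 : ℝ) : ℂ))
          = ((-(2 * Real.pi * n * x) : ℝ) : ℂ) * Complex.I := by
        push_cast; ring
      rw [this, Complex.exp_mul_I, ← Complex.ofReal_cos, ← Complex.ofReal_sin, Real.cos_neg,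
        Real.sin_neg, smul_eq_mul]
      push_cast; ring
    simp only [e]
    rw [intervalIntegral.integral_sub, intervalIntegral.integral_mul_const,
      intervalIntegral.integral_ofReal, intervalIntegral.integral_ofReal, hc, hs]
    · simp
    · exact hi _ (by fun_prop)
    · exact (hi _ (by fun_prop)).mul_const _
  simp only [h0, norm_zero, ne_eq, OfNat.ofNat_ne_zero, not_false_eq_true, zero_pow] at hF
  have hz := hF.unique hasSum_zero
  simp only [sub_zero, inv_one, one_smul, Complex.norm_real,
    intervalIntegral.integral_of_le (zero_le_one' ℝ), Real.norm_eq_abs, sq_abs] at hz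
  rw [integral_eq_zero_iff_of_nonneg (fun x => sq_nonneg _) (Lp.memLp f).integrable_sq] at hz
  rw [Lp.eq_zero_iff_ae_eq_zero]
  filter_upwards [hz] with x hx
  simpa using hx

lemma IsWeakDeriv.unique {j : ℕ} {q g h : L2T} (hg : IsWeakDeriv j q g)
    (hh : IsWeakDeriv j q h) : g = h := by
  have hd : IsWeakDeriv j 0 (g + (-1 : ℝ) • h) := by
    simpa using hg.add (hh.smul (-1))
  have : g + (-1 : ℝ) • h = 0 := by
    refine eq_zero_of_forall_integral _ fun φ hφ => ?_
    have := hd φ hφ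
    rw [integral_zero_mul] at this
    simpa using this.symm
  simpa [add_neg_eq_zero] using this

/-- A test function of mean zero is the derivative of a test function of mean zero. -/
lemma exists_primitive {ψ : ℝ → ℝ} (hψ : ψ ∈ TestFn) (h0 : ∫ x in (0 : ℝ)..1, ψ x = 0) :
    ∃ φ ∈ TestFn, deriv φ = ψ ∧ ∫ x in (0 : ℝ)..1, φ x = 0 := by
  have hcont := hψ.1.continuous
  set F : ℝ → ℝ := fun x => ∫ t in (0 : ℝ)..x, ψ t with hF
  set c := ∫ x in (0 : ℝ)..1, F x
  have hd (x : ℝ) : HasDerivAt F (ψ x) x := hcont.integral_hasStrictDerivAt 0 x |>.hasDerivAt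
  have hFc : Continuous F := continuous_iff_continuousAt.2 fun x => (hd x).continuousAt
  have hder : deriv (fun x => F x - c) = ψ := by
    funext x
    exact ((hd x).sub_const c).deriv
  refine ⟨fun x => F x - c, ⟨?_, fun x => ?_⟩, hder, ?_⟩
  · rw [contDiff_infty_iff_deriv, hder]
    exact ⟨fun x => ((hd x).sub_const c).differentiableAt, hψ.1⟩
  · have : F (x + 1) = F x := by
      have := intervalIntegral.integral_add_adjacent_intervals
        (hcont.intervalIntegrable (μ := volume) 0 x) (hcont.intervalIntegrable x (x + 1))
      rw [hψ.2.intervalIntegral_add_eq x 0, zero_add, h0, add_zero] at this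
      exact this.symm
    simp only [this]
  · rw [intervalIntegral.integral_sub (hFc.intervalIntegrable _ _) (by simp)]
    simp [c]

lemma exists_iterated_primitive (j : ℕ) {ψ : ℝ → ℝ} (hψ : ψ ∈ TestFn)
    (h0 : ∫ x in (0 : ℝ)..1, ψ x = 0) :
    ∃ φ ∈ TestFn, iteratedDeriv j φ = ψ := by
  induction j generalizing ψ with
  | zero => exact ⟨ψ, hψ, by simp⟩
  | succ j ih =>
    obtain ⟨φ, hφ, hd, hm⟩ := exists_primitive hψ h0
    obtain ⟨χ, hχ, hj⟩ := ih hφ hm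
    exact ⟨χ, hχ, by rw [iteratedDeriv_succ, hj, hd]⟩

/-- A mean-zero function whose `j`-th weak derivative vanishes is zero. -/
lemma IsWeakDeriv.eq_zero {j : ℕ} {q : L2T} (h : IsWeakDeriv j q 0)
    (hm : ∫ x in (0 : ℝ)..1, q x = 0) : q = 0 := by
  refine eq_zero_of_forall_integral q fun ψ hψ => ?_
  set c := ∫ x in (0 : ℝ)..1, ψ x
  have hmem : (fun x => ψ x - c) ∈ TestFn :=
    ⟨hψ.1.sub contDiff_const, fun x => by simp [hψ.2 x]⟩
  have h0 : ∫ x in (0 : ℝ)..1, (ψ x - c) = 0 := by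
    rw [intervalIntegral.integral_sub (hψ.1.continuous.intervalIntegrable _ _) (by simp)]
    simp [c]
  obtain ⟨φ, hφ, hj⟩ := exists_iterated_primitive j hmem h0
  have := h φ hφ
  rw [integral_zero_mul, mul_zero, hj] at this
  simp only [mul_sub] at this
  rw [intervalIntegral.integral_sub (intervalIntegrable_mul q hψ.1.continuous)
    ((intervalIntegrable_L2T q).mul_const c), intervalIntegral.integral_mul_const, hm] at this
  simpa using this

/-! ### The spaces `ℋ_j`, `j ≥ 0` -/

/-- The underlying vector space of `ℋ_j`, `j ≥ 0`: the `q ∈ L²(𝕋)` with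
`q⁽ʲ⁾ ∈ L²(𝕋)` and `∫₀¹ q = 0`. -/
def sobolev (j : ℕ) : Submodule ℝ L2T where
  carrier := {q | (∃ g, IsWeakDeriv j q g) ∧ ∫ x in (0 : ℝ)..1, q x = 0}
  add_mem' := by
    rintro q r ⟨⟨g, hg⟩, hq⟩ ⟨⟨h, hh⟩, hr⟩
    refine ⟨⟨g + h, hg.add hh⟩, ?_⟩
    simpa [hq, hr] using integral_add_mul q r (continuous_const (y := (1 : ℝ)))
  zero_mem' := ⟨⟨0, isWeakDeriv_zero j⟩, by simpa using integral_zero_mul fun _ => 1⟩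
  smul_mem' := by
    rintro c q ⟨⟨g, hg⟩, hq⟩
    refine ⟨⟨c • g, hg.smul c⟩, ?_⟩
    simpa [hq] using integral_smul_mul c q fun _ => 1

/-- The space `ℋ_j`, `j ≥ 0`. Its norm is `‖q‖_j = ‖q⁽ʲ⁾‖_{L²}`, see below. -/
def Sob (j : ℕ) : Type := sobolev j

instance (j : ℕ) : AddCommGroup (Sob j) := inferInstanceAs (AddCommGroup (sobolev j))

instance (j : ℕ) : Module ℝ (Sob j) := inferInstanceAs (Module ℝ (sobolev j))

/-- The inclusion `ℋ_j ⊂ L²(𝕋)`. -/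
def Sob.toL2 {j : ℕ} : Sob j →ₗ[ℝ] L2T := (sobolev j).subtype

lemma Sob.toL2_injective {j : ℕ} : Function.Injective (Sob.toL2 : Sob j → L2T) :=
  Subtype.val_injective

lemma Sob.exists_weakDeriv {j : ℕ} (q : Sob j) : ∃ g, IsWeakDeriv j q.toL2 g := q.2.1

lemma Sob.integral_eq_zero {j : ℕ} (q : Sob j) : ∫ x in (0 : ℝ)..1, q.toL2 x = 0 := q.2.2

/-- The top derivative `q ↦ q⁽ʲ⁾`, from `ℋ_j` to `L²(𝕋)`. -/
def Sob.topDeriv {j : ℕ} : Sob j →ₗ[ℝ] L2T where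
  toFun q := q.exists_weakDeriv.choose
  map_add' q r := by
    refine (q + r).exists_weakDeriv.choose_spec.unique ?_
    rw [map_add]
    exact q.exists_weakDeriv.choose_spec.add r.exists_weakDeriv.choose_spec
  map_smul' c q := by
    refine (c • q).exists_weakDeriv.choose_spec.unique ?_
    rw [map_smul]
    exact q.exists_weakDeriv.choose_spec.smul c

lemma Sob.topDeriv_spec {j : ℕ} (q : Sob j) : IsWeakDeriv j q.toL2 q.topDeriv :=
  q.exists_weakDeriv.choose_spec

lemma Sob.topDeriv_injective {j : ℕ} : Function.Injective (Sob.topDeriv : Sob j → L2T) := by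
  rw [injective_iff_map_eq_zero]
  intro q hq
  have h := q.topDeriv_spec
  rw [hq] at h
  exact Sob.toL2_injective (by rw [h.eq_zero q.integral_eq_zero, map_zero])

/-- The norm `‖q‖_j = ‖q⁽ʲ⁾‖` of `ℋ_j`. -/
instance (j : ℕ) : NormedAddCommGroup (Sob j) :=
  NormedAddCommGroup.induced (Sob j) L2T Sob.topDeriv Sob.topDeriv_injective

lemma Sob.norm_def {j : ℕ} (q : Sob j) : ‖q‖ = ‖q.topDeriv‖ := rfl

/-- The inner product `(q⁽ʲ⁾, r⁽ʲ⁾)` of `ℋ_j`. -/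
instance (j : ℕ) : InnerProductSpace ℝ (Sob j) where
  norm_smul_le c q := by simp [Sob.norm_def, norm_smul]
  inner q r := inner ℝ q.topDeriv r.topDeriv
  norm_sq_eq_re_inner q := by simp [Sob.norm_def]
  conj_inner_symm q r := by simp [real_inner_comm]
  add_left q r s := by simp [inner_add_left]
  smul_left q r c := by simp [inner_smul_left]

/-! ### The space `ℋ₋₁` -/

/-- The distributional derivative `g ↦ g'` on the circle, `⟨g', φ⟩ = -∫₀¹ g φ'`. -/
def distribDeriv : Sob 0 →ₗ[ℝ] Module.Dual ℝ TestFn :=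
  LinearMap.mk₂ ℝ (fun (g : Sob 0) (φ : TestFn) =>
      -∫ x in (0 : ℝ)..1, g.toL2 x * deriv (φ : ℝ → ℝ) x)
    (fun g h φ => by
      rw [map_add, integral_add_mul _ _ (TestFn.deriv_mem φ.2).1.continuous, neg_add])
    (fun c g φ => by rw [map_smul, integral_smul_mul, smul_eq_mul, mul_neg])
    (fun g φ ψ => by
      rw [← neg_add, ← intervalIntegral.integral_add
        (intervalIntegrable_mul _ (TestFn.deriv_mem φ.2).1.continuous)
        (intervalIntegrable_mul _ (TestFn.deriv_mem ψ.2).1.continuous)]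
      congr 2
      funext x
      rw [← mul_add, Submodule.coe_add, deriv_add (φ.2.1.differentiable (by simp) x)
        (ψ.2.1.differentiable (by simp) x)])
    (fun c g φ => by
      rw [smul_eq_mul, mul_neg, ← intervalIntegral.integral_const_mul]
      congr 2
      funext x
      rw [Submodule.coe_smul, deriv_const_smul c (φ.2.1.differentiable (by simp) x),
        smul_eq_mul, mul_left_comm])

lemma distribDeriv_injective : Function.Injective distribDeriv := by
  rw [injective_iff_map_eq_zero]
  intro g hg
  have h : IsWeakDeriv 1 g.toL2 0 := by
    intro φ hφ
    have := LinearMap.congr_fun hg ⟨φ, hφ⟩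
    rw [integral_zero_mul, mul_zero, iteratedDeriv_one]
    simpa [distribDeriv] using this
  exact Sob.toL2_injective (by rw [h.eq_zero g.integral_eq_zero, map_zero])

/-- The space `ℋ₋₁ = {g' : g ∈ ℋ₀}` of distributions on the circle. Its norm is
`‖g'‖₋₁ = ‖g‖`, see below. -/
def SobNeg : Type := LinearMap.range distribDeriv

instance : AddCommGroup SobNeg := inferInstanceAs (AddCommGroup (LinearMap.range distribDeriv))

instance : Module ℝ SobNeg := inferInstanceAs (Module ℝ (LinearMap.range distribDeriv))

/-- An element of `ℋ₋₁` as a distribution. -/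
def SobNeg.toDistrib : SobNeg →ₗ[ℝ] Module.Dual ℝ TestFn :=
  (LinearMap.range distribDeriv).subtype

/-- The map `g' ↦ g`, from `ℋ₋₁` to `ℋ₀`. -/
def SobNeg.primitive : SobNeg ≃ₗ[ℝ] Sob 0 :=
  (LinearEquiv.ofInjective distribDeriv distribDeriv_injective).symm

lemma SobNeg.distribDeriv_primitive (f : SobNeg) : distribDeriv f.primitive = f.toDistrib :=
  congrArg Subtype.val
    ((LinearEquiv.ofInjective distribDeriv distribDeriv_injective).apply_symm_apply f)

/-- The norm `‖g'‖₋₁ = ‖g‖` of `ℋ₋₁`. -/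
instance : NormedAddCommGroup SobNeg :=
  NormedAddCommGroup.induced SobNeg (Sob 0) SobNeg.primitive.toLinearMap
    SobNeg.primitive.injective

lemma SobNeg.norm_def (f : SobNeg) : ‖f‖ = ‖f.primitive‖ := rfl

/-- The inner product `(g', h')₋₁ = (g, h)` of `ℋ₋₁`. -/
instance : InnerProductSpace ℝ SobNeg where
  norm_smul_le c f := by simp [SobNeg.norm_def, norm_smul]
  inner f h := inner ℝ f.primitive h.primitive
  norm_sq_eq_re_inner f := by simp [SobNeg.norm_def]
  conj_inner_symm f h := by simp [real_inner_comm]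
  add_left f h k := by simp [inner_add_left]
  smul_left f h c := by simp [inner_smul_left]

/-! ### The perturbed Riccati map -/

/-- `Q(x) = ∫₀ˣ q(t) dt`. -/
def primQ (q : L2T) (x : ℝ) : ℝ := ∫ t in (0 : ℝ)..x, q t

/-- `α q² + u`, where `u = A e^{-β Q}`. -/
def lowerTerm (α β A : ℝ) (q : L2T) (x : ℝ) : ℝ :=
  α * q x ^ 2 + A * Real.exp (-β * primQ q x)

/-- `c₀ = ∫₀¹ (α q² + u) dx`. -/
def meanTerm (α β A : ℝ) (q : L2T) : ℝ := ∫ x in (0 : ℝ)..1, lowerTerm α β A q x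

/-- `P : ℋ_{j+1} → ℋ_j` is the map `P(q) = q' + α q² + u - c₀`: every `q ∈ ℋ_{j+1}` has a weak
derivative `q' ∈ L²(𝕋)` and the formula holds almost everywhere. -/
def IsRiccatiMap (α β A : ℝ) {j : ℕ} (P : Sob (j + 1) → Sob j) : Prop :=
  ∀ q : Sob (j + 1), ∃ dq : L2T, IsWeakDeriv 1 q.toL2 dq ∧
    ∀ᵐ x ∂periodMeasure,
      (P q).toL2 x = dq x + lowerTerm α β A q.toL2 x - meanTerm α β A q.toL2

/-- `P : ℋ₀ → ℋ₋₁` is the map `P(q) = q' + α q² + u - c₀`, in the sense of distributions. -/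
def IsSingularRiccatiMap (α β A : ℝ) (P : Sob 0 → SobNeg) : Prop :=
  ∀ (q : Sob 0) (φ : TestFn),
    (P q).toDistrib φ = -(∫ x in (0 : ℝ)..1, q.toL2 x * deriv (φ : ℝ → ℝ) x)
      + ∫ x in (0 : ℝ)..1,
          (lowerTerm α β A q.toL2 x - meanTerm α β A q.toL2) * (φ : ℝ → ℝ) x

/-- A real analytic isomorphism: a real analytic bijection with real analytic inverse. -/
def IsRealAnalyticIso {E F : Type*} [NormedAddCommGroup E] [NormedSpace ℝ E]
    [NormedAddCommGroup F] [NormedSpace ℝ F] (f : E → F) : Prop :=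
  AnalyticOnNhd ℝ f univ ∧ ∃ g : F → E,
    Function.LeftInverse g f ∧ Function.RightInverse g f ∧ AnalyticOnNhd ℝ g univ

end

end RiccatiTorus

open RiccatiTorus

/-!
Write `D⁻¹` for the mean-zero primitive on the circle. Then `P(q)` is the derivative of
`F(q) = q + D⁻¹(α q² + u - c₀)`, and `F` is real analytic on `L²(𝕋)`. The difference of two
solutions of `F(q) = p`, and likewise an element of the kernel of `dF`, solves a linear problem
`r' + p r + z = const` in which `z` has the sign opposite to that of the primitive of `r`; a maximum
principle gives `r = 0`. Since `D⁻¹ : L¹ → L²` is compact, the Fredholm alternative makes `dF`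
invertible, so that `F` is an open embedding with real analytic inverse. A value `p` is attained as
soon as the solutions of `F(q) = t p` with `0 ≤ t ≤ 1` are bounded in `L²`, by continuation in `t`.
If `p' ∈ L²` the bound is `‖q‖ ≤ ‖q'‖ ≤ ‖P(q)‖`, since `(q', P(q) - q') ≥ 0`. For general `p` and
`α > 0` it comes from testing the equation against `e^{2αQ}`, where Chebyshev's inequality controls
the term `u`. Regularity is gained one derivative at a time from `q = F(q) - D⁻¹(α q² + u - c₀)`,
with real analytic dependence on parameters at each step.
-/

namespace RiccatiTorus

noncomputable section

open Filter Topology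
open scoped ENNReal BoundedContinuousFunction

/-! ### Integrals and exponentials on one period -/

/-- The space `L¹(0, 1)`. -/
abbrev L1T : Type := Lp ℝ 1 periodMeasure

/-- A bounded continuous function as an element of `L¹(0, 1)`. -/
def toL1 : (ℝ →ᵇ ℝ) →L[ℝ] L1T := BoundedContinuousFunction.toLp 1 periodMeasure ℝ

/-- A bounded continuous function as an element of `L²(0, 1)`. -/
def toL2 : (ℝ →ᵇ ℝ) →L[ℝ] L2T := BoundedContinuousFunction.toLp 2 periodMeasure ℝ

lemma coeFn_toL1 (g : ℝ →ᵇ ℝ) : toL1 g =ᵐ[periodMeasure] g :=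
  BoundedContinuousFunction.coeFn_toLp _ _ _ _

lemma coeFn_toL2 (g : ℝ →ᵇ ℝ) : toL2 g =ᵐ[periodMeasure] g :=
  BoundedContinuousFunction.coeFn_toLp _ _ _ _

lemma denseRange_toL1 : DenseRange toL1 :=
  BoundedContinuousFunction.toLp_denseRange ℝ periodMeasure ℝ (by simp)

/-- The product `L²(0, 1) × L²(0, 1) → L¹(0, 1)`. -/
def mulL2 : L2T →L[ℝ] L2T →L[ℝ] L1T :=
  (ContinuousLinearMap.mul ℝ ℝ).holderL periodMeasure 2 2 1

lemma coeFn_mulL2 (f g : L2T) : mulL2 f g =ᵐ[periodMeasure] fun x => f x * g x :=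
  (ContinuousLinearMap.mul ℝ ℝ).coeFn_holder f g

lemma mulL2_comm (f g : L2T) : mulL2 f g = mulL2 g f := by
  refine Lp.ext ?_
  filter_upwards [coeFn_mulL2 f g, coeFn_mulL2 g f] with x h1 h2
  rw [h1, h2, mul_comm]

lemma norm_mulL2_le (f g : L2T) : ‖mulL2 f g‖ ≤ ‖f‖ * ‖g‖ := by
  refine ((ContinuousLinearMap.mul ℝ ℝ).norm_holder_apply_apply_le f g).trans ?_
  simp

/-- Multiplication of `Lᵖ(0, 1)` functions by bounded continuous ones. -/
def mulB {p : ℝ≥0∞} [Fact (1 ≤ p)] :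
    (ℝ →ᵇ ℝ) →L[ℝ] Lp ℝ p periodMeasure →L[ℝ] Lp ℝ p periodMeasure :=
  ((ContinuousLinearMap.mul ℝ ℝ).holderL periodMeasure ∞ p p).comp
    (BoundedContinuousFunction.toLp ∞ periodMeasure ℝ)

lemma coeFn_mulB {p : ℝ≥0∞} [Fact (1 ≤ p)] (g : ℝ →ᵇ ℝ) (f : Lp ℝ p periodMeasure) :
    mulB g f =ᵐ[periodMeasure] fun x => g x * f x := by
  filter_upwards [(ContinuousLinearMap.mul ℝ ℝ).coeFn_holder (r := p)
    (BoundedContinuousFunction.toLp ∞ periodMeasure ℝ g) f,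
    BoundedContinuousFunction.coeFn_toLp ∞ periodMeasure ℝ g] with x h_mul h_coe
  rw [← h_coe]
  exact h_mul

/-- The inclusion `L²(0, 1) ⊂ L¹(0, 1)`. -/
def inclL1 : L2T →L[ℝ] L1T := mulL2 (toL2 1)

lemma coeFn_inclL1 (f : L2T) : inclL1 f =ᵐ[periodMeasure] f := by
  filter_upwards [coeFn_mulL2 (toL2 1) f, coeFn_toL2 1] with x h1 h2
  rw [inclL1, h1, h2]
  simp

lemma ae_Icc : ∀ᵐ x ∂periodMeasure, x ∈ Icc (0 : ℝ) 1 := by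
  filter_upwards [ae_restrict_mem measurableSet_Ioc] with x hx using Ioc_subset_Icc_self hx

lemma integral_congr_period {f g : ℝ → ℝ} (h : f =ᵐ[periodMeasure] g) {x : ℝ}
    (hx : x ∈ Icc (0 : ℝ) 1) : ∫ t in (0 : ℝ)..x, f t = ∫ t in (0 : ℝ)..x, g t := by
  rw [intervalIntegral.integral_of_le hx.1, intervalIntegral.integral_of_le hx.1]
  exact integral_congr_ae
    (ae_mono (Measure.restrict_mono (Ioc_subset_Ioc_right hx.2) le_rfl) h)

lemma integral_period_congr {f g : ℝ → ℝ} (h : f =ᵐ[periodMeasure] g) :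
    ∫ t in (0 : ℝ)..1, f t = ∫ t in (0 : ℝ)..1, g t :=
  integral_congr_period h (by simp)

lemma integral_Iic_eq (f : ℝ → ℝ) {x : ℝ} (hx : x ∈ Icc (0 : ℝ) 1) :
    ∫ t in Iic x, f t ∂periodMeasure = ∫ t in (0 : ℝ)..x, f t := by
  rw [intervalIntegral.integral_of_le hx.1, periodMeasure,
    Measure.restrict_restrict measurableSet_Iic]
  congr 2
  ext t
  simp only [mem_inter_iff, mem_Iic, mem_Ioc]
  grind

lemma continuous_integral_Iic (f : L1T) :
    Continuous fun x => ∫ t in Iic x, f t ∂periodMeasure := by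
  have h := L1.integrable_coeFn f
  have h_split : (fun x => ∫ t in Iic x, f t ∂periodMeasure)
      = fun x => (∫ t in Iic (0 : ℝ), f t ∂periodMeasure)
          + ∫ t in (0 : ℝ)..x, f t ∂periodMeasure := by
    funext x
    rw [← intervalIntegral.integral_Iic_sub_Iic h.integrableOn h.integrableOn]
    ring
  rw [h_split]
  exact continuous_const.add
    (intervalIntegral.continuous_primitive (fun a b => h.intervalIntegrable) 0)

lemma norm_setIntegral_L1T_le (f : L1T) (s : Set ℝ) :
    ‖∫ t in s, f t ∂periodMeasure‖ ≤ ‖f‖ := by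
  rw [L1.norm_eq_integral_norm]
  exact (norm_integral_le_integral_norm _).trans
    (setIntegral_le_integral (L1.integrable_coeFn f).norm
      (Eventually.of_forall fun _ => norm_nonneg _))

/-- The primitive `x ↦ ∫₀ˣ f` of an integrable function on `(0, 1)`. -/
def primitive : L1T →L[ℝ] (ℝ →ᵇ ℝ) :=
  LinearMap.mkContinuous
    { toFun := fun f => BoundedContinuousFunction.ofNormedAddCommGroup
        (fun x => ∫ t in Iic x, f t ∂periodMeasure) (continuous_integral_Iic f) ‖f‖
        (fun x => norm_setIntegral_L1T_le f (Iic x))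
      map_add' := fun f g => by
        ext x
        simp only [BoundedContinuousFunction.coe_ofNormedAddCommGroup,
          BoundedContinuousFunction.coe_add, Pi.add_apply]
        rw [← integral_add (L1.integrable_coeFn f).integrableOn
          (L1.integrable_coeFn g).integrableOn]
        refine integral_congr_ae (ae_restrict_of_ae ?_)
        filter_upwards [Lp.coeFn_add f g] with t ht using ht
      map_smul' := fun c f => by
        ext x
        simp only [BoundedContinuousFunction.coe_ofNormedAddCommGroup, RingHom.id_apply,
          BoundedContinuousFunction.coe_smul]
        rw [← integral_smul]
        refine integral_congr_ae (ae_restrict_of_ae ?_)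
        filter_upwards [Lp.coeFn_smul c f] with t ht using ht } 1
    (fun f => by
      rw [one_mul]
      exact BoundedContinuousFunction.norm_ofNormedAddCommGroup_le _ (norm_nonneg _)
        (fun x => norm_setIntegral_L1T_le f (Iic x)))

lemma primitive_apply (f : L1T) {x : ℝ} (hx : x ∈ Icc (0 : ℝ) 1) :
    primitive f x = ∫ t in (0 : ℝ)..x, f t :=
  integral_Iic_eq _ hx

lemma primitive_of_ae {f : L1T} {g : ℝ → ℝ} (h : f =ᵐ[periodMeasure] g) {x : ℝ}
    (hx : x ∈ Icc (0 : ℝ) 1) : primitive f x = ∫ t in (0 : ℝ)..x, g t := by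
  rw [primitive_apply f hx, integral_congr_period h hx]

lemma primitive_zero_right (f : L1T) : primitive f 0 = 0 := by
  rw [primitive_apply f (by simp)]; simp

lemma primitive_one (f : L1T) : primitive f 1 = ∫ t in (0 : ℝ)..1, f t :=
  primitive_apply f (by simp)

lemma primitive_one_of_ae {f : L1T} {g : ℝ → ℝ} (h : f =ᵐ[periodMeasure] g) :
    primitive f 1 = ∫ t in (0 : ℝ)..1, g t := primitive_of_ae h (by simp)

lemma abs_primitive_le (f : L1T) (x : ℝ) : |primitive f x| ≤ ‖f‖ :=
  norm_setIntegral_L1T_le f (Iic x)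

lemma primitive_toL1 (g : ℝ →ᵇ ℝ) {x : ℝ} (hx : x ∈ Icc (0 : ℝ) 1) :
    primitive (toL1 g) x = ∫ t in (0 : ℝ)..x, g t := primitive_of_ae (coeFn_toL1 g) hx

lemma primitive_toL1_one {x : ℝ} (hx : x ∈ Icc (0 : ℝ) 1) : primitive (toL1 1) x = x := by
  rw [primitive_toL1 _ hx]; simp

lemma continuous_eval (x : ℝ) : Continuous fun g : ℝ →ᵇ ℝ => g x :=
  (BoundedContinuousFunction.evalCLM ℝ x).continuous

lemma hasDerivAt_integral (a : ℝ →ᵇ ℝ) (t : ℝ) :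
    HasDerivAt (fun x => ∫ s in (0 : ℝ)..x, a s) (a t) t :=
  (a.continuous.integral_hasStrictDerivAt 0 t).hasDerivAt

/-- Both sides are continuous in `(a, b)`, so that it suffices to treat continuous functions. -/
lemma primitive_mul_primitive (a b : L1T) {x : ℝ} (hx : x ∈ Icc (0 : ℝ) 1) :
    primitive a x * primitive b x
      = primitive (mulB (primitive a) b + mulB (primitive b) a) x := by
  refine denseRange_toL1.induction_on₂ (p := fun a b => primitive a x * primitive b x
      = primitive (mulB (primitive a) b + mulB (primitive b) a) x) ?_ ?_ a b
  · refine isClosed_eq ?_ ?_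
    · exact ((continuous_eval x).comp (primitive.continuous.comp continuous_fst)).mul
        ((continuous_eval x).comp (primitive.continuous.comp continuous_snd))
    · refine (continuous_eval x).comp (primitive.continuous.comp ?_)
      fun_prop
  · intro a b
    have hae : (mulB (primitive (toL1 a)) (toL1 b) + mulB (primitive (toL1 b)) (toL1 a) : L1T)
        =ᵐ[periodMeasure] fun t =>
          a t * (∫ s in (0 : ℝ)..t, b s) + (∫ s in (0 : ℝ)..t, a s) * b t := by
      filter_upwards [Lp.coeFn_add (mulB (primitive (toL1 a)) (toL1 b))
        (mulB (primitive (toL1 b)) (toL1 a)), coeFn_mulB (primitive (toL1 a)) (toL1 b),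
        coeFn_mulB (primitive (toL1 b)) (toL1 a), coeFn_toL1 a, coeFn_toL1 b, ae_Icc]
        with t h1 h2 h3 h4 h5 ht
      rw [h1, Pi.add_apply, h2, h3, h4, h5, primitive_toL1 _ ht, primitive_toL1 _ ht]
      ring
    rw [primitive_of_ae hae hx, primitive_toL1 _ hx, primitive_toL1 _ hx,
      intervalIntegral.integral_deriv_mul_eq_sub (fun t _ => hasDerivAt_integral a t)
        (fun t _ => hasDerivAt_integral b t) (a.continuous.intervalIntegrable _ _)
        (b.continuous.intervalIntegrable _ _)]
    simp

/-- The pointwise exponential, obtained from the Banach algebra `ℝ →ᵇ ℝ` so that its analyticity is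
that of the exponential series. -/
def expB (g : ℝ →ᵇ ℝ) : ℝ →ᵇ ℝ := NormedSpace.exp g

lemma expB_apply (g : ℝ →ᵇ ℝ) (x : ℝ) : expB g x = Real.exp (g x) := by
  let ev : (ℝ →ᵇ ℝ) →+* ℝ :=
    { toFun := fun g => g x, map_one' := rfl, map_mul' := fun _ _ => rfl, map_zero' := rfl,
      map_add' := fun _ _ => rfl }
  let _ : NormedAlgebra ℚ (ℝ →ᵇ ℝ) := NormedAlgebra.restrictScalars ℚ ℝ (ℝ →ᵇ ℝ)
  have := NormedSpace.map_exp ev (continuous_eval x) g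
  rw [Real.exp_eq_exp_ℝ]
  exact this

lemma analyticAt_expB (g : ℝ →ᵇ ℝ) : AnalyticAt ℝ expB g := NormedSpace.exp_analytic g

lemma continuous_expB : Continuous expB :=
  continuous_iff_continuousAt.2 fun g => (analyticAt_expB g).continuousAt

lemma hasFDerivAt_expB (g : ℝ →ᵇ ℝ) :
    HasFDerivAt expB (expB g • (1 : (ℝ →ᵇ ℝ) →L[ℝ] (ℝ →ᵇ ℝ))) g := hasFDerivAt_exp

lemma exp_primitive (a : L1T) {x : ℝ} (hx : x ∈ Icc (0 : ℝ) 1) :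
    Real.exp (primitive a x) = 1 + primitive (mulB (expB (primitive a)) a) x := by
  refine denseRange_toL1.induction_on (p := fun a => Real.exp (primitive a x)
      = 1 + primitive (mulB (expB (primitive a)) a) x) a ?_ ?_
  · refine isClosed_eq ?_ ?_
    · exact Real.continuous_exp.comp ((continuous_eval x).comp primitive.continuous)
    · refine continuous_const.add ((continuous_eval x).comp (primitive.continuous.comp ?_))
      exact (mulB.continuous.comp (continuous_expB.comp primitive.continuous)).clm_apply
        continuous_id
  · intro a
    have hae : mulB (expB (primitive (toL1 a))) (toL1 a) =ᵐ[periodMeasure]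
        fun t => Real.exp (∫ s in (0 : ℝ)..t, a s) * a t := by
      filter_upwards [coeFn_mulB (expB (primitive (toL1 a))) (toL1 a), coeFn_toL1 a, ae_Icc]
        with t h1 h2 ht
      rw [h1, h2, expB_apply, primitive_toL1 _ ht]
    rw [primitive_of_ae hae hx, primitive_toL1 _ hx,
      intervalIntegral.integral_eq_sub_of_hasDerivAt
        (f := fun t => Real.exp (∫ s in (0 : ℝ)..t, a s))
        (fun t _ => (hasDerivAt_integral a t).exp)]
    · simp
    · refine Continuous.intervalIntegrable ?_ _ _
      exact (Real.continuous_exp.comp (continuous_iff_continuousAt.2 fun t =>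
        (hasDerivAt_integral a t).continuousAt)).mul a.continuous

/-- `ρ` is absolutely continuous on `[0, 1]` with derivative `a`. -/
def HasL1Deriv (ρ : ℝ →ᵇ ℝ) (a : L1T) : Prop :=
  ∀ ⦃x⦄, x ∈ Icc (0 : ℝ) 1 → ρ x = ρ 0 + primitive a x

lemma hasL1Deriv_expB_primitive (a : L1T) :
    HasL1Deriv (expB (primitive a)) (mulB (expB (primitive a)) a) := by
  intro x hx
  rw [expB_apply, expB_apply, primitive_zero_right, Real.exp_zero, exp_primitive a hx]

namespace HasL1Deriv

variable {ρ σ : ℝ →ᵇ ℝ} {a b : L1T}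

lemma const_smul (h : HasL1Deriv ρ a) (c : ℝ) : HasL1Deriv (c • ρ) (c • a) := by
  intro x hx
  simp only [map_smul, BoundedContinuousFunction.coe_smul, smul_eq_mul]
  rw [h hx]
  ring

lemma mulB_eq (h : HasL1Deriv ρ a) (f : L1T) : mulB ρ f = ρ 0 • f + mulB (primitive a) f := by
  refine Lp.ext ?_
  filter_upwards [coeFn_mulB ρ f, Lp.coeFn_add (ρ 0 • f) (mulB (primitive a) f),
    Lp.coeFn_smul (ρ 0) f, coeFn_mulB (primitive a) f, ae_Icc] with x h1 h2 h3 h4 hx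
  rw [h1, h2, Pi.add_apply, h3, Pi.smul_apply, h4, h hx, smul_eq_mul]
  ring

lemma mul (hρ : HasL1Deriv ρ a) (hσ : HasL1Deriv σ b) :
    HasL1Deriv (ρ * σ) (mulB ρ b + mulB σ a) := by
  intro x hx
  have h_eq : mulB ρ b + mulB σ a
      = ρ 0 • b + σ 0 • a + (mulB (primitive a) b + mulB (primitive b) a) := by
    rw [hρ.mulB_eq, hσ.mulB_eq]
    abel
  rw [h_eq, map_add, BoundedContinuousFunction.add_apply, ← primitive_mul_primitive a b hx,
    map_add, map_smul, map_smul]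
  simp only [BoundedContinuousFunction.coe_mul, BoundedContinuousFunction.coe_add,
    BoundedContinuousFunction.coe_smul, Pi.mul_apply, Pi.add_apply, smul_eq_mul]
  rw [hρ hx, hσ hx]
  ring

end HasL1Deriv

/-! ### Weak derivatives as almost everywhere derivatives -/

lemma intervalIntegrable_L1T (f : L1T) : IntervalIntegrable f volume 0 1 := by
  rw [intervalIntegrable_iff_integrableOn_Ioc_of_le zero_le_one]
  exact L1.integrable_coeFn f

lemma integral_L2T_add (q r : L2T) : ∫ x in (0 : ℝ)..1, (q + r : L2T) x
    = (∫ x in (0 : ℝ)..1, q x) + ∫ x in (0 : ℝ)..1, r x := by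
  simpa only [mul_one] using integral_add_mul q r (continuous_const (y := (1 : ℝ)))

lemma integral_L2T_smul (c : ℝ) (q : L2T) : ∫ x in (0 : ℝ)..1, (c • q : L2T) x
    = c * ∫ x in (0 : ℝ)..1, q x := by
  simpa only [mul_one] using integral_smul_mul c q fun _ => 1

lemma integral_toL2_one : ∫ x in (0 : ℝ)..1, toL2 1 x = 1 := by
  rw [integral_period_congr (coeFn_toL2 1)]; simp

lemma primitive_inclL1_one (g : L2T) : primitive (inclL1 g) 1 = ∫ x in (0 : ℝ)..1, g x :=
  primitive_one_of_ae (coeFn_inclL1 g)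

lemma TestFn.exists_bcf {φ : ℝ → ℝ} (hφ : φ ∈ TestFn) : ∃ g : ℝ →ᵇ ℝ, ⇑g = φ := by
  obtain ⟨C, hC⟩ := (isCompact_Icc (a := (0 : ℝ)) (b := 1)).exists_bound_of_continuousOn
    hφ.1.continuous.continuousOn
  refine ⟨BoundedContinuousFunction.ofNormedAddCommGroup φ hφ.1.continuous C fun x => ?_, rfl⟩
  obtain ⟨y, hy, hxy⟩ := hφ.2.exists_mem_Ico₀ one_pos x
  rw [hxy]
  exact hC y (Ico_subset_Icc_self hy)

lemma integral_primitive_mul_deriv (f : L1T) {φ : ℝ → ℝ} (hφ : φ ∈ TestFn) :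
    ∫ x in (0 : ℝ)..1, primitive f x * deriv φ x
      = φ 1 * primitive f 1 - ∫ x in (0 : ℝ)..1, f x * φ x := by
  obtain ⟨ψ, hψ⟩ := TestFn.exists_bcf (TestFn.deriv_mem hφ)
  have hd (x : ℝ) : HasDerivAt φ (deriv φ x) x := (hφ.1.differentiable (by simp) x).hasDerivAt
  have hprim {x : ℝ} (hx : x ∈ Icc (0 : ℝ) 1) : primitive (toL1 ψ) x = φ x - φ 0 := by
    rw [primitive_toL1 _ hx, hψ]
    exact intervalIntegral.integral_deriv_eq_sub (fun x _ => (hd x).differentiableAt)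
      ((TestFn.deriv_mem hφ).1.continuous.intervalIntegrable _ _)
  have h := primitive_mul_primitive f (toL1 ψ) (x := 1) (by simp)
  have hae : (mulB (primitive f) (toL1 ψ) + mulB (primitive (toL1 ψ)) f : L1T)
      =ᵐ[periodMeasure] fun x => primitive f x * deriv φ x + (f x * φ x - f x * φ 0) := by
    filter_upwards [Lp.coeFn_add (mulB (primitive f) (toL1 ψ)) (mulB (primitive (toL1 ψ)) f),
      coeFn_mulB (primitive f) (toL1 ψ), coeFn_mulB (primitive (toL1 ψ)) f, coeFn_toL1 ψ,
      ae_Icc] with x h1 h2 h3 h4 hx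
    rw [h1, Pi.add_apply, h2, h3, h4, hprim hx, hψ]
    ring
  have hf := intervalIntegrable_L1T f
  have hfφ : IntervalIntegrable (fun x => f x * φ x) volume 0 1 :=
    hf.mul_continuousOn hφ.1.continuous.continuousOn
  have hfd : IntervalIntegrable (fun x => primitive f x * deriv φ x) volume 0 1 :=
    ((primitive f).continuous.mul (TestFn.deriv_mem hφ).1.continuous).intervalIntegrable _ _
  rw [primitive_one_of_ae hae, hprim (by simp), intervalIntegral.integral_add hfd
    (hfφ.sub (hf.mul_const _)), intervalIntegral.integral_sub hfφ (hf.mul_const _),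
    intervalIntegral.integral_mul_const, ← primitive_one] at h
  linarith

lemma TestFn.integral_deriv {φ : ℝ → ℝ} (hφ : φ ∈ TestFn) :
    ∫ x in (0 : ℝ)..1, deriv φ x = 0 := by
  have h_per : φ 1 = φ 0 := by simpa using hφ.2 0
  rw [intervalIntegral.integral_deriv_eq_sub (fun x _ => hφ.1.differentiable (by simp) x)
    ((TestFn.deriv_mem hφ).1.continuous.intervalIntegrable _ _), h_per, sub_self]

lemma isWeakDeriv_one_of_ae_eq {q g : L2T} {c : ℝ} (hg : ∫ x in (0 : ℝ)..1, g x = 0)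
    (hq : q =ᵐ[periodMeasure] fun x => c + primitive (inclL1 g) x) : IsWeakDeriv 1 q g := by
  intro φ hφ
  have h_cont := (TestFn.deriv_mem hφ).1.continuous
  have h_split : ∫ x in (0 : ℝ)..1, q x * iteratedDeriv 1 φ x
      = ∫ x in (0 : ℝ)..1, (c * deriv φ x + primitive (inclL1 g) x * deriv φ x) := by
    refine integral_period_congr ?_
    filter_upwards [hq] with x hx
    rw [hx, iteratedDeriv_one, add_mul]
  have h_incl : ∫ x in (0 : ℝ)..1, inclL1 g x * φ x = ∫ x in (0 : ℝ)..1, g x * φ x := by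
    refine integral_period_congr ?_
    filter_upwards [coeFn_inclL1 g] with x hx
    rw [hx]
  have h_int : IntervalIntegrable (fun x => primitive (inclL1 g) x * deriv φ x) volume 0 1 :=
    ((primitive (inclL1 g)).continuous.mul h_cont).intervalIntegrable _ _
  rw [h_split, intervalIntegral.integral_add ((h_cont.intervalIntegrable _ _).const_mul _) h_int,
    intervalIntegral.integral_const_mul, integral_primitive_mul_deriv _ hφ,
    primitive_inclL1_one, hg, h_incl, TestFn.integral_deriv hφ]
  ring

lemma isWeakDeriv_one_const (c : ℝ) : IsWeakDeriv 1 (c • toL2 1) 0 := by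
  refine isWeakDeriv_one_of_ae_eq (c := c) (integral_period_congr (Lp.coeFn_zero ℝ 2 _) |>.trans
    (by simp)) ?_
  filter_upwards [Lp.coeFn_smul c (toL2 1), coeFn_toL2 1] with x h1 h2
  rw [h1, Pi.smul_apply, h2]
  simp

lemma IsWeakDeriv.integral_eq_zero {q g : L2T} (h : IsWeakDeriv 1 q g) :
    ∫ x in (0 : ℝ)..1, g x = 0 := by
  simpa using (h (fun _ => 1) ⟨contDiff_const, fun _ => rfl⟩).symm

lemma IsWeakDeriv.sub {j : ℕ} {q r g h : L2T} (hq : IsWeakDeriv j q g)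
    (hr : IsWeakDeriv j r h) : IsWeakDeriv j (q - r) (g - h) := by
  simpa [sub_eq_add_neg] using hq.add (hr.smul (-1))

lemma IsWeakDeriv.eq_of_integral_eq {j : ℕ} {q r g : L2T} (hq : IsWeakDeriv j q g)
    (hr : IsWeakDeriv j r g)
    (h : ∫ x in (0 : ℝ)..1, q x = ∫ x in (0 : ℝ)..1, r x) : q = r := by
  have h_deriv : IsWeakDeriv j (q - r) 0 := by simpa using hq.sub hr
  refine sub_eq_zero.1 (h_deriv.eq_zero ?_)
  rw [sub_eq_add_neg, ← neg_one_smul ℝ r, integral_L2T_add, integral_L2T_smul, h]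
  ring

lemma IsWeakDeriv.exists_ae_eq {q g : L2T} (h : IsWeakDeriv 1 q g) :
    ∃ c : ℝ, q =ᵐ[periodMeasure] fun x => c + primitive (inclL1 g) x := by
  set r : L2T := toL2 (primitive (inclL1 g))
  set c : ℝ := (∫ x in (0 : ℝ)..1, q x) - ∫ x in (0 : ℝ)..1, r x
  have hr : IsWeakDeriv 1 r g := isWeakDeriv_one_of_ae_eq (c := 0) h.integral_eq_zero (by
    filter_upwards [coeFn_toL2 (primitive (inclL1 g))] with x hx
    rw [hx, zero_add])
  have h_eq : q = c • toL2 1 + r := by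
    refine h.eq_of_integral_eq (by simpa using (isWeakDeriv_one_const c).add hr) ?_
    rw [integral_L2T_add, integral_L2T_smul, integral_toL2_one]
    ring
  refine ⟨c, ?_⟩
  filter_upwards [Lp.coeFn_add (c • toL2 1) r, Lp.coeFn_smul c (toL2 1), coeFn_toL2 1,
    coeFn_toL2 (primitive (inclL1 g))] with x h1 h2 h3 h4
  rw [h_eq, h1, Pi.add_apply, h2, Pi.smul_apply, h3, h4]
  simp

lemma IsWeakDeriv.trans {i j : ℕ} {q g h : L2T} (hq : IsWeakDeriv i q g)
    (hg : IsWeakDeriv j g h) : IsWeakDeriv (i + j) q h := by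
  intro φ hφ
  have h_comp : iteratedDeriv (i + j) φ = iteratedDeriv i (iteratedDeriv j φ) := by
    simp only [iteratedDeriv_eq_iterate, Function.iterate_add_apply]
  rw [h_comp, hq _ (TestFn.iteratedDeriv_mem hφ j), hg φ hφ, pow_add, mul_assoc]

/-! ### Norms in `L¹` and `L²` -/

lemma inner_L2T (q r : L2T) : inner ℝ q r = ∫ x in (0 : ℝ)..1, q x * r x := by
  rw [L2.inner_def, intervalIntegral.integral_of_le zero_le_one]
  refine integral_congr_ae (Eventually.of_forall fun x => ?_)
  simp [mul_comm]

lemma norm_sq_L2T (q : L2T) : ‖q‖ ^ 2 = ∫ x in (0 : ℝ)..1, q x ^ 2 := by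
  rw [← real_inner_self_eq_norm_sq, inner_L2T]
  simp only [pow_two]

lemma norm_sq_of_ae {q : L2T} {g : ℝ → ℝ} (h : q =ᵐ[periodMeasure] g) :
    ‖q‖ ^ 2 = ∫ x in (0 : ℝ)..1, g x ^ 2 := by
  rw [norm_sq_L2T]
  refine integral_period_congr ?_
  filter_upwards [h] with x hx
  rw [hx]

lemma norm_L1T (f : L1T) : ‖f‖ = ∫ x in (0 : ℝ)..1, |f x| := by
  rw [L1.norm_eq_integral_norm, intervalIntegral.integral_of_le zero_le_one]
  rfl

lemma norm_toL2_one : ‖toL2 1‖ = 1 := by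
  have := norm_sq_of_ae (coeFn_toL2 1)
  simp only [BoundedContinuousFunction.coe_one, Pi.one_apply, one_pow,
    intervalIntegral.integral_const, sub_zero, smul_eq_mul, mul_one] at this
  exact (pow_eq_one_iff_of_nonneg (norm_nonneg _) two_ne_zero).1 this

lemma norm_inclL1_le (q : L2T) : ‖inclL1 q‖ ≤ ‖q‖ :=
  (norm_mulL2_le (toL2 1) q).trans_eq (by rw [norm_toL2_one, one_mul])

lemma abs_primitive_inclL1_le (q : L2T) (x : ℝ) : |primitive (inclL1 q) x| ≤ ‖q‖ :=
  (abs_primitive_le _ _).trans (norm_inclL1_le q)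

lemma norm_toL1_le (g : ℝ →ᵇ ℝ) {C : ℝ} (hg : ∀ x, |g x| ≤ C) : ‖toL1 g‖ ≤ C := by
  rw [norm_L1T, integral_period_congr (g := fun x => |g x|)
    (by filter_upwards [coeFn_toL1 g] with x hx; rw [hx])]
  refine (intervalIntegral.integral_mono_on zero_le_one
    (g.continuous.abs.intervalIntegrable _ _) intervalIntegrable_const
    fun x _ => hg x).trans ?_
  simp

/-! ### Compactness of the primitive -/

lemma intervalIntegrable_subinterval {f : ℝ → ℝ} (h : IntervalIntegrable f volume 0 1) {x y : ℝ}
    (hx : x ∈ Icc (0 : ℝ) 1) (hy : y ∈ Icc (0 : ℝ) 1) : IntervalIntegrable f volume x y := by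
  refine h.mono_set ?_
  rw [uIcc_of_le zero_le_one]
  exact uIcc_subset_Icc hx hy

lemma primitive_sub_primitive (f : L1T) {x y : ℝ} (hx : x ∈ Icc (0 : ℝ) 1)
    (hy : y ∈ Icc (0 : ℝ) 1) : primitive f y - primitive f x = ∫ t in x..y, f t := by
  rw [primitive_apply f hx, primitive_apply f hy]
  exact intervalIntegral.integral_interval_sub_left
    (intervalIntegrable_subinterval (intervalIntegrable_L1T f) (by simp) hy)
    (intervalIntegrable_subinterval (intervalIntegrable_L1T f) (by simp) hx)

/-- Approximation of the primitive by step functions with `n` steps. -/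
def stepPrimitive (n : ℕ) : L1T →L[ℝ] L2T :=
  ∑ k ∈ Finset.range n,
    ((BoundedContinuousFunction.evalCLM ℝ ((k : ℝ) / n)).comp primitive).smulRight
      (indicatorConstLp 2 (μ := periodMeasure)
        (measurableSet_Ioc (a := (k : ℝ) / n) (b := ((k + 1 : ℕ) : ℝ) / n))
        (measure_ne_top _ _) (1 : ℝ))

lemma isCompactOperator_smulRight {E F : Type*} [NormedAddCommGroup E] [NormedSpace ℝ E]
    [NormedAddCommGroup F] [NormedSpace ℝ F] (l : E →L[ℝ] ℝ) (v : F) :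
    IsCompactOperator (l.smulRight v) := by
  have : (l.smulRight v : E → F) = (ContinuousLinearMap.toSpanSingleton ℝ v) ∘ l := by
    ext x; simp
  rw [this]
  exact (isCompactOperator_of_locallyCompactSpace_dom l).clm_comp
    (ContinuousLinearMap.toSpanSingleton ℝ v)

lemma isCompactOperator_stepPrimitive (n : ℕ) : IsCompactOperator (stepPrimitive n) := by
  have : stepPrimitive n ∈ compactOperator (RingHom.id ℝ) L1T L2T :=
    Submodule.sum_mem _ fun k _ => isCompactOperator_smulRight _ _
  exact this

lemma coeFn_stepPrimitive (n : ℕ) (f : L1T) : stepPrimitive n f =ᵐ[periodMeasure]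
    fun x => ∑ k ∈ Finset.range n, primitive f ((k : ℝ) / n) *
      (Ioc ((k : ℝ) / n) (((k + 1 : ℕ) : ℝ) / n)).indicator (fun _ => (1 : ℝ)) x := by
  rw [stepPrimitive, sum_apply]
  refine (Lp.coeFn_finsetSum _ _).trans ?_
  have (k : ℕ) := (Lp.coeFn_smul (primitive f ((k : ℝ) / n))
      (indicatorConstLp 2 (μ := periodMeasure)
        (measurableSet_Ioc (a := (k : ℝ) / n) (b := ((k + 1 : ℕ) : ℝ) / n))
        (measure_ne_top _ _) (1 : ℝ))).and (indicatorConstLp_coeFn (p := 2) (μ := periodMeasure)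
        (hs := measurableSet_Ioc (a := (k : ℝ) / n) (b := ((k + 1 : ℕ) : ℝ) / n))
        (hμs := measure_ne_top _ _) (c := (1 : ℝ)))
  filter_upwards [ae_all_iff.2 this] with x hx
  rw [Finset.sum_apply]
  refine Finset.sum_congr rfl fun k _ => ?_
  rw [← (hx k).2]
  exact (hx k).1

lemma natCast_div_mem_Icc {k n : ℕ} (hk : k ≤ n) : (k : ℝ) / n ∈ Icc (0 : ℝ) 1 :=
  ⟨by positivity, div_le_one_of_le₀ (by exact_mod_cast hk) (by positivity)⟩

lemma sum_integral_Ioc_div {n : ℕ} (hn : 0 < n) {g : ℝ → ℝ}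
    (hg : IntervalIntegrable g volume 0 1) :
    ∑ k ∈ Finset.range n, ∫ x in ((k : ℝ) / n)..((k + 1 : ℕ) : ℝ) / n, g x
      = ∫ x in (0 : ℝ)..1, g x := by
  have hn' : (n : ℝ) ≠ 0 := by positivity
  rw [intervalIntegral.sum_integral_adjacent_intervals (a := fun k : ℕ => (k : ℝ) / n)
    fun k hk => intervalIntegrable_subinterval hg (natCast_div_mem_Icc hk.le)
      (natCast_div_mem_Icc hk)]
  simp [hn']

lemma stepPrimitive_ae_eq {n k : ℕ} (hk : k < n) (f : L1T) :
    ∀ᵐ x ∂periodMeasure, x ∈ Ioc ((k : ℝ) / n) (((k + 1 : ℕ) : ℝ) / n) →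
      stepPrimitive n f x = primitive f ((k : ℝ) / n) := by
  filter_upwards [coeFn_stepPrimitive n f] with x h_step hx
  rw [h_step, Finset.sum_eq_single k]
  · rw [indicator_of_mem hx, mul_one]
  · intro l _ hl
    have h_mono : Monotone fun m : ℕ => (m : ℝ) / n := fun a b hab => by
      dsimp only; gcongr
    have hxl : x ∉ Ioc ((l : ℝ) / n) (((l + 1 : ℕ) : ℝ) / n) := fun hxl =>
      disjoint_left.1 (h_mono.pairwise_disjoint_on_Ioc_succ hl) hxl hx
    rw [indicator_of_notMem hxl, mul_zero]
  · exact fun h => absurd (Finset.mem_range.2 hk) h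

lemma integral_sub_stepPrimitive_sq_le {n k : ℕ} (hk : k < n) (f : L1T) :
    ∫ x in ((k : ℝ) / n)..((k + 1 : ℕ) : ℝ) / n, (toL2 (primitive f) - stepPrimitive n f) x ^ 2
      ≤ ‖f‖ / n * ∫ x in ((k : ℝ) / n)..((k + 1 : ℕ) : ℝ) / n, |f x| := by
  set e : L2T := toL2 (primitive f) - stepPrimitive n f
  set a := (k : ℝ) / n with ha
  set b := ((k + 1 : ℕ) : ℝ) / n with hb
  have ha_mem : a ∈ Icc (0 : ℝ) 1 := natCast_div_mem_Icc hk.le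
  have hb_mem : b ∈ Icc (0 : ℝ) 1 := natCast_div_mem_Icc hk
  have hab : a ≤ b := by rw [ha, hb]; gcongr; simp
  have h_sub : Ioc a b ⊆ Ioc 0 1 := Ioc_subset_Ioc ha_mem.1 hb_mem.2
  have h_abs : IntervalIntegrable (fun x => |f x|) volume 0 1 := (intervalIntegrable_L1T f).abs
  have h_sq : IntervalIntegrable (fun x => e x ^ 2) volume 0 1 := by
    rw [intervalIntegrable_iff_integrableOn_Ioc_of_le zero_le_one]
    exact (Lp.memLp e).integrable_sq
  set V := ∫ x in a..b, |f x|
  have hV_nonneg : 0 ≤ V := intervalIntegral.integral_nonneg hab fun _ _ => abs_nonneg _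
  have hV_le : V ≤ ‖f‖ := by
    rw [norm_L1T]
    exact intervalIntegral.integral_mono_interval ha_mem.1 hab hb_mem.2
      (Eventually.of_forall fun _ => abs_nonneg _) h_abs
  have h_bound : ∫ x in a..b, e x ^ 2 ≤ ∫ _ in a..b, V ^ 2 := by
    rw [intervalIntegral.integral_of_le hab, intervalIntegral.integral_of_le hab]
    refine setIntegral_mono_ae_restrict (intervalIntegrable_subinterval h_sq ha_mem hb_mem).1
      (intervalIntegrable_const (μ := volume) (a := a) (b := b)).1 ?_
    filter_upwards [ae_mono (Measure.restrict_mono h_sub le_rfl) (stepPrimitive_ae_eq hk f),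
      ae_mono (Measure.restrict_mono h_sub le_rfl)
        (Lp.coeFn_sub (toL2 (primitive f)) (stepPrimitive n f)),
      ae_mono (Measure.restrict_mono h_sub le_rfl) (coeFn_toL2 (primitive f)),
      ae_restrict_mem measurableSet_Ioc] with x h_step h_e h_prim hx
    rw [h_e, Pi.sub_apply, h_prim, h_step hx,
      primitive_sub_primitive f ha_mem (Ioc_subset_Icc_self (h_sub hx)), sq_le_sq,
      abs_of_nonneg hV_nonneg]
    refine (intervalIntegral.abs_integral_le_integral_abs hx.1.le).trans ?_
    exact intervalIntegral.integral_mono_interval le_rfl hx.1.le hx.2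
      (Eventually.of_forall fun _ => abs_nonneg _)
      (intervalIntegrable_subinterval h_abs ha_mem hb_mem)
  calc ∫ x in a..b, e x ^ 2 ≤ ∫ _ in a..b, V ^ 2 := h_bound
    _ = 1 / n * (V * V) := by
      rw [intervalIntegral.integral_const, smul_eq_mul, ha, hb]; push_cast; ring
    _ ≤ 1 / n * (‖f‖ * V) := by gcongr
    _ = ‖f‖ / n * V := by ring

lemma norm_sub_stepPrimitive_le {n : ℕ} (hn : 0 < n) (f : L1T) :
    ‖toL2 (primitive f) - stepPrimitive n f‖ ^ 2 ≤ ‖f‖ ^ 2 / n := by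
  set e : L2T := toL2 (primitive f) - stepPrimitive n f
  have h_sq : IntervalIntegrable (fun x => e x ^ 2) volume 0 1 := by
    rw [intervalIntegrable_iff_integrableOn_Ioc_of_le zero_le_one]
    exact (Lp.memLp e).integrable_sq
  calc ‖e‖ ^ 2
      = ∑ k ∈ Finset.range n, ∫ x in ((k : ℝ) / n)..((k + 1 : ℕ) : ℝ) / n, e x ^ 2 := by
        rw [sum_integral_Ioc_div hn h_sq, norm_sq_L2T]
    _ ≤ ∑ k ∈ Finset.range n, ‖f‖ / n * ∫ x in ((k : ℝ) / n)..((k + 1 : ℕ) : ℝ) / n, |f x| :=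
        Finset.sum_le_sum fun k hk => integral_sub_stepPrimitive_sq_le (Finset.mem_range.1 hk) f
    _ = ‖f‖ ^ 2 / n := by
        rw [← Finset.mul_sum, sum_integral_Ioc_div hn (intervalIntegrable_L1T f).abs, ← norm_L1T]
        ring

lemma isCompactOperator_toL2_primitive : IsCompactOperator (toL2.comp primitive) := by
  refine isCompactOperator_of_tendsto (l := atTop) (F := stepPrimitive) ?_
    (Eventually.of_forall isCompactOperator_stepPrimitive)
  rw [tendsto_iff_norm_sub_tendsto_zero]
  have hlim : Tendsto (fun n : ℕ => Real.sqrt (1 / (n : ℝ))) atTop (𝓝 0) := by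
    have := (Real.continuous_sqrt.tendsto 0).comp (tendsto_one_div_atTop_nhds_zero_nat (𝕜 := ℝ))
    rwa [Real.sqrt_zero] at this
  refine squeeze_zero' (Eventually.of_forall fun _ => norm_nonneg _) ?_ hlim
  filter_upwards [eventually_gt_atTop 0] with n hn
  refine ContinuousLinearMap.opNorm_le_bound _ (Real.sqrt_nonneg _) fun f => ?_
  have := norm_sub_stepPrimitive_le hn f
  rw [sub_apply, norm_sub_rev]
  refine le_of_sq_le_sq ?_ (by positivity)
  rw [mul_pow, Real.sq_sqrt (by positivity)]
  calc _ ≤ _ := this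
    _ = _ := by ring

/-! ### The mean-zero primitive -/

/-- The mean value of an integrable function. -/
def meanL1 : L1T →L[ℝ] ℝ := (BoundedContinuousFunction.evalCLM ℝ 1).comp primitive

lemma meanL1_eq_primitive (f : L1T) : meanL1 f = primitive f 1 := rfl

lemma meanL1_of_ae {f : L1T} {g : ℝ → ℝ} (h : f =ᵐ[periodMeasure] g) :
    meanL1 f = ∫ x in (0 : ℝ)..1, g x := primitive_one_of_ae h

lemma abs_meanL1_le (f : L1T) : |meanL1 f| ≤ ‖f‖ := abs_primitive_le f 1

lemma meanL1_one : meanL1 (toL1 1) = 1 := primitive_toL1_one (by simp)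

/-- Subtraction of the mean value. -/
def center : L1T →L[ℝ] L1T := ContinuousLinearMap.id ℝ L1T - meanL1.smulRight (toL1 1)

lemma center_apply (f : L1T) : center f = f - meanL1 f • toL1 1 := rfl

lemma coeFn_center (f : L1T) : center f =ᵐ[periodMeasure] fun x => f x - meanL1 f := by
  filter_upwards [Lp.coeFn_sub f (meanL1 f • toL1 1), Lp.coeFn_smul (meanL1 f) (toL1 1),
    coeFn_toL1 1] with x h1 h2 h3
  rw [center_apply, h1, Pi.sub_apply, h2, Pi.smul_apply, h3]
  simp

lemma meanL1_center (f : L1T) : meanL1 (center f) = 0 := by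
  rw [center_apply, map_sub, map_smul, meanL1_one]; simp

/-- The periodic mean-zero primitive of `f - ∫₀¹ f`, as a bounded continuous function. -/
def periodicPrimitive : L1T →L[ℝ] (ℝ →ᵇ ℝ) :=
  primitive.comp center
    - ((meanL1.comp (toL1.comp (primitive.comp center))).smulRight (1 : ℝ →ᵇ ℝ))

lemma periodicPrimitive_apply (f : L1T) (x : ℝ) : periodicPrimitive f x
    = primitive (center f) x - meanL1 (toL1 (primitive (center f))) := by
  simp [periodicPrimitive]

lemma hasL1Deriv_periodicPrimitive (f : L1T) : HasL1Deriv (periodicPrimitive f) (center f) := by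
  intro x _
  rw [periodicPrimitive_apply, periodicPrimitive_apply, primitive_zero_right]
  ring

/-- The periodic mean-zero primitive of `f - ∫₀¹ f`, as an operator from `L¹` to `L²`. -/
def invDeriv : L1T →L[ℝ] L2T := toL2.comp periodicPrimitive

lemma coeFn_invDeriv (f : L1T) : invDeriv f =ᵐ[periodMeasure] periodicPrimitive f :=
  coeFn_toL2 _

lemma isCompactOperator_invDeriv : IsCompactOperator invDeriv := by
  have h1 := isCompactOperator_toL2_primitive.comp_clm center
  have h2 := isCompactOperator_smulRight
    (meanL1.comp (toL1.comp (primitive.comp center))) (toL2 1)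
  have : (invDeriv : L1T → L2T) = (toL2.comp primitive) ∘ center
      - (meanL1.comp (toL1.comp (primitive.comp center))).smulRight (toL2 1) := by
    ext1 f
    simp [invDeriv, periodicPrimitive]
  rw [this]
  exact h1.sub h2

lemma integral_invDeriv (f : L1T) : ∫ x in (0 : ℝ)..1, invDeriv f x = 0 := by
  have h : invDeriv f =ᵐ[periodMeasure]
      fun x => primitive (center f) x - meanL1 (toL1 (primitive (center f))) := by
    filter_upwards [coeFn_invDeriv f] with x hx
    rw [hx, periodicPrimitive_apply]
  rw [integral_period_congr h, intervalIntegral.integral_sub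
    ((primitive (center f)).continuous.intervalIntegrable _ _) (by simp),
    meanL1_of_ae (coeFn_toL1 _)]
  simp

lemma center_inclL1 {g : L2T} (hg : ∫ x in (0 : ℝ)..1, g x = 0) :
    center (inclL1 g) = inclL1 g := by
  rw [center_apply, meanL1_of_ae (coeFn_inclL1 g), hg, zero_smul, sub_zero]

lemma isWeakDeriv_invDeriv {g : L2T} (hg : ∫ x in (0 : ℝ)..1, g x = 0) :
    IsWeakDeriv 1 (invDeriv (inclL1 g)) g := by
  refine isWeakDeriv_one_of_ae_eq (c := -meanL1 (toL1 (primitive (center (inclL1 g))))) hg ?_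
  filter_upwards [coeFn_invDeriv (inclL1 g)] with x hx
  rw [hx, periodicPrimitive_apply, center_inclL1 hg]
  ring

/-! ### A maximum principle -/

lemma hasDerivAt_max_zero_sq (t : ℝ) : HasDerivAt (fun s : ℝ => max s 0 ^ 2) (2 * max t 0) t := by
  rcases lt_trichotomy t 0 with ht | rfl | ht
  · rw [max_eq_right ht.le, mul_zero]
    refine (hasDerivAt_const t (0 : ℝ)).congr_of_eventuallyEq ?_
    filter_upwards [Iio_mem_nhds ht] with s hs
    rw [max_eq_right (le_of_lt hs)]; norm_num
  · rw [max_self, mul_zero, hasDerivAt_iff_isLittleO_nhds_zero]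
    have h_bound : (fun h : ℝ => max (0 + h) 0 ^ 2 - max (0 : ℝ) 0 ^ 2 - h • (0 : ℝ))
        =O[𝓝 0] fun h => h ^ 2 := by
      refine Asymptotics.isBigO_of_le _ fun h => ?_
      simp only [zero_add, max_self, smul_zero, sub_zero, norm_pow, ne_eq, OfNat.ofNat_ne_zero,
        not_false_eq_true, zero_pow]
      gcongr
      rw [Real.norm_eq_abs, Real.norm_eq_abs, abs_of_nonneg (le_max_right _ _)]
      exact max_le (le_abs_self h) (abs_nonneg h)
    exact h_bound.trans_isLittleO (Asymptotics.isLittleO_pow_id one_lt_two)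
  · rw [max_eq_left ht.le]
    refine (by simpa using hasDerivAt_pow 2 t : HasDerivAt (fun s : ℝ => s ^ 2) (2 * t) t)
      |>.congr_of_eventuallyEq ?_
    filter_upwards [Ioi_mem_nhds ht] with s hs
    rw [max_eq_left (le_of_lt hs)]

/-- Solutions of `y' = ρ`, `(E ρ)' = E (m - z)` on `[0, 1]`, where `ρ` is `1`-periodic, `y` and `z`
vanish at the base point and `z` has the sign opposite to that of `y`. This is the first order
problem `ρ' + pρ + z = m` on the circle after multiplication by the integrating factor `E`, which is
not periodic in general. -/
structure IsOpposedSolution (E z ρ y : ℝ → ℝ) (m : ℝ) : Prop where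
  continuous_E : Continuous E
  E_pos : ∀ x, 0 < E x
  continuous_z : Continuous z
  continuous_ρ : Continuous ρ
  hasDerivAt : ∀ x, HasDerivAt y (ρ x) x
  hasDerivAt_mul : ∀ x ∈ Ioo (0 : ℝ) 1, HasDerivAt (fun t => E t * ρ t) (E x * (m - z x)) x
  ρ_periodic : ρ 0 = ρ 1
  y_zero : y 0 = 0
  y_one : y 1 = 0
  z_zero : z 0 = 0
  mul_nonpos : ∀ x ∈ Icc (0 : ℝ) 1, z x * y x ≤ 0

namespace IsOpposedSolution

variable {E z ρ y : ℝ → ℝ} {m : ℝ}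

lemma neg (h : IsOpposedSolution E z ρ y m) :
    IsOpposedSolution E (fun x => -z x) (fun x => -ρ x) (fun x => -y x) (-m) where
  continuous_E := h.continuous_E
  E_pos := h.E_pos
  continuous_z := h.continuous_z.neg
  continuous_ρ := h.continuous_ρ.neg
  hasDerivAt x := (h.hasDerivAt x).neg
  hasDerivAt_mul x hx := by
    have h_neg := (h.hasDerivAt_mul x hx).fun_neg
    simp only [← mul_neg] at h_neg
    rwa [neg_sub', sub_neg_eq_add, ← sub_neg_eq_add] at h_neg
  ρ_periodic := by rw [h.ρ_periodic]
  y_zero := by rw [h.y_zero, neg_zero]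
  y_one := by rw [h.y_one, neg_zero]
  z_zero := by rw [h.z_zero, neg_zero]
  mul_nonpos x hx := by rw [neg_mul_neg]; exact h.mul_nonpos x hx

lemma continuous_y (h : IsOpposedSolution E z ρ y m) : Continuous y :=
  continuous_iff_continuousAt.2 fun x => (h.hasDerivAt x).continuousAt

/-- The flux `(y⁺)² E ρ` vanishes at both ends and has the nonnegative derivative
`2 y⁺ E ρ² + (y⁺)² E (m - z)`. -/
lemma max_mul_eq_zero (h : IsOpposedSolution E z ρ y m) (hm : 0 ≤ m) {x : ℝ}
    (hx : x ∈ Ioo (0 : ℝ) 1) : max (y x) 0 * ρ x = 0 := by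
  set W : ℝ → ℝ := fun t => max (y t) 0 ^ 2 * (E t * ρ t)
  have h_term_nonneg (t : ℝ) : 0 ≤ 2 * max (y t) 0 * ρ t * (E t * ρ t) := by
    have := h.E_pos t
    calc 0 ≤ 2 * max (y t) 0 * (E t * ρ t ^ 2) := by positivity
      _ = _ := by ring
  have h_rest_nonneg {t : ℝ} (ht : t ∈ Icc (0 : ℝ) 1) :
      0 ≤ max (y t) 0 ^ 2 * (E t * (m - z t)) := by
    rcases le_or_gt (y t) 0 with hyt | hyt
    · simp [max_eq_right hyt]
    · have hz : z t ≤ 0 := nonpos_of_mul_nonpos_left (h.mul_nonpos t ht) hyt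
      have := h.E_pos t
      have : 0 ≤ m - z t := by linarith
      positivity
  have hW {t : ℝ} (ht : t ∈ Ioo (0 : ℝ) 1) : HasDerivAt W
      (2 * max (y t) 0 * ρ t * (E t * ρ t) + max (y t) 0 ^ 2 * (E t * (m - z t))) t :=
    ((hasDerivAt_max_zero_sq (y t)).comp t (h.hasDerivAt t)).mul (h.hasDerivAt_mul t ht)
  have hW_mono : MonotoneOn W (Icc 0 1) := by
    refine monotoneOn_of_deriv_nonneg (convex_Icc 0 1) (Continuous.continuousOn ?_) ?_ ?_
    · exact ((h.continuous_y.max continuous_const).pow 2).mul (h.continuous_E.mul h.continuous_ρ)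
    · rw [interior_Icc]
      exact fun t ht => (hW ht).differentiableAt.differentiableWithinAt
    · rw [interior_Icc]
      intro t ht
      rw [(hW ht).deriv]
      exact add_nonneg (h_term_nonneg t) (h_rest_nonneg (Ioo_subset_Icc_self ht))
  have hW_zero : W =ᶠ[𝓝 x] fun _ => 0 := by
    filter_upwards [Ioo_mem_nhds hx.1 hx.2] with t ht
    have ht' := Ioo_subset_Icc_self ht
    refine le_antisymm ?_ ?_
    · simpa [W, h.y_one] using hW_mono ht' (right_mem_Icc.2 zero_le_one) ht'.2
    · simpa [W, h.y_zero] using hW_mono (left_mem_Icc.2 zero_le_one) ht' ht'.1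
  have h_sum := ((hW hx).congr_of_eventuallyEq hW_zero.symm).unique (hasDerivAt_const x (0 : ℝ))
  have h_term : 2 * max (y x) 0 * ρ x * (E x * ρ x) = 0 := by
    linarith [h_term_nonneg x, h_rest_nonneg (Ioo_subset_Icc_self hx)]
  have := (h.E_pos x).ne'
  grind

lemma y_nonpos (h : IsOpposedSolution E z ρ y m) (hm : 0 ≤ m) {x : ℝ}
    (hx : x ∈ Icc (0 : ℝ) 1) : y x ≤ 0 := by
  have h_deriv (t : ℝ) : HasDerivAt (fun s => max (y s) 0 ^ 2) (2 * max (y t) 0 * ρ t) t :=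
    (hasDerivAt_max_zero_sq (y t)).comp t (h.hasDerivAt t)
  have h_mono : MonotoneOn (fun s => max (y s) 0 ^ 2) (Icc 0 1) := by
    refine monotoneOn_of_deriv_nonneg (convex_Icc 0 1)
      ((h.continuous_y.max continuous_const).pow 2).continuousOn
      (fun t _ => (h_deriv t).differentiableAt.differentiableWithinAt) ?_
    rw [interior_Icc]
    intro t ht
    rw [(h_deriv t).deriv, mul_assoc, h.max_mul_eq_zero hm ht, mul_zero]
  have h_le : max (y x) 0 ^ 2 ≤ 0 := by
    simpa [h.y_one] using h_mono hx (right_mem_Icc.2 zero_le_one) hx.2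
  exact (le_max_left _ _).trans (pow_eq_zero_iff two_ne_zero |>.1
    (le_antisymm h_le (sq_nonneg _))).le

lemma ρ_zero (h : IsOpposedSolution E z ρ y m) (hm : 0 ≤ m) : ρ 0 = 0 := by
  have h_le {x : ℝ} (hx : x ∈ Icc (0 : ℝ) 1) : y x ≤ 0 := h.y_nonpos hm hx
  have h_max_zero : IsLocalMaxOn y (Icc 0 1) 0 :=
    IsMaxOn.localize fun x hx => by simpa [h.y_zero] using h_le hx
  have h_max_one : IsLocalMaxOn y (Icc 0 1) 1 :=
    IsMaxOn.localize fun x hx => by simpa [h.y_one] using h_le hx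
  refine le_antisymm ?_ ?_
  · simpa using h_max_zero.hasFDerivWithinAt_nonpos
      (h.hasDerivAt 0).hasDerivWithinAt.hasFDerivWithinAt
      (mem_posTangentConeAt_of_segment_subset (y := 1) (by simp [segment_eq_Icc]))
  · rw [h.ρ_periodic]
    simpa using h_max_one.hasFDerivWithinAt_nonpos
      (h.hasDerivAt 1).hasDerivWithinAt.hasFDerivWithinAt
      (mem_posTangentConeAt_of_segment_subset (y := -1)
        (by simp [segment_symm ℝ (1 : ℝ), segment_eq_Icc]))

/-- If `m` were positive, `E ρ` and then `y` would be strictly increasing near `0`. -/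
lemma m_nonpos (h : IsOpposedSolution E z ρ y m) : m ≤ 0 := by
  by_contra! hm
  have h_pos : ∀ᶠ x in 𝓝 0, 0 < m - z x :=
    (continuous_const.sub h.continuous_z).tendsto' 0 m (by simp [h.z_zero]) |>.eventually
      (lt_mem_nhds hm)
  obtain ⟨ε, hε, h_ball⟩ := Metric.eventually_nhds_iff.1 h_pos
  set δ := min (ε / 2) 1
  have hδ : 0 < δ := by positivity
  have hδ_one : δ ≤ 1 := min_le_right _ _
  have h_flux : StrictMonoOn (fun x => E x * ρ x) (Icc 0 δ) := by
    refine strictMonoOn_of_deriv_pos (convex_Icc 0 δ)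
      (h.continuous_E.mul h.continuous_ρ).continuousOn ?_
    rw [interior_Icc]
    intro x hx
    rw [(h.hasDerivAt_mul x ⟨hx.1, hx.2.trans_le hδ_one⟩).deriv]
    refine mul_pos (h.E_pos x) (h_ball ?_)
    rw [Real.dist_eq, sub_zero, abs_of_pos hx.1]
    linarith [hx.2.trans_le (min_le_left (ε / 2) 1)]
  have hρ {x : ℝ} (hx : x ∈ Ioo 0 δ) : 0 < ρ x := by
    have h_lt : E 0 * ρ 0 < E x * ρ x :=
      h_flux (left_mem_Icc.2 hδ.le) (Ioo_subset_Icc_self hx) hx.1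
    rw [h.ρ_zero hm.le, mul_zero] at h_lt
    exact pos_of_mul_pos_right h_lt (h.E_pos x).le
  have hy : StrictMonoOn y (Icc 0 δ) := by
    refine strictMonoOn_of_deriv_pos (convex_Icc 0 δ) h.continuous_y.continuousOn ?_
    rw [interior_Icc]
    exact fun x hx => by rw [(h.hasDerivAt x).deriv]; exact hρ hx
  have h_lt := hy (left_mem_Icc.2 hδ.le) (right_mem_Icc.2 hδ.le) hδ
  rw [h.y_zero] at h_lt
  exact h_lt.not_ge (h.y_nonpos hm.le ⟨hδ.le, hδ_one⟩)

theorem y_eq_zero (h : IsOpposedSolution E z ρ y m) {x : ℝ} (hx : x ∈ Icc (0 : ℝ) 1) :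
    y x = 0 := by
  have hm : m = 0 := le_antisymm h.m_nonpos (by simpa using h.neg.m_nonpos)
  exact le_antisymm (h.y_nonpos hm.ge hx) (by simpa using h.neg.y_nonpos (by simp [hm]) hx)

end IsOpposedSolution

lemma periodicPrimitive_zero_eq_one (f : L1T) :
    periodicPrimitive f 0 = periodicPrimitive f 1 := by
  rw [periodicPrimitive_apply, periodicPrimitive_apply, primitive_zero_right,
    ← meanL1_eq_primitive, meanL1_center]

lemma eq_zero_of_primitive_inclL1_eq_zero {r : L2T} {ρ : ℝ →ᵇ ℝ} (hr : r =ᵐ[periodMeasure] ρ)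
    (h : ∀ x ∈ Icc (0 : ℝ) 1, primitive (inclL1 r) x = 0) : r = 0 := by
  rw [Lp.eq_zero_iff_ae_eq_zero]
  have h_Ioo : ∀ᵐ x ∂periodMeasure, x ∈ Ioo (0 : ℝ) 1 := by
    rw [periodMeasure, ← restrict_Ioo_eq_restrict_Ioc]
    exact ae_restrict_mem measurableSet_Ioo
  filter_upwards [hr, h_Ioo] with x hrx hx
  have h_zero : (fun t => ∫ s in (0 : ℝ)..t, ρ s) =ᶠ[𝓝 x] fun _ => 0 := by
    filter_upwards [Ioo_mem_nhds hx.1 hx.2] with t ht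
    have ht' := Ioo_subset_Icc_self ht
    rw [← primitive_of_ae ((coeFn_inclL1 r).trans hr) ht', h t ht']
  rw [hrx, Pi.zero_apply]
  exact ((hasDerivAt_integral ρ x).congr_of_eventuallyEq h_zero.symm).unique
    (hasDerivAt_const x (0 : ℝ))

/-- Here `exp ∫₀ˣ p` is the integrating factor of `ρ' + pρ + z = m`, where `m = ∫₀¹ (pρ + z)`. -/
lemma expB_mul_eq_of_add_periodicPrimitive_eq_zero {r p : L2T} {z ρ : ℝ →ᵇ ℝ}
    (hr : r =ᵐ[periodMeasure] ρ) (hρ : ρ = -periodicPrimitive (mulL2 p r + toL1 z)) {x : ℝ}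
    (hx : x ∈ Icc (0 : ℝ) 1) :
    expB (primitive (inclL1 p)) x * ρ x = ρ 0 + ∫ t in (0 : ℝ)..x,
      expB (primitive (inclL1 p)) t * (meanL1 (mulL2 p r + toL1 z) - z t) := by
  set f : L1T := mulL2 p r + toL1 z
  set E : ℝ →ᵇ ℝ := expB (primitive (inclL1 p))
  have hρ_deriv : HasL1Deriv ρ ((-1 : ℝ) • center f) := by
    rw [hρ, ← neg_one_smul ℝ (periodicPrimitive f)]
    exact (hasL1Deriv_periodicPrimitive f).const_smul (-1)
  have hE0 : E 0 = 1 := by rw [expB_apply, primitive_zero_right, Real.exp_zero]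
  have h_ae : (mulB E ((-1 : ℝ) • center f) + mulB ρ (mulB E (inclL1 p)) : L1T)
      =ᵐ[periodMeasure] fun t => E t * (meanL1 f - z t) := by
    filter_upwards [Lp.coeFn_add (mulB E ((-1 : ℝ) • center f)) (mulB ρ (mulB E (inclL1 p))),
      coeFn_mulB E ((-1 : ℝ) • center f), Lp.coeFn_smul (-1 : ℝ) (center f), coeFn_center f,
      Lp.coeFn_add (mulL2 p r) (toL1 z), coeFn_mulL2 p r, coeFn_toL1 z,
      coeFn_mulB ρ (mulB E (inclL1 p)), coeFn_mulB E (inclL1 p), coeFn_inclL1 p, hr]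
      with t h1 h2 h3 h4 h5 h6 h7 h8 h9 h10 h11
    rw [h1, Pi.add_apply, h2, h3, Pi.smul_apply, h4, h5, Pi.add_apply, h6, h7, h8, h9, h10, h11,
      smul_eq_mul]
    ring
  have h_mul := ((hasL1Deriv_expB_primitive (inclL1 p)).mul hρ_deriv) hx
  rwa [primitive_of_ae h_ae hx, BoundedContinuousFunction.mul_apply,
    BoundedContinuousFunction.mul_apply, hE0, one_mul] at h_mul

/-- Uniqueness for the linear problem `r' + pr + z = const` on the circle. -/
lemma eq_zero_of_add_invDeriv_eq_zero {r p : L2T} {z : ℝ →ᵇ ℝ} (hz0 : z 0 = 0)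
    (hz : ∀ x ∈ Icc (0 : ℝ) 1, z x * primitive (inclL1 r) x ≤ 0)
    (h : r + invDeriv (mulL2 p r + toL1 z) = 0) : r = 0 := by
  set f : L1T := mulL2 p r + toL1 z
  set ρ : ℝ →ᵇ ℝ := -periodicPrimitive f with hρ
  set E : ℝ →ᵇ ℝ := expB (primitive (inclL1 p))
  have hr_neg : r = -invDeriv f := eq_neg_of_add_eq_zero_left h
  have hr : r =ᵐ[periodMeasure] ρ := by
    rw [hr_neg]
    filter_upwards [Lp.coeFn_neg (invDeriv f), coeFn_invDeriv f] with x h1 h2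
    rw [h1, Pi.neg_apply, h2]
    rfl
  have hy {x : ℝ} (hx : x ∈ Icc (0 : ℝ) 1) : primitive (inclL1 r) x = ∫ t in (0 : ℝ)..x, ρ t :=
    primitive_of_ae ((coeFn_inclL1 r).trans hr) hx
  have hE_cont : Continuous fun t => E t * (meanL1 f - z t) := by fun_prop
  have h_sol : IsOpposedSolution E z ρ (fun x => ∫ t in (0 : ℝ)..x, ρ t) (meanL1 f) :=
    { continuous_E := E.continuous
      E_pos := fun x => by rw [expB_apply]; exact Real.exp_pos _
      continuous_z := z.continuous
      continuous_ρ := ρ.continuous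
      hasDerivAt := hasDerivAt_integral ρ
      hasDerivAt_mul := fun x hx => by
        refine ((hE_cont.integral_hasStrictDerivAt 0 x).hasDerivAt.const_add (ρ 0))
          |>.congr_of_eventuallyEq ?_
        filter_upwards [Ioo_mem_nhds hx.1 hx.2] with t ht using
          expB_mul_eq_of_add_periodicPrimitive_eq_zero hr hρ (Ioo_subset_Icc_self ht)
      ρ_periodic := by simp [hρ, periodicPrimitive_zero_eq_one]
      y_zero := intervalIntegral.integral_same
      y_one := by
        rw [← hy (by simp), primitive_inclL1_one, hr_neg, ← neg_one_smul ℝ, integral_L2T_smul,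
          integral_invDeriv, mul_zero]
      z_zero := hz0
      mul_nonpos := fun x hx => by rw [← hy hx]; exact hz x hx }
  exact eq_zero_of_primitive_inclL1_eq_zero hr fun x hx => (hy hx).trans (h_sol.y_eq_zero hx)

/-! ### Compact perturbations of the identity -/

section CompactPerturbation

variable {E F : Type*} [NormedAddCommGroup E] [NormedSpace ℝ E] [NormedAddCommGroup F]
  [NormedSpace ℝ F]

lemma exists_equiv_eq_id_add_of_isCompactOperator [CompleteSpace E] {T : E →L[ℝ] E}
    (hT : IsCompactOperator T) (hker : ∀ h, h + T h = 0 → h = 0) :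
    ∃ i : E ≃L[ℝ] E, ContinuousLinearMap.id ℝ E + T = i := by
  have hev : ¬ Module.End.HasEigenvalue (T : Module.End ℝ E) (-1) := by
    intro hev
    obtain ⟨h, hh⟩ := hev.exists_hasEigenvector
    have hTh : T h = (-1 : ℝ) • h := hh.apply_eq_smul
    exact hh.2 (hker h (by rw [hTh, neg_one_smul, add_neg_cancel]))
  have hres := (hT.hasEigenvalue_or_mem_resolventSet (μ := (-1 : ℝ)) (by norm_num)).resolve_left
    hev
  rw [spectrum.mem_resolventSet_iff, ← IsUnit.neg_iff] at hres
  obtain ⟨u, hu⟩ := hres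
  refine ⟨ContinuousLinearEquiv.ofUnit u, ?_⟩
  change _ = (u : E →L[ℝ] E)
  rw [hu]
  ext1 h
  simp [add_comm]

lemma range_mem_nhds_and_analyticAt_invFun [CompleteSpace E] {f : E → F} {x : E}
    (hinj : Function.Injective f) (hf : AnalyticAt ℝ f x) (i : E ≃L[ℝ] F)
    (hi : fderiv ℝ f x = i) :
    range f ∈ 𝓝 (f x) ∧ AnalyticAt ℝ (Function.invFun f) (f x) := by
  have hs : HasStrictFDerivAt f (i : E →L[ℝ] F) x := hi ▸ hf.hasStrictFDerivAt
  set R := hs.toOpenPartialHomeomorph f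
  have hx : x ∈ R.source := hs.mem_toOpenPartialHomeomorph_source
  have hsymm : AnalyticAt ℝ R.symm (f x) := R.analyticAt_symm' hx hf hi
  have htarget : R.target ∈ 𝓝 (f x) := R.open_target.mem_nhds (R.map_source hx)
  have hR {y : F} (hy : y ∈ R.target) : f (R.symm y) = y := R.right_inv hy
  refine ⟨mem_of_superset htarget fun y hy => ⟨R.symm y, hR hy⟩, hsymm.congr ?_⟩
  filter_upwards [htarget] with y hy
  conv_rhs => rw [← hR hy]
  exact (Function.leftInverse_invFun hinj _).symm

variable {f : E → E} {N : E → F} {K : F →L[ℝ] E}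

lemma mem_range_of_tendsto (hK : IsCompactOperator K) (hf : Continuous f)
    (hfN : ∀ x, f x = x + K (N x)) {C : ℝ} {x : ℕ → E} (hN : ∀ n, ‖N (x n)‖ ≤ C) {y : E}
    (hy : Tendsto (fun n => f (x n)) atTop (𝓝 y)) : y ∈ range f := by
  obtain ⟨Z, hZ, hsub⟩ := hK.image_closedBall_subset_compact C
  obtain ⟨k, -, φ, hφ, hlim⟩ := hZ.tendsto_subseq (x := fun n => K (N (x n)))
    fun n => hsub ⟨_, mem_closedBall_zero_iff.2 (hN n), rfl⟩
  have hyφ : Tendsto (fun n => f (x (φ n))) atTop (𝓝 y) := hy.comp hφ.tendsto_atTop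
  have hxφ : Tendsto (fun n => x (φ n)) atTop (𝓝 (y - k)) :=
    (hyφ.sub hlim).congr fun n => by simp [hfN]
  exact ⟨y - k, tendsto_nhds_unique ((hf.tendsto _).comp hxφ) hyφ⟩

lemma mem_range_of_forall_norm_le (hK : IsCompactOperator K) (hf : Continuous f)
    (hfN : ∀ x, f x = x + K (N x)) (hN : ∀ R, ∃ C, ∀ x, ‖x‖ ≤ R → ‖N x‖ ≤ C)
    (hopen : IsOpen (range f)) (h0 : f 0 = 0) {p : E} {R : ℝ}
    (hR : ∀ t ∈ Icc (0 : ℝ) 1, ∀ x, f x = t • p → ‖x‖ ≤ R) : p ∈ range f := by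
  set S : Set ℝ := {t | t • p ∈ range f}
  have hSopen : IsOpen S := hopen.preimage (continuous_id.smul continuous_const)
  have hSclosed : IsClosed (S ∩ Icc 0 1) := by
    refine IsSeqClosed.isClosed fun t s ht hts => ⟨?_, isClosed_Icc.mem_of_tendsto hts
      (Eventually.of_forall fun n => (ht n).2)⟩
    choose x hx using fun n => (ht n).1
    obtain ⟨C, hC⟩ := hN R
    exact mem_range_of_tendsto hK hf hfN (fun n => hC _ (hR (t n) (ht n).2 _ (hx n)))
      ((hts.smul_const p).congr fun n => (hx n).symm)
  have h0S : (0 : ℝ) ∈ S := ⟨0, by rw [h0, zero_smul]⟩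
  have h1S : (1 : ℝ) ∈ S := hSclosed.Icc_subset_of_forall_mem_nhdsWithin h0S
    (fun t ht => mem_nhdsWithin_of_mem_nhds (hSopen.mem_nhds ht.1)) (right_mem_Icc.2 zero_le_one)
  simpa only [S, mem_ofPred_eq, one_smul] using h1S

end CompactPerturbation

/-! ### The Riccati map on `L²` -/

lemma analyticAt_clm_comp {E F G : Type*} [NormedAddCommGroup E] [NormedSpace ℝ E]
    [NormedAddCommGroup F] [NormedSpace ℝ F] [NormedAddCommGroup G] [NormedSpace ℝ G]
    (L : F →L[ℝ] G) {f : E → F} {x : E} (hf : AnalyticAt ℝ f x) :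
    AnalyticAt ℝ (fun y => L (f y)) x :=
  (L.analyticAt (f x)).comp hf

section RiccatiMap

variable (α β A : ℝ)

/-- The function `e^{cQ}`, where `Q` is the primitive of `q`. -/
def expQ (c : ℝ) (q : L2T) : ℝ →ᵇ ℝ := expB (c • primitive (inclL1 q))

/-- The function `u = A e^{-β Q}`. -/
def expTerm (q : L2T) : ℝ →ᵇ ℝ := A • expQ (-β) q

/-- The function `α q² + u` in `L¹`. -/
def lowerL1 (q : L2T) : L1T := α • mulL2 q q + toL1 (expTerm β A q)

/-- The map `q ↦ q + D⁻¹(α q² + u - c₀)` on `L²`, of which `P` is the derivative. -/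
def riccati (q : L2T) : L2T := q + invDeriv (lowerL1 α β A q)

lemma expQ_apply (c : ℝ) (q : L2T) (x : ℝ) :
    expQ c q x = Real.exp (c * primitive (inclL1 q) x) := by
  simp [expQ, expB_apply]

lemma expTerm_apply (q : L2T) (x : ℝ) :
    expTerm β A q x = A * Real.exp (-β * primitive (inclL1 q) x) := by
  simp [expTerm, expQ_apply]

lemma expTerm_apply_zero (q : L2T) : expTerm β A q 0 = A := by
  simp [expTerm_apply, primitive_zero_right]

lemma primitive_inclL1_eq_primQ (q : L2T) {x : ℝ} (hx : x ∈ Icc (0 : ℝ) 1) :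
    primitive (inclL1 q) x = primQ q x := primitive_of_ae (coeFn_inclL1 q) hx

lemma coeFn_lowerL1 (q : L2T) : lowerL1 α β A q =ᵐ[periodMeasure] lowerTerm α β A q := by
  filter_upwards [Lp.coeFn_add (α • mulL2 q q) (toL1 (expTerm β A q)),
    Lp.coeFn_smul α (mulL2 q q), coeFn_mulL2 q q, coeFn_toL1 (expTerm β A q), ae_Icc]
    with x h1 h2 h3 h4 hx
  rw [lowerL1, h1, Pi.add_apply, h2, Pi.smul_apply, h3, h4, expTerm_apply,
    primitive_inclL1_eq_primQ q hx, lowerTerm, smul_eq_mul]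
  ring

lemma meanL1_lowerL1 (q : L2T) : meanL1 (lowerL1 α β A q) = meanTerm α β A q :=
  meanL1_of_ae (coeFn_lowerL1 α β A q)

lemma analyticAt_expQ (c : ℝ) (q : L2T) : AnalyticAt ℝ (expQ c) q :=
  (analyticAt_expB _).comp ((c • primitive.comp inclL1).analyticAt q)

lemma analyticAt_expTerm (q : L2T) : AnalyticAt ℝ (expTerm β A) q :=
  (analyticAt_expQ (-β) q).const_smul (c := A)

lemma analyticAt_lowerL1 (q : L2T) : AnalyticAt ℝ (lowerL1 α β A) q := by
  have hsq : AnalyticAt ℝ (fun q : L2T => mulL2 q q) q :=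
    (mulL2.analyticAt_bilinear (q, q)).comp₂ analyticAt_id analyticAt_id
  exact (hsq.const_smul (c := α)).add (analyticAt_clm_comp toL1 (analyticAt_expTerm β A q))

lemma analyticAt_riccati (q : L2T) : AnalyticAt ℝ (riccati α β A) q :=
  analyticAt_id.add (analyticAt_clm_comp invDeriv (analyticAt_lowerL1 α β A q))

lemma continuous_riccati : Continuous (riccati α β A) :=
  continuous_iff_continuousAt.2 fun q => (analyticAt_riccati α β A q).continuousAt

/-- The derivative of `q ↦ α q² + u`. -/
def lowerDeriv (q : L2T) : L2T →L[ℝ] L1T :=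
  α • (mulL2 q + mulL2.flip q)
    + toL1.comp (A • (expQ (-β) q • (1 : (ℝ →ᵇ ℝ) →L[ℝ] (ℝ →ᵇ ℝ))).comp
        ((-β) • primitive.comp inclL1))

lemma hasFDerivAt_lowerL1 (q : L2T) :
    HasFDerivAt (lowerL1 α β A) (lowerDeriv α β A q) q := by
  have hsq : HasFDerivAt (fun q : L2T => mulL2 q q) (mulL2 q + mulL2.flip q) q := by
    refine (mulL2.hasFDerivAt_of_bilinear (hasFDerivAt_id q) (hasFDerivAt_id q)).congr_fderiv ?_
    ext1 h
    simp
  have hQ : HasFDerivAt (fun q : L2T => ((-β) • primitive.comp inclL1) q)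
      ((-β) • primitive.comp inclL1) q := ContinuousLinearMap.hasFDerivAt _
  have hu := ((hasFDerivAt_expB (((-β) • primitive.comp inclL1) q)).comp q hQ).const_smul A
  exact (hsq.const_smul α).add (toL1.hasFDerivAt.comp q hu)

lemma lowerDeriv_apply (q h : L2T) : lowerDeriv α β A q h
    = mulL2 ((2 * α) • q) h + toL1 ((-β) • (expTerm β A q * primitive (inclL1 h))) := by
  have : lowerDeriv α β A q h = α • (mulL2 q h + mulL2 h q)
      + toL1 (A • (expQ (-β) q * ((-β) • primitive (inclL1 h)))) := rfl
  rw [this, mulL2_comm h q, map_smul mulL2, smul_apply, ← two_smul ℝ (mulL2 q h),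
    smul_smul, mul_comm α 2]
  congr 2
  ext x
  simp only [expTerm, BoundedContinuousFunction.coe_smul, BoundedContinuousFunction.coe_mul,
    Pi.mul_apply, smul_eq_mul]
  ring

lemma hasFDerivAt_riccati (q : L2T) : HasFDerivAt (riccati α β A)
    (ContinuousLinearMap.id ℝ L2T + invDeriv.comp (lowerDeriv α β A q)) q :=
  (hasFDerivAt_id q).add (invDeriv.hasFDerivAt.comp q (hasFDerivAt_lowerL1 α β A q))

lemma integral_riccati (q : L2T) :
    ∫ x in (0 : ℝ)..1, riccati α β A q x = ∫ x in (0 : ℝ)..1, q x := by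
  rw [riccati, integral_L2T_add, integral_invDeriv, add_zero]

lemma riccati_zero : riccati α β A 0 = 0 := by
  have hc : center (toL1 1) = 0 := by rw [center_apply, meanL1_one, one_smul, sub_self]
  have h : lowerL1 α β A 0 = A • toL1 1 := by
    rw [lowerL1, map_zero, smul_zero, zero_add, ← map_smul]
    congr 1
    ext x
    rw [expTerm_apply]
    simp
  simp [riccati, h, invDeriv, periodicPrimitive, hc]

variable {A}

lemma expTerm_nonneg (hA : 0 ≤ A) (q : L2T) (x : ℝ) : 0 ≤ expTerm β A q x := by
  rw [expTerm_apply]; positivity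

variable {β}

lemma sub_expTerm_mul_sub_primitive_nonpos (hβ : 0 ≤ β) (hA : 0 ≤ A) (q₁ q₂ : L2T) (x : ℝ) :
    (expTerm β A q₁ x - expTerm β A q₂ x)
      * (primitive (inclL1 q₁) x - primitive (inclL1 q₂) x) ≤ 0 := by
  have hanti : Antitone fun t : ℝ => A * Real.exp (-β * t) := fun s t hst =>
    mul_le_mul_of_nonneg_left (Real.exp_le_exp.2 (by nlinarith)) hA
  simp only [expTerm_apply]
  rcases le_total (primitive (inclL1 q₁) x) (primitive (inclL1 q₂) x) with h | h
  · exact mul_nonpos_of_nonneg_of_nonpos (sub_nonneg.2 (hanti h)) (sub_nonpos.2 h)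
  · exact mul_nonpos_of_nonpos_of_nonneg (sub_nonpos.2 (hanti h)) (sub_nonneg.2 h)

lemma riccati_injective (hβ : 0 ≤ β) (hA : 0 ≤ A) : Function.Injective (riccati α β A) := by
  intro q₁ q₂ h
  have hsub : lowerL1 α β A q₁ - lowerL1 α β A q₂
      = mulL2 (α • (q₁ + q₂)) (q₁ - q₂) + toL1 (expTerm β A q₁ - expTerm β A q₂) := by
    simp only [lowerL1, map_sub, map_add, map_smul, add_apply, smul_apply, mulL2_comm q₂ q₁]
    module
  have h0 : (q₁ - q₂) + invDeriv (mulL2 (α • (q₁ + q₂)) (q₁ - q₂)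
      + toL1 (expTerm β A q₁ - expTerm β A q₂)) = 0 := by
    rw [← hsub, map_sub, ← sub_eq_zero.2 h, riccati, riccati]
    abel
  refine sub_eq_zero.1 (eq_zero_of_add_invDeriv_eq_zero ?_ (fun x _ => ?_) h0)
  · simp [expTerm_apply_zero]
  · rw [map_sub, map_sub]
    exact sub_expTerm_mul_sub_primitive_nonpos hβ hA q₁ q₂ x

lemma exists_fderiv_riccati_eq (hβ : 0 ≤ β) (hA : 0 ≤ A) (q : L2T) :
    ∃ i : L2T ≃L[ℝ] L2T, fderiv ℝ (riccati α β A) q = i := by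
  rw [(hasFDerivAt_riccati α β A q).fderiv]
  refine exists_equiv_eq_id_add_of_isCompactOperator
    (isCompactOperator_invDeriv.comp_clm (lowerDeriv α β A q)) fun h hh => ?_
  rw [ContinuousLinearMap.comp_apply, lowerDeriv_apply] at hh
  refine eq_zero_of_add_invDeriv_eq_zero ?_ (fun x _ => ?_) hh
  · simp [primitive_zero_right]
  · simp only [BoundedContinuousFunction.coe_smul, BoundedContinuousFunction.coe_mul,
      Pi.mul_apply, smul_eq_mul]
    have := mul_nonneg (mul_nonneg hβ (expTerm_nonneg β hA q x))
      (sq_nonneg (primitive (inclL1 h) x))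
    linarith

lemma isOpen_range_riccati (hβ : 0 ≤ β) (hA : 0 ≤ A) : IsOpen (range (riccati α β A)) := by
  rw [isOpen_iff_mem_nhds]
  rintro _ ⟨q, rfl⟩
  obtain ⟨i, hi⟩ := exists_fderiv_riccati_eq α hβ hA q
  exact (range_mem_nhds_and_analyticAt_invFun (riccati_injective α hβ hA)
    (analyticAt_riccati α β A q) i hi).1

lemma analyticAt_invFun_riccati (hβ : 0 ≤ β) (hA : 0 ≤ A) {p : L2T}
    (hp : p ∈ range (riccati α β A)) : AnalyticAt ℝ (Function.invFun (riccati α β A)) p := by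
  obtain ⟨q, rfl⟩ := hp
  obtain ⟨i, hi⟩ := exists_fderiv_riccati_eq α hβ hA q
  exact (range_mem_nhds_and_analyticAt_invFun (riccati_injective α hβ hA)
    (analyticAt_riccati α β A q) i hi).2

lemma expTerm_le (hβ : 0 ≤ β) (hA : 0 ≤ A) (q : L2T) (x : ℝ) :
    expTerm β A q x ≤ A * Real.exp (β * ‖q‖) := by
  rw [expTerm_apply]
  refine mul_le_mul_of_nonneg_left (Real.exp_le_exp.2 ?_) hA
  have := (abs_le.1 (abs_primitive_inclL1_le q x)).1
  nlinarith

lemma norm_lowerL1_le (hβ : 0 ≤ β) (hA : 0 ≤ A) (q : L2T) :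
    ‖lowerL1 α β A q‖ ≤ |α| * ‖q‖ ^ 2 + A * Real.exp (β * ‖q‖) := by
  refine (norm_add_le _ _).trans (add_le_add ?_ (norm_toL1_le _ fun x => ?_))
  · rw [norm_smul, Real.norm_eq_abs, pow_two]
    exact mul_le_mul_of_nonneg_left (norm_mulL2_le q q) (abs_nonneg α)
  · rw [abs_of_nonneg (expTerm_nonneg β hA q x)]
    exact expTerm_le hβ hA q x

lemma mem_range_riccati_of_forall_norm_le (hβ : 0 ≤ β) (hA : 0 ≤ A) {p : L2T} {R : ℝ}
    (hR : ∀ t ∈ Icc (0 : ℝ) 1, ∀ q, riccati α β A q = t • p → ‖q‖ ≤ R) :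
    p ∈ range (riccati α β A) := by
  refine mem_range_of_forall_norm_le isCompactOperator_invDeriv (continuous_riccati α β A)
    (fun q => rfl) (fun R => ⟨|α| * R ^ 2 + A * Real.exp (β * R), fun q hq => ?_⟩)
    (isOpen_range_riccati α hβ hA) (riccati_zero α β A) hR
  refine (norm_lowerL1_le α hβ hA q).trans ?_
  gcongr

end RiccatiMap

/-! ### Periodic functions with an integrable derivative -/

namespace HasL1Deriv

variable {ρ σ : ℝ →ᵇ ℝ} {a b : L1T}

lemma one_eq_zero_iff (h : HasL1Deriv ρ a) : ρ 1 = ρ 0 ↔ meanL1 a = 0 := by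
  rw [h (by simp), meanL1_eq_primitive, add_eq_left]

lemma integral_mul_eq_neg (hρ : HasL1Deriv ρ a) (hσ : HasL1Deriv σ b) (ha : meanL1 a = 0)
    (hb : meanL1 b = 0) :
    ∫ x in (0 : ℝ)..1, ρ x * b x = -∫ x in (0 : ℝ)..1, σ x * a x := by
  have h_mean : meanL1 (mulB ρ b + mulB σ a) = 0 := by
    rw [← (hρ.mul hσ).one_eq_zero_iff, BoundedContinuousFunction.mul_apply,
      BoundedContinuousFunction.mul_apply, hρ.one_eq_zero_iff.2 ha, hσ.one_eq_zero_iff.2 hb]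
  rw [map_add, meanL1_of_ae (coeFn_mulB ρ b), meanL1_of_ae (coeFn_mulB σ a)] at h_mean
  exact eq_neg_of_add_eq_zero_left h_mean

lemma integral_sq_mul_deriv (h : HasL1Deriv ρ a) (ha : meanL1 a = 0) :
    ∫ x in (0 : ℝ)..1, ρ x ^ 2 * a x = 0 := by
  have h_sq := h.mul h
  have h_sq_mean : meanL1 (mulB ρ a + mulB ρ a) = 0 := by
    rw [← h_sq.one_eq_zero_iff, BoundedContinuousFunction.mul_apply,
      BoundedContinuousFunction.mul_apply, h.one_eq_zero_iff.2 ha]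
  have h_parts := h.integral_mul_eq_neg h_sq ha h_sq_mean
  have h_left : ∫ x in (0 : ℝ)..1, ρ x * (mulB ρ a + mulB ρ a : L1T) x
      = ∫ x in (0 : ℝ)..1, 2 * (ρ x ^ 2 * a x) := by
    refine integral_period_congr ?_
    filter_upwards [Lp.coeFn_add (mulB ρ a) (mulB ρ a), coeFn_mulB ρ a] with x h1 h2
    rw [h1, Pi.add_apply, h2]
    ring
  rw [h_left, intervalIntegral.integral_const_mul] at h_parts
  simp only [BoundedContinuousFunction.mul_apply] at h_parts
  simp only [← pow_two] at h_parts
  linarith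

lemma abs_sub_le (h : HasL1Deriv ρ a) (ha : meanL1 a = 0) {x y : ℝ}
    (hx : x ∈ Icc (0 : ℝ) 1) (hy : y ∈ Icc (0 : ℝ) 1) : |ρ y - ρ x| ≤ 1 / 2 * ‖a‖ := by
  wlog hxy : x ≤ y generalizing x y
  · rw [abs_sub_comm]; exact this hy hx (le_of_not_ge hxy)
  have h0 : (0 : ℝ) ∈ Icc (0 : ℝ) 1 := by simp
  have h1 : (1 : ℝ) ∈ Icc (0 : ℝ) 1 := by simp
  have h_int := (intervalIntegrable_L1T a).abs
  have h_int0 := intervalIntegrable_subinterval h_int h0 hx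
  have h_int1 := intervalIntegrable_subinterval h_int hx hy
  have h_int2 := intervalIntegrable_subinterval h_int hy h1
  have h_norm : ‖a‖
      = (∫ t in (0 : ℝ)..x, |a t|) + (∫ t in x..y, |a t|) + ∫ t in y..1, |a t| := by
    rw [norm_L1T, intervalIntegral.integral_add_adjacent_intervals h_int0 h_int1,
      intervalIntegral.integral_add_adjacent_intervals (h_int0.trans h_int1) h_int2]
  have h_sub {s t : ℝ} (hs : s ∈ Icc (0 : ℝ) 1) (ht : t ∈ Icc (0 : ℝ) 1) (hst : s ≤ t) :
      |ρ t - ρ s| ≤ ∫ r in s..t, |a r| := by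
    rw [h ht, h hs, add_sub_add_left_eq_sub, primitive_sub_primitive a hs ht]
    exact intervalIntegral.abs_integral_le_integral_abs hst
  have h_triangle : |ρ y - ρ x| ≤ |ρ 0 - ρ y| + |ρ x - ρ 0| := by
    rw [abs_sub_comm (ρ 0), abs_sub_comm (ρ x)]
    exact _root_.abs_sub_le _ _ _
  have h_last := h_sub hy h1 hy.2
  rw [h.one_eq_zero_iff.2 ha] at h_last
  linarith [h_sub h0 hx hx.1, h_sub hx hy hxy]

end HasL1Deriv

lemma IsWeakDeriv.exists_hasL1Deriv {q g : L2T} (h : IsWeakDeriv 1 q g) :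
    ∃ ρ : ℝ →ᵇ ℝ, q =ᵐ[periodMeasure] ρ ∧ HasL1Deriv ρ (inclL1 g) := by
  obtain ⟨c, hc⟩ := h.exists_ae_eq
  refine ⟨BoundedContinuousFunction.const ℝ c + primitive (inclL1 g), hc, fun x _ => ?_⟩
  simp [primitive_zero_right]

lemma meanL1_inclL1 (g : L2T) : meanL1 (inclL1 g) = ∫ x in (0 : ℝ)..1, g x :=
  meanL1_of_ae (coeFn_inclL1 g)

lemma hasL1Deriv_expQ (c : ℝ) (q : L2T) :
    HasL1Deriv (expQ c q) (c • mulB (expQ c q) (inclL1 q)) := by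
  simpa only [expQ, map_smul] using hasL1Deriv_expB_primitive (c • inclL1 q)

lemma meanL1_expQ_mul (c : ℝ) {q : L2T} (hq : ∫ x in (0 : ℝ)..1, q x = 0) :
    meanL1 (c • mulB (expQ c q) (inclL1 q)) = 0 := by
  rw [← (hasL1Deriv_expQ c q).one_eq_zero_iff, expQ_apply, expQ_apply, primitive_inclL1_one, hq,
    primitive_zero_right]

/-! ### Norm estimates for the Riccati map -/

lemma norm_toL2_le (g : ℝ →ᵇ ℝ) {C : ℝ} (hC : 0 ≤ C) (hg : ∀ x, |g x| ≤ C) : ‖toL2 g‖ ≤ C := by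
  refine le_of_sq_le_sq ?_ hC
  rw [norm_sq_of_ae (coeFn_toL2 g)]
  refine (intervalIntegral.integral_mono_on (g := fun _ => C ^ 2) zero_le_one
    ((g.continuous.pow 2).intervalIntegrable _ _) intervalIntegrable_const
    fun x _ => ?_).trans (by simp)
  exact sq_le_sq.2 ((hg x).trans_eq (abs_of_nonneg hC).symm)

lemma inner_toL2 (g : L2T) (w : ℝ →ᵇ ℝ) :
    inner ℝ g (toL2 w) = ∫ x in (0 : ℝ)..1, g x * w x := by
  rw [inner_L2T]
  refine integral_period_congr ?_
  filter_upwards [coeFn_toL2 w] with x hx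
  rw [hx]

lemma inner_toL2_one (g : L2T) : inner ℝ g (toL2 1) = ∫ x in (0 : ℝ)..1, g x := by
  simp [inner_toL2]

lemma norm_sub_mean_le (g : L2T) (c : ℝ) :
    ‖g - (∫ x in (0 : ℝ)..1, g x) • toL2 1‖ ≤ ‖g - c • toL2 1‖ := by
  refine le_of_sq_le_sq ?_ (norm_nonneg _)
  simp only [norm_sub_sq_real, inner_smul_right, inner_toL2_one, norm_smul, norm_toL2_one,
    mul_one, Real.norm_eq_abs, sq_abs]
  linarith [sq_nonneg (c - ∫ x in (0 : ℝ)..1, g x)]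

lemma invDeriv_eq (f : L1T) : invDeriv f = toL2 (primitive (center f))
    - (∫ x in (0 : ℝ)..1, toL2 (primitive (center f)) x) • toL2 1 := by
  rw [integral_period_congr (coeFn_toL2 (primitive (center f))),
    ← meanL1_of_ae (coeFn_toL1 (primitive (center f)))]
  simp [invDeriv, periodicPrimitive]

lemma norm_invDeriv_le_center (f : L1T) : ‖invDeriv f‖ ≤ ‖center f‖ := by
  rw [invDeriv_eq]
  refine (norm_sub_mean_le _ 0).trans ?_
  rw [zero_smul, sub_zero]
  exact norm_toL2_le _ (norm_nonneg _) fun x => abs_primitive_le _ x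

lemma norm_invDeriv_le (f : L1T) : ‖invDeriv f‖ ≤ 2 * ‖f‖ := by
  have h_one : ‖toL1 1‖ ≤ 1 := norm_toL1_le _ fun x => by simp
  refine (norm_invDeriv_le_center f).trans ?_
  calc ‖center f‖ ≤ ‖f‖ + |meanL1 f| * ‖toL1 1‖ := by
        rw [center_apply, ← Real.norm_eq_abs, ← norm_smul]
        exact norm_sub_le _ _
    _ ≤ ‖f‖ + ‖f‖ * 1 := by
        gcongr
        exact abs_meanL1_le f
    _ = 2 * ‖f‖ := by ring

lemma inclL1_toL2 (g : ℝ →ᵇ ℝ) : inclL1 (toL2 g) = toL1 g := by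
  refine Lp.ext ?_
  filter_upwards [coeFn_inclL1 (toL2 g), coeFn_toL2 g, coeFn_toL1 g] with x h1 h2 h3
  rw [h1, h2, h3]

lemma norm_invDeriv_inclL1_le (g : L2T) (c : ℝ) :
    ‖invDeriv (inclL1 g)‖ ≤ ‖g - c • toL2 1‖ := by
  have h_center : center (inclL1 g) = inclL1 (g - (∫ x in (0 : ℝ)..1, g x) • toL2 1) := by
    rw [center_apply, map_sub, map_smul, inclL1_toL2, meanL1_inclL1]
  refine (norm_invDeriv_le_center _).trans ?_
  rw [h_center]
  exact (norm_inclL1_le _).trans (norm_sub_mean_le g c)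

lemma abs_exp_sub_one_le (t : ℝ) : |Real.exp t - 1| ≤ |t| * Real.exp |t| := by
  have h_neg : 1 - t ≤ Real.exp (-t) := by linarith [Real.add_one_le_exp (-t)]
  rcases le_total 0 t with h | h
  · have h_mul : Real.exp (-t) * Real.exp t = 1 := by rw [← Real.exp_add]; simp
    rw [abs_of_nonneg (by linarith [Real.one_le_exp h]), abs_of_nonneg h]
    nlinarith [Real.exp_pos t]
  · rw [abs_of_nonpos (by linarith [Real.exp_le_one_iff.2 h]), abs_of_nonpos h]
    nlinarith [Real.add_one_le_exp t]

section Bounds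

variable {α β A : ℝ}

lemma abs_expTerm_sub_le (hβ : 0 ≤ β) (hA : 0 ≤ A) (q : L2T) (x : ℝ) :
    |expTerm β A q x - A| ≤ β * A * ‖q‖ * Real.exp (β * ‖q‖) := by
  set y := primitive (inclL1 q) x
  have h_arg : |-β * y| ≤ β * ‖q‖ := by
    rw [abs_mul, abs_neg, abs_of_nonneg hβ]
    exact mul_le_mul_of_nonneg_left (abs_primitive_inclL1_le q x) hβ
  calc |expTerm β A q x - A| = A * |Real.exp (-β * y) - 1| := by
        rw [expTerm_apply, ← mul_sub_one, abs_mul, abs_of_nonneg hA]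
    _ ≤ A * (|-β * y| * Real.exp |-β * y|) :=
        mul_le_mul_of_nonneg_left (abs_exp_sub_one_le _) hA
    _ ≤ A * (β * ‖q‖ * Real.exp (β * ‖q‖)) := by gcongr
    _ = _ := by ring

lemma abs_expTerm_sub_le_mul_exp (hβ : 0 ≤ β) (hA : 0 ≤ A) (q : L2T) (x : ℝ) :
    |expTerm β A q x - A| ≤ A * Real.exp (β * ‖q‖) := by
  have h_exp : A * 1 ≤ A * Real.exp (β * ‖q‖) :=
    mul_le_mul_of_nonneg_left (Real.one_le_exp (by positivity)) hA
  rw [abs_le]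
  constructor <;> linarith [expTerm_nonneg β hA q x, expTerm_le hβ hA q x]

lemma norm_riccati_le (hβ : 0 ≤ β) (hA : 0 ≤ A) (q : L2T) :
    ‖riccati α β A q‖ ≤ ‖q‖ * (3 + 2 * |α| * ‖q‖ + β * A * Real.exp (β * ‖q‖)) := by
  have h_split : riccati α β A q = q + α • invDeriv (mulL2 q q)
      + invDeriv (inclL1 (toL2 (expTerm β A q))) := by
    rw [riccati, lowerL1, inclL1_toL2, map_add, map_smul, add_assoc]
  have h_sq : ‖α • invDeriv (mulL2 q q)‖ ≤ |α| * (2 * (‖q‖ * ‖q‖)) := by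
    rw [norm_smul, Real.norm_eq_abs]
    gcongr
    exact (norm_invDeriv_le _).trans (mul_le_mul_of_nonneg_left (norm_mulL2_le q q) (by norm_num))
  have h_exp : ‖invDeriv (inclL1 (toL2 (expTerm β A q)))‖
      ≤ β * A * ‖q‖ * Real.exp (β * ‖q‖) := by
    refine (norm_invDeriv_inclL1_le _ A).trans ?_
    rw [← map_smul, ← map_sub]
    refine norm_toL2_le _ (by positivity) fun x => ?_
    simpa using abs_expTerm_sub_le hβ hA q x
  rw [h_split]
  refine (norm_add₃_le).trans ?_
  linarith [norm_nonneg q]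

lemma integral_expTerm_mul_deriv {q : L2T} {ρ : ℝ →ᵇ ℝ} {a : L1T}
    (hq0 : ∫ x in (0 : ℝ)..1, q x = 0) (hqρ : q =ᵐ[periodMeasure] ρ) (hρ : HasL1Deriv ρ a)
    (ha : meanL1 a = 0) :
    ∫ x in (0 : ℝ)..1, expTerm β A q x * a x
      = β * ∫ x in (0 : ℝ)..1, expTerm β A q x * ρ x ^ 2 := by
  set b : L1T := (-β) • mulB (expQ (-β) q) (inclL1 q)
  have hu : HasL1Deriv (expTerm β A q) (A • b) := (hasL1Deriv_expQ (-β) q).const_smul A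
  have hub : meanL1 (A • b) = 0 := by rw [map_smul, meanL1_expQ_mul _ hq0, smul_zero]
  have h_int : ∫ x in (0 : ℝ)..1, ρ x * (A • b : L1T) x
      = ∫ x in (0 : ℝ)..1, -β * (expTerm β A q x * ρ x ^ 2) := by
    refine integral_period_congr ?_
    filter_upwards [Lp.coeFn_smul A b, Lp.coeFn_smul (-β) (mulB (expQ (-β) q) (inclL1 q)),
      coeFn_mulB (expQ (-β) q) (inclL1 q), coeFn_inclL1 q, hqρ] with x h1 h2 h3 h4 h5
    rw [h1, Pi.smul_apply, h2, Pi.smul_apply, h3, h4, h5, expTerm_apply, expQ_apply, smul_eq_mul,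
      smul_eq_mul]
    ring
  have h_parts := hρ.integral_mul_eq_neg hu ha hub
  rw [h_int, intervalIntegral.integral_const_mul] at h_parts
  linarith

section Smooth

variable {q dq : L2T} {ρ : ℝ →ᵇ ℝ}

lemma exists_eq_zero_of_integral_eq_zero (h : ∫ x in (0 : ℝ)..1, ρ x = 0) :
    ∃ y ∈ Icc (0 : ℝ) 1, ρ y = 0 := by
  obtain ⟨y, hy, hρy⟩ := exists_eq_interval_average zero_ne_one ρ.continuous.continuousOn
  refine ⟨y, uIoo_subset_uIcc_self.trans (uIcc_of_le zero_le_one).subset hy, ?_⟩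
  rw [hρy, interval_average_eq, h, smul_zero]

lemma sq_le_norm_mul_norm_deriv (hq0 : ∫ x in (0 : ℝ)..1, q x = 0)
    (hd0 : ∫ x in (0 : ℝ)..1, dq x = 0) (hqρ : q =ᵐ[periodMeasure] ρ)
    (hρ : HasL1Deriv ρ (inclL1 dq)) {x : ℝ} (hx : x ∈ Icc (0 : ℝ) 1) :
    ρ x ^ 2 ≤ ‖q‖ * ‖dq‖ := by
  obtain ⟨y, hy, hy0⟩ := exists_eq_zero_of_integral_eq_zero
    ((integral_period_congr hqρ).symm.trans hq0)
  have hmul : mulB ρ (inclL1 dq) = mulL2 q dq := by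
    refine Lp.ext ?_
    filter_upwards [coeFn_mulB ρ (inclL1 dq), coeFn_inclL1 dq, coeFn_mulL2 q dq, hqρ]
      with x h1 h2 h3 h4
    rw [h1, h2, h3, h4]
  have hsq : HasL1Deriv (ρ * ρ) (2 • mulL2 q dq) := by
    simpa only [hmul, two_nsmul] using hρ.mul hρ
  have hsq_mean : meanL1 (2 • mulL2 q dq) = 0 := by
    have h_per : ρ 1 = ρ 0 := hρ.one_eq_zero_iff.2 ((meanL1_inclL1 dq).trans hd0)
    rw [← hsq.one_eq_zero_iff, BoundedContinuousFunction.mul_apply,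
      BoundedContinuousFunction.mul_apply, h_per]
  calc ρ x ^ 2 = (ρ * ρ) x - (ρ * ρ) y := by simp [hy0, pow_two]
    _ ≤ 1 / 2 * ‖2 • mulL2 q dq‖ :=
        (le_abs_self _).trans (hsq.abs_sub_le hsq_mean hy hx)
    _ ≤ 1 / 2 * (2 * (‖q‖ * ‖dq‖)) := by
        gcongr
        refine norm_nsmul_le.trans ?_
        gcongr
        · norm_num
        · exact norm_mulL2_le q dq
    _ = ‖q‖ * ‖dq‖ := by ring

/-- The function `α ρ² + u - c₀`, the difference between `P(q)` and `q'` when `q = ρ`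
almost everywhere. -/
def lowerL2 (α β A : ℝ) (q : L2T) (ρ : ℝ →ᵇ ℝ) : L2T :=
  toL2 (α • ρ ^ 2 + expTerm β A q) - meanTerm α β A q • toL2 1

lemma lowerTerm_ae_eq (hqρ : q =ᵐ[periodMeasure] ρ) :
    lowerTerm α β A q =ᵐ[periodMeasure] (α • ρ ^ 2 + expTerm β A q : ℝ →ᵇ ℝ) := by
  filter_upwards [hqρ, ae_Icc] with x hx hx1
  rw [lowerTerm, hx, ← primitive_inclL1_eq_primQ q hx1, ← expTerm_apply]
  rfl

lemma coeFn_lowerL2 (hqρ : q =ᵐ[periodMeasure] ρ) : lowerL2 α β A q ρ =ᵐ[periodMeasure]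
    fun x => lowerTerm α β A q x - meanTerm α β A q := by
  filter_upwards [lowerTerm_ae_eq (α := α) (β := β) (A := A) hqρ,
    Lp.coeFn_sub (toL2 (α • ρ ^ 2 + expTerm β A q)) (meanTerm α β A q • toL2 1),
    Lp.coeFn_smul (meanTerm α β A q) (toL2 1), coeFn_toL2 (α • ρ ^ 2 + expTerm β A q),
    coeFn_toL2 1] with x h1 h2 h3 h4 h5
  rw [lowerL2, h1, h2, Pi.sub_apply, h3, Pi.smul_apply, h4, h5]
  simp

lemma coeFn_add_lowerL2 (dq : L2T) (hqρ : q =ᵐ[periodMeasure] ρ) :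
    (dq + lowerL2 α β A q ρ : L2T) =ᵐ[periodMeasure]
      fun x => dq x + lowerTerm α β A q x - meanTerm α β A q := by
  filter_upwards [Lp.coeFn_add dq (lowerL2 α β A q ρ), coeFn_lowerL2 hqρ] with x h1 h2
  rw [h1, Pi.add_apply, h2, add_sub_assoc]

lemma eq_add_lowerL2 {p : L2T} (hqρ : q =ᵐ[periodMeasure] ρ)
    (hp : ∀ᵐ x ∂periodMeasure, p x = dq x + lowerTerm α β A q x - meanTerm α β A q) :
    p = dq + lowerL2 α β A q ρ :=
  Lp.ext (EventuallyEq.trans hp (coeFn_add_lowerL2 dq hqρ).symm)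

lemma inner_deriv_lowerL2 (hq0 : ∫ x in (0 : ℝ)..1, q x = 0)
    (hd0 : ∫ x in (0 : ℝ)..1, dq x = 0) (hqρ : q =ᵐ[periodMeasure] ρ)
    (hρ : HasL1Deriv ρ (inclL1 dq)) :
    inner ℝ dq (lowerL2 α β A q ρ) = β * ∫ x in (0 : ℝ)..1, expTerm β A q x * ρ x ^ 2 := by
  have hmean : meanL1 (inclL1 dq) = 0 := (meanL1_inclL1 dq).trans hd0
  have hint (w : ℝ →ᵇ ℝ) :
      inner ℝ dq (toL2 w) = ∫ x in (0 : ℝ)..1, w x * inclL1 dq x := by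
    rw [inner_toL2]
    refine integral_period_congr ?_
    filter_upwards [coeFn_inclL1 dq] with x hx
    rw [hx, mul_comm]
  rw [lowerL2, inner_sub_right, inner_smul_right, inner_toL2_one, hd0, mul_zero, sub_zero,
    map_add, map_smul, inner_add_right, inner_smul_right, hint, hint,
    integral_expTerm_mul_deriv hq0 hqρ hρ hmean]
  simp only [BoundedContinuousFunction.coe_pow, Pi.pow_apply]
  rw [hρ.integral_sq_mul_deriv hmean, mul_zero, zero_add]

lemma integral_expTerm_mul_sq_le (hβ : 0 ≤ β) (hA : 0 ≤ A) (hqρ : q =ᵐ[periodMeasure] ρ) :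
    ∫ x in (0 : ℝ)..1, expTerm β A q x * ρ x ^ 2 ≤ A * Real.exp (β * ‖q‖) * ‖q‖ ^ 2 := by
  rw [norm_sq_of_ae hqρ, ← intervalIntegral.integral_const_mul]
  exact intervalIntegral.integral_mono_on zero_le_one
    (((expTerm β A q).continuous.mul (ρ.continuous.pow 2)).intervalIntegrable _ _)
    ((continuous_const.mul (ρ.continuous.pow 2)).intervalIntegrable _ _)
    fun x _ => mul_le_mul_of_nonneg_right (expTerm_le hβ hA q x) (sq_nonneg _)

lemma norm_lowerL2_sq_le (hβ : 0 ≤ β) (hA : 0 ≤ A) (hq0 : ∫ x in (0 : ℝ)..1, q x = 0)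
    (hd0 : ∫ x in (0 : ℝ)..1, dq x = 0) (hqρ : q =ᵐ[periodMeasure] ρ)
    (hρ : HasL1Deriv ρ (inclL1 dq)) :
    ‖lowerL2 α β A q ρ‖ ^ 2 ≤ (α ^ 2 * (‖q‖ * ‖dq‖) + 2 * |α| * (A * Real.exp (β * ‖q‖)))
      * ‖q‖ ^ 2 + (β * A * ‖q‖ * Real.exp (β * ‖q‖)) ^ 2 := by
  set e := Real.exp (β * ‖q‖)
  set w : ℝ →ᵇ ℝ := α • ρ ^ 2 + expTerm β A q
  have hm : meanTerm α β A q = ∫ x in (0 : ℝ)..1, toL2 w x :=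
    integral_period_congr ((lowerTerm_ae_eq hqρ).trans (coeFn_toL2 w).symm)
  have h_pt (x : ℝ) (hx : x ∈ Icc (0 : ℝ) 1) : (w - A • 1 : ℝ →ᵇ ℝ) x ^ 2 ≤
      (α ^ 2 * (‖q‖ * ‖dq‖) + 2 * |α| * (A * e)) * ρ x ^ 2 + (β * A * ‖q‖ * e) ^ 2 := by
    set v := expTerm β A q x - A
    have hwv : (w - A • 1 : ℝ →ᵇ ℝ) x = α * ρ x ^ 2 + v := by simp [w, v]; ring
    have hv_sq : v ^ 2 ≤ (β * A * ‖q‖ * e) ^ 2 :=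
      sq_le_sq.2 ((abs_expTerm_sub_le hβ hA q x).trans (le_abs_self _))
    have hv_mul : α * v ≤ |α| * (A * e) := (le_abs_self _).trans
      ((abs_mul α v).trans_le
        (mul_le_mul_of_nonneg_left (abs_expTerm_sub_le_mul_exp hβ hA q x) (abs_nonneg α)))
    have h_quartic : α ^ 2 * ρ x ^ 2 ≤ α ^ 2 * (‖q‖ * ‖dq‖) :=
      mul_le_mul_of_nonneg_left (sq_le_norm_mul_norm_deriv hq0 hd0 hqρ hρ hx) (sq_nonneg α)
    rw [hwv]
    nlinarith [mul_le_mul_of_nonneg_right hv_mul (sq_nonneg (ρ x)),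
      mul_le_mul_of_nonneg_right h_quartic (sq_nonneg (ρ x))]
  have h_int : IntervalIntegrable (fun x => ρ x ^ 2) volume 0 1 :=
    (ρ.continuous.pow 2).intervalIntegrable _ _
  calc ‖lowerL2 α β A q ρ‖ ^ 2 ≤ ‖toL2 (w - A • 1)‖ ^ 2 := by
        rw [lowerL2, hm, map_sub, map_smul]
        exact pow_le_pow_left₀ (norm_nonneg _) (norm_sub_mean_le _ A) 2
    _ ≤ ∫ x in (0 : ℝ)..1, ((α ^ 2 * (‖q‖ * ‖dq‖) + 2 * |α| * (A * e)) * ρ x ^ 2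
          + (β * A * ‖q‖ * e) ^ 2) := by
        rw [norm_sq_of_ae (coeFn_toL2 _)]
        exact intervalIntegral.integral_mono_on zero_le_one
          (((w - A • 1 : ℝ →ᵇ ℝ).continuous.pow 2).intervalIntegrable _ _)
          ((h_int.const_mul _).add intervalIntegrable_const) h_pt
    _ = _ := by
        rw [intervalIntegral.integral_add (h_int.const_mul _) intervalIntegrable_const,
          intervalIntegral.integral_const_mul, ← norm_sq_of_ae hqρ]
        simp

end Smooth

lemma norm_sq_riccati_bounds (hβ : 0 ≤ β) (hA : 0 ≤ A) {q dq p : L2T}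
    (hq0 : ∫ x in (0 : ℝ)..1, q x = 0) (hd : IsWeakDeriv 1 q dq)
    (hp : ∀ᵐ x ∂periodMeasure, p x = dq x + lowerTerm α β A q x - meanTerm α β A q) :
    ‖dq‖ ^ 2 ≤ ‖p‖ ^ 2 ∧ ‖p‖ ^ 2 ≤ ‖dq‖ ^ 2 + 2 * α ^ 2 * ‖q‖ ^ 3 * ‖dq‖
      + A * (β + |α|) * (2 + β * A) * ‖q‖ ^ 2 * Real.exp (2 * β * ‖q‖) := by
  obtain ⟨ρ, hqρ, hρ⟩ := hd.exists_hasL1Deriv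
  have hd0 := hd.integral_eq_zero
  set I := ∫ x in (0 : ℝ)..1, expTerm β A q x * ρ x ^ 2
  have h_norm : ‖p‖ ^ 2 = ‖dq‖ ^ 2 + 2 * (β * I) + ‖lowerL2 α β A q ρ‖ ^ 2 := by
    rw [eq_add_lowerL2 hqρ hp, norm_add_sq_real, inner_deriv_lowerL2 hq0 hd0 hqρ hρ]
  have hI0 : 0 ≤ β * I := mul_nonneg hβ (intervalIntegral.integral_nonneg zero_le_one fun x _ =>
    mul_nonneg (expTerm_nonneg β hA q x) (sq_nonneg _))
  refine ⟨by rw [h_norm]; linarith [sq_nonneg ‖lowerL2 α β A q ρ‖], ?_⟩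
  set e := Real.exp (β * ‖q‖)
  have he_sq : Real.exp (2 * β * ‖q‖) = e ^ 2 := by
    rw [← Real.exp_nat_mul]; congr 1; push_cast; ring
  have he_le : A * (β + |α|) * ‖q‖ ^ 2 * e ≤ A * (β + |α|) * ‖q‖ ^ 2 * e ^ 2 :=
    mul_le_mul_of_nonneg_left (le_self_pow₀ (Real.one_le_exp (by positivity)) two_ne_zero)
      (by positivity)
  have hI := mul_le_mul_of_nonneg_left (integral_expTerm_mul_sq_le hβ hA hqρ) hβ
  have h_quartic : 0 ≤ α ^ 2 * ‖q‖ ^ 3 * ‖dq‖ := by positivity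
  have h_cross : 0 ≤ A ^ 2 * (β * |α|) * ‖q‖ ^ 2 * e ^ 2 := by positivity
  rw [h_norm, he_sq]
  linear_combination norm_lowerL2_sq_le (α := α) hβ hA hq0 hd0 hqρ hρ + 2 * hI + 2 * he_le
    + h_cross + h_quartic

end Bounds

/-! ### The a priori bound in `ℋ₀` -/

lemma integral_mul_le_of_antivary {f g : ℝ → ℝ} (hf : Continuous f) (hg : Continuous g)
    (hfg : Antivary f g) : ∫ x in (0 : ℝ)..1, f x * g x
      ≤ (∫ x in (0 : ℝ)..1, f x) * ∫ x in (0 : ℝ)..1, g x := by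
  -- Chebyshev's argument, at a point `y` where `g` takes its mean value.
  obtain ⟨y, -, hy⟩ := exists_eq_interval_average zero_ne_one hg.continuousOn
  rw [interval_average_eq, sub_zero, inv_one, one_smul] at hy
  have hi {h : ℝ → ℝ} (hh : Continuous h) : IntervalIntegrable h volume 0 1 :=
    hh.intervalIntegrable _ _
  have h_le : ∫ x in (0 : ℝ)..1, f x * g x ≤ ∫ x in (0 : ℝ)..1, f x * g y + f y * (g x - g y) :=
    intervalIntegral.integral_mono_on zero_le_one (hi (by fun_prop)) (hi (by fun_prop))
      fun x _ => by linarith [hfg.sub_mul_sub_nonpos y x]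
  refine h_le.trans_eq ?_
  rw [intervalIntegral.integral_add (hi (by fun_prop)) (hi (by fun_prop)),
    intervalIntegral.integral_mul_const, intervalIntegral.integral_const_mul,
    intervalIntegral.integral_sub (hi hg) intervalIntegrable_const, ← hy]
  simp

lemma intervalIntegrable_sq (q : L2T) : IntervalIntegrable (fun x => q x ^ 2) volume 0 1 := by
  rw [intervalIntegrable_iff_integrableOn_Ioc_of_le zero_le_one]
  exact (Lp.memLp q).integrable_sq

lemma meanTerm_eq (α β A : ℝ) (q : L2T) :
    meanTerm α β A q = α * ‖q‖ ^ 2 + ∫ x in (0 : ℝ)..1, expTerm β A q x := by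
  have h_lower : lowerTerm α β A q =ᵐ[periodMeasure] fun x => α * q x ^ 2 + expTerm β A q x := by
    filter_upwards [ae_Icc] with x hx
    rw [lowerTerm, expTerm_apply, primitive_inclL1_eq_primQ q hx]
  rw [meanTerm, integral_period_congr h_lower, norm_sq_L2T, ← intervalIntegral.integral_const_mul]
  exact intervalIntegral.integral_add ((intervalIntegrable_sq q).const_mul α)
    ((expTerm β A q).continuous.intervalIntegrable _ _)

section ExpWeight

variable (c : ℝ) (q : L2T)

lemma expQ_sq_apply (x : ℝ) : expQ c q x ^ 2 = expQ (2 * c) q x := by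
  rw [expQ_apply, expQ_apply, ← Real.exp_nat_mul, Nat.cast_ofNat, mul_assoc]

lemma norm_sq_toL2_expQ : ‖toL2 (expQ c q)‖ ^ 2 = ∫ x in (0 : ℝ)..1, expQ (2 * c) q x := by
  simp only [norm_sq_of_ae (coeFn_toL2 (expQ c q)), expQ_sq_apply]

lemma norm_sq_mulB_expQ :
    ‖mulB (expQ c q) q‖ ^ 2 = ∫ x in (0 : ℝ)..1, expQ (2 * c) q x * q x ^ 2 := by
  simp only [norm_sq_of_ae (coeFn_mulB (expQ c q) q), mul_pow, expQ_sq_apply]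

lemma toL2_expQ_ne_zero : toL2 (expQ c q) ≠ 0 := by
  refine norm_ne_zero_iff.1 (pow_ne_zero_iff two_ne_zero |>.1 ?_)
  rw [norm_sq_toL2_expQ]
  refine (intervalIntegral.intervalIntegral_pos_of_pos_on
    ((expQ (2 * c) q).continuous.intervalIntegrable _ _) (fun x _ => ?_) zero_lt_one).ne'
  rw [expQ_apply]
  exact Real.exp_pos _

lemma mulB_expQ_inclL1 : mulB (expQ (2 * c) q) (inclL1 q)
    = mulL2 (toL2 (expQ c q)) (mulB (expQ c q) q) := by
  refine Lp.ext ?_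
  filter_upwards [coeFn_mulB (expQ (2 * c) q) (inclL1 q), coeFn_inclL1 q, coeFn_toL2 (expQ c q),
    coeFn_mulL2 (toL2 (expQ c q)) (mulB (expQ c q) q), coeFn_mulB (expQ c q) q]
    with x h1 h2 h3 h4 h5
  rw [h1, h2, h4, h3, h5, ← expQ_sq_apply]
  ring

variable {q} (hq : ∫ x in (0 : ℝ)..1, q x = 0)
include hq

lemma expQ_two_mul_le {x : ℝ} (hx : x ∈ Icc (0 : ℝ) 1) : expQ (2 * c) q x
    ≤ ‖toL2 (expQ c q)‖ ^ 2 + |c| * (‖toL2 (expQ c q)‖ * ‖mulB (expQ c q) q‖) := by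
  set K := |c| * (‖toL2 (expQ c q)‖ * ‖mulB (expQ c q) q‖)
  have h_deriv : 1 / 2 * ‖(2 * c) • mulB (expQ (2 * c) q) (inclL1 q)‖ ≤ K := by
    rw [norm_smul, mulB_expQ_inclL1, Real.norm_eq_abs, abs_mul, abs_two]
    linarith [mul_le_mul_of_nonneg_left
      (norm_mulL2_le (toL2 (expQ c q)) (mulB (expQ c q) q)) (abs_nonneg c)]
  have h_osc : ∀ y ∈ Icc (0 : ℝ) 1, expQ (2 * c) q x - K ≤ expQ (2 * c) q y := fun y hy => by
    linarith [le_abs_self (expQ (2 * c) q x - expQ (2 * c) q y),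
      (hasL1Deriv_expQ (2 * c) q).abs_sub_le (meanL1_expQ_mul _ hq) hy hx]
  have h_mean := intervalIntegral.integral_mono_on zero_le_one
    (intervalIntegrable_const (μ := volume))
    ((expQ (2 * c) q).continuous.intervalIntegrable _ _) h_osc
  rw [intervalIntegral.integral_const, sub_zero, one_smul, ← norm_sq_toL2_expQ] at h_mean
  linarith

lemma norm_sq_mulB_expQ_two_mul_le : ‖mulB (expQ (2 * c) q) q‖ ^ 2
    ≤ (‖toL2 (expQ c q)‖ ^ 2 + |c| * (‖toL2 (expQ c q)‖ * ‖mulB (expQ c q) q‖))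
      * ‖mulB (expQ c q) q‖ ^ 2 := by
  have h_int : IntervalIntegrable (fun x => expQ (2 * c) q x * q x ^ 2) volume 0 1 :=
    (intervalIntegrable_sq q).continuousOn_mul (expQ (2 * c) q).continuous.continuousOn
  rw [norm_sq_of_ae (coeFn_mulB (expQ (2 * c) q) q), norm_sq_mulB_expQ c q,
    ← intervalIntegral.integral_const_mul]
  refine intervalIntegral.integral_mono_on zero_le_one ?_ (h_int.const_mul _) fun x hx => ?_
  · simp only [mul_pow, pow_two (expQ (2 * c) q _), mul_assoc]
    exact h_int.continuousOn_mul (expQ (2 * c) q).continuous.continuousOn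
  · have h_nonneg : 0 ≤ expQ (2 * c) q x * q x ^ 2 := by
      rw [← expQ_sq_apply]
      positivity
    linarith [mul_le_mul_of_nonneg_right (expQ_two_mul_le c hq hx) h_nonneg]

end ExpWeight

/-- The pairing of `P(q)` with `-e^{2αQ}`, integrated by parts: `2αe^{2αQ}q` is the derivative of
`e^{2αQ}`. -/
lemma inner_riccati_mulB_expQ (α β A : ℝ) {q : L2T} (hq : ∫ x in (0 : ℝ)..1, q x = 0) :
    2 * α * inner ℝ (riccati α β A q) (mulB (expQ (2 * α) q) q)
      = α * ‖mulB (expQ α q) q‖ ^ 2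
        - (∫ x in (0 : ℝ)..1, expTerm β A q x * expQ (2 * α) q x)
        + meanTerm α β A q * ‖toL2 (expQ α q)‖ ^ 2 := by
  set F := expQ (2 * α) q
  set N := lowerL1 α β A q
  set b := (2 * α) • mulB F (inclL1 q)
  have hF : IntervalIntegrable F volume 0 1 := F.continuous.intervalIntegrable _ _
  have hFq : IntervalIntegrable (fun x => F x * q x ^ 2) volume 0 1 :=
    (intervalIntegrable_sq q).continuousOn_mul F.continuous.continuousOn
  have hFu : IntervalIntegrable (fun x => expTerm β A q x * F x) volume 0 1 :=
    ((expTerm β A q).continuous.mul F.continuous).intervalIntegrable _ _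
  have h_inner : 2 * α * inner ℝ (riccati α β A q) (mulB F q) = ∫ x in (0 : ℝ)..1,
      (2 * α * (F x * q x ^ 2) + periodicPrimitive N x * b x) := by
    rw [inner_L2T, ← intervalIntegral.integral_const_mul]
    refine integral_period_congr ?_
    filter_upwards [Lp.coeFn_add q (invDeriv N), coeFn_invDeriv N, coeFn_mulB F q,
      Lp.coeFn_smul (2 * α) (mulB F (inclL1 q)), coeFn_mulB F (inclL1 q), coeFn_inclL1 q]
      with x h1 h2 h3 h4 h5 h6
    rw [riccati, h1, Pi.add_apply, h2, h3, h4, Pi.smul_apply, h5, h6, smul_eq_mul]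
    ring
  have h_lower : ∫ x in (0 : ℝ)..1, F x * center N x = ∫ x in (0 : ℝ)..1,
      (α * (F x * q x ^ 2) + expTerm β A q x * F x - meanTerm α β A q * F x) := by
    refine integral_period_congr ?_
    filter_upwards [coeFn_center N, coeFn_lowerL1 α β A q, ae_Icc] with x h1 h2 hx
    rw [h1, h2, lowerTerm, meanL1_lowerL1, expTerm_apply, primitive_inclL1_eq_primQ q hx]
    ring
  rw [h_inner, intervalIntegral.integral_add (hFq.const_mul _)
      ((intervalIntegrable_L1T b).continuousOn_mul
        (periodicPrimitive N).continuous.continuousOn),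
    (hasL1Deriv_periodicPrimitive N).integral_mul_eq_neg (hasL1Deriv_expQ (2 * α) q)
      (meanL1_center N) (meanL1_expQ_mul _ hq), h_lower,
    intervalIntegral.integral_sub ((hFq.const_mul _).add hFu) (hF.const_mul _),
    intervalIntegral.integral_add (hFq.const_mul _) hFu, norm_sq_mulB_expQ, norm_sq_toL2_expQ]
  simp only [intervalIntegral.integral_const_mul]
  ring

lemma le_of_weighted_bounds {X P a d n α : ℝ} (ha : 0 < a) (hd : 0 ≤ d) (hα : 0 ≤ α)
    (h : X * a ^ 2 + d ^ 2 ≤ 2 * (P * n)) (hn : n ^ 2 ≤ (a ^ 2 + α * (a * d)) * d ^ 2) :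
    X ≤ 2 * P ^ 2 * (1 + α ^ 2 * P ^ 2) := by
  set r := a ^ 2 + α * (a * d) with hr
  have h_young : 2 * (P * n) ≤ 2 * P ^ 2 * r + d ^ 2 / 2 := by
    refine le_of_sq_le_sq ?_ (by positivity)
    nlinarith [sq_nonneg (2 * P ^ 2 * r - d ^ 2 / 2), mul_le_mul_of_nonneg_left hn (sq_nonneg P)]
  have h_young' : 2 * P ^ 2 * (α * (a * d)) ≤ 2 * α ^ 2 * P ^ 4 * a ^ 2 + d ^ 2 / 2 := by
    linarith [sq_nonneg (2 * α * P ^ 2 * a - d)]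
  refine le_of_mul_le_mul_right ?_ (pow_pos ha 2)
  rw [hr] at h_young
  linarith

lemma norm_sq_le_norm_riccati {α β A : ℝ} (hα : 0 < α) (hβ : 0 ≤ β) (hA : 0 ≤ A) {q : L2T}
    (hq : ∫ x in (0 : ℝ)..1, q x = 0) :
    ‖q‖ ^ 2 ≤ 2 * ‖riccati α β A q‖ ^ 2 * (1 + α ^ 2 * ‖riccati α β A q‖ ^ 2) := by
  have h_antivary : Antivary (expTerm β A q) (expQ (2 * α) q) := by
    intro x y hxy
    rw [expQ_apply, expQ_apply, Real.exp_lt_exp] at hxy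
    rw [expTerm_apply, expTerm_apply]
    have := lt_of_mul_lt_mul_left hxy (by positivity)
    exact mul_le_mul_of_nonneg_left (Real.exp_le_exp.2 (by nlinarith)) hA
  have h_chebyshev := integral_mul_le_of_antivary (expTerm β A q).continuous
    (expQ (2 * α) q).continuous h_antivary
  have h_test := inner_riccati_mulB_expQ α β A hq
  have h_cauchy := mul_le_mul_of_nonneg_left
    (real_inner_le_norm (riccati α β A q) (mulB (expQ (2 * α) q) q)) (by positivity : 0 ≤ 2 * α)
  rw [meanTerm_eq] at h_test
  rw [← norm_sq_toL2_expQ] at h_chebyshev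
  refine le_of_weighted_bounds (norm_pos_iff.2 (toL2_expQ_ne_zero α q)) (norm_nonneg _) hα.le
    (le_of_mul_le_mul_left ?_ hα)
    ((norm_sq_mulB_expQ_two_mul_le α hq).trans_eq (by rw [abs_of_pos hα]))
  linarith

/-! ### Analytic families of Sobolev functions -/

/-- The mean-zero primitive of a mean-zero function, as an operator in `L²`. -/
def invDerivL2 : L2T →L[ℝ] L2T := invDeriv.comp inclL1

lemma isWeakDeriv_invDerivL2 {g : L2T} (hg : ∫ x in (0 : ℝ)..1, g x = 0) :
    IsWeakDeriv 1 (invDerivL2 g) g := isWeakDeriv_invDeriv hg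

lemma integral_invDerivL2 (g : L2T) : ∫ x in (0 : ℝ)..1, invDerivL2 g x = 0 :=
  integral_invDeriv _

lemma IsWeakDeriv.eq_mean_add {q g : L2T} (h : IsWeakDeriv 1 q g) :
    q = (∫ x in (0 : ℝ)..1, q x) • toL2 1 + invDerivL2 g := by
  refine h.eq_of_integral_eq (r := (∫ x in (0 : ℝ)..1, q x) • toL2 1 + invDerivL2 g) ?_ ?_
  · simpa only [zero_add] using
      (isWeakDeriv_one_const _).add (isWeakDeriv_invDerivL2 h.integral_eq_zero)
  · rw [integral_L2T_add, integral_L2T_smul, integral_toL2_one, integral_invDerivL2, mul_one,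
      add_zero]

lemma IsWeakDeriv.eq_invDerivL2 {q g : L2T} (h : IsWeakDeriv 1 q g)
    (hq : ∫ x in (0 : ℝ)..1, q x = 0) : q = invDerivL2 g := by
  conv_lhs => rw [h.eq_mean_add, hq, zero_smul, zero_add]

lemma HasL1Deriv.isWeakDeriv {ρ : ℝ →ᵇ ℝ} {q g : L2T} (hρ : HasL1Deriv ρ (inclL1 g))
    (hqρ : q =ᵐ[periodMeasure] ρ) (hg : ∫ x in (0 : ℝ)..1, g x = 0) : IsWeakDeriv 1 q g := by
  refine isWeakDeriv_one_of_ae_eq (c := ρ 0) hg ?_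
  filter_upwards [hqρ, ae_Icc] with x h1 hx
  rw [h1, hρ hx]

lemma mulB_congr {ρ σ : ℝ →ᵇ ℝ} (h : ρ =ᵐ[periodMeasure] σ) (f : L2T) :
    mulB ρ f = mulB σ f := by
  refine Lp.ext ?_
  filter_upwards [coeFn_mulB ρ f, coeFn_mulB σ f, h] with x h1 h2 h3
  rw [h1, h2, h3]

lemma inclL1_mulB (ρ : ℝ →ᵇ ℝ) (f : L2T) : inclL1 (mulB ρ f) = mulB ρ (inclL1 f) := by
  refine Lp.ext ?_
  filter_upwards [coeFn_inclL1 (mulB ρ f), coeFn_mulB ρ f, coeFn_mulB ρ (inclL1 f),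
    coeFn_inclL1 f] with x h1 h2 h3 h4
  rw [h1, h2, h3, h4]

lemma mulB_toL2 (ρ σ : ℝ →ᵇ ℝ) : mulB ρ (toL2 σ) = toL2 (ρ * σ) := by
  refine Lp.ext ?_
  filter_upwards [coeFn_mulB ρ (toL2 σ), coeFn_toL2 σ, coeFn_toL2 (ρ * σ)] with x h1 h2 h3
  rw [h1, h2, h3, BoundedContinuousFunction.mul_apply]

lemma IsWeakDeriv.toL2_mul {ρ σ : ℝ →ᵇ ℝ} {r s : L2T} (hρ : IsWeakDeriv 1 (toL2 ρ) r)
    (hσ : IsWeakDeriv 1 (toL2 σ) s) : IsWeakDeriv 1 (toL2 (ρ * σ)) (mulB ρ s + mulB σ r) := by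
  obtain ⟨ρ', hρρ', hρ'⟩ := hρ.exists_hasL1Deriv
  obtain ⟨σ', hσσ', hσ'⟩ := hσ.exists_hasL1Deriv
  replace hρρ' : ρ =ᵐ[periodMeasure] ρ' := (coeFn_toL2 ρ).symm.trans hρρ'
  replace hσσ' : σ =ᵐ[periodMeasure] σ' := (coeFn_toL2 σ).symm.trans hσσ'
  rw [mulB_congr hρρ', mulB_congr hσσ']
  have h_mul := hρ'.mul hσ'
  rw [← inclL1_mulB, ← inclL1_mulB, ← map_add] at h_mul
  refine h_mul.isWeakDeriv ((coeFn_toL2 (ρ * σ)).trans (hρρ'.mul hσσ')) ?_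
  rw [← meanL1_inclL1, ← h_mul.one_eq_zero_iff, BoundedContinuousFunction.mul_apply,
    BoundedContinuousFunction.mul_apply,
    hρ'.one_eq_zero_iff.2 ((meanL1_inclL1 r).trans hρ.integral_eq_zero),
    hσ'.one_eq_zero_iff.2 ((meanL1_inclL1 s).trans hσ.integral_eq_zero)]

lemma isWeakDeriv_expQ (c : ℝ) {q : L2T} (hq : ∫ x in (0 : ℝ)..1, q x = 0) :
    IsWeakDeriv 1 (toL2 (expQ c q)) (c • mulB (expQ c q) q) := by
  have h := hasL1Deriv_expQ c q
  have h_mean := meanL1_expQ_mul c hq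
  rw [← inclL1_mulB, ← map_smul] at h h_mean
  exact h.isWeakDeriv (coeFn_toL2 _) ((meanL1_inclL1 _).symm.trans h_mean)

section AnalyticFamilies

variable {E : Type*} [NormedAddCommGroup E] [NormedSpace ℝ E] {k : ℕ} {Φ Ψ : E → L2T}

/-- A family of functions in `L²` whose weak derivatives up to order `k` exist in `L²` and depend
analytically on the parameter, that is, an analytic family in the Sobolev space `H^k`. -/
def AnalyticSobolev : ℕ → (E → L2T) → Prop
  | 0, Φ => ∀ e, AnalyticAt ℝ Φ e
  | k + 1, Φ => (∀ e, AnalyticAt ℝ Φ e) ∧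
      ∃ Φ' : E → L2T, AnalyticSobolev k Φ' ∧ ∀ e, IsWeakDeriv 1 (Φ e) (Φ' e)

namespace AnalyticSobolev

lemma analyticAt (h : AnalyticSobolev k Φ) (e : E) : AnalyticAt ℝ Φ e := by
  cases k with
  | zero => exact h e
  | succ k => exact h.1 e

lemma of_succ (h : AnalyticSobolev (k + 1) Φ) : AnalyticSobolev k Φ := by
  induction k generalizing Φ with
  | zero => exact h.1
  | succ k ih =>
    obtain ⟨hΦ, Φ', hΦ', hd⟩ := h
    exact ⟨hΦ, Φ', ih hΦ', hd⟩

lemma add (hΦ : AnalyticSobolev k Φ) (hΨ : AnalyticSobolev k Ψ) :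
    AnalyticSobolev k (fun e => Φ e + Ψ e) := by
  induction k generalizing Φ Ψ with
  | zero => exact fun e => (hΦ e).add (hΨ e)
  | succ k ih =>
    obtain ⟨hΦ, Φ', hΦ', hΦd⟩ := hΦ
    obtain ⟨hΨ, Ψ', hΨ', hΨd⟩ := hΨ
    exact ⟨fun e => (hΦ e).add (hΨ e), _, ih hΦ' hΨ', fun e => (hΦd e).add (hΨd e)⟩

lemma const_smul (c : ℝ) (hΦ : AnalyticSobolev k Φ) : AnalyticSobolev k (fun e => c • Φ e) := by
  induction k generalizing Φ with
  | zero => exact fun e => (hΦ e).const_smul (c := c)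
  | succ k ih =>
    obtain ⟨hΦ, Φ', hΦ', hd⟩ := hΦ
    exact ⟨fun e => (hΦ e).const_smul (c := c), _, ih hΦ', fun e => (hd e).smul c⟩

lemma sub (hΦ : AnalyticSobolev k Φ) (hΨ : AnalyticSobolev k Ψ) :
    AnalyticSobolev k (fun e => Φ e - Ψ e) := by
  simpa only [neg_one_smul, ← sub_eq_add_neg] using hΦ.add (hΨ.const_smul (-1))

protected lemma zero (k : ℕ) : AnalyticSobolev k (fun _ : E => 0) := by
  induction k with
  | zero => exact fun e => analyticAt_const
  | succ k ih => exact ⟨fun e => analyticAt_const, _, ih, fun _ => isWeakDeriv_zero 1⟩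

lemma smul_one (k : ℕ) {m : E → ℝ} (hm : ∀ e, AnalyticAt ℝ m e) :
    AnalyticSobolev k (fun e => m e • toL2 1) := by
  have h (e : E) : AnalyticAt ℝ (fun e => m e • toL2 1) e := (hm e).smul analyticAt_const
  cases k with
  | zero => exact h
  | succ k => exact ⟨h, _, AnalyticSobolev.zero k, fun _ => isWeakDeriv_one_const _⟩

lemma invDerivL2 (hΦ : AnalyticSobolev k Φ) (h0 : ∀ e, ∫ x in (0 : ℝ)..1, Φ e x = 0) :
    AnalyticSobolev (k + 1) (fun e => RiccatiTorus.invDerivL2 (Φ e)) :=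
  ⟨fun e => analyticAt_clm_comp _ (hΦ.analyticAt e), Φ, hΦ,
    fun e => isWeakDeriv_invDerivL2 (h0 e)⟩

lemma exists_continuous (hΦ : AnalyticSobolev (k + 1) Φ) :
    ∃ R : E → (ℝ →ᵇ ℝ), (∀ e, AnalyticAt ℝ R e) ∧ ∀ e, Φ e = toL2 (R e) := by
  obtain ⟨hΦ, Φ', hΦ', hd⟩ := hΦ
  refine ⟨fun e => meanL1 (inclL1 (Φ e)) • 1 + periodicPrimitive (inclL1 (Φ' e)),
    fun e => ?_, fun e => ?_⟩
  · exact ((analyticAt_clm_comp (meanL1.comp inclL1) (hΦ e)).smul analyticAt_const).add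
      (analyticAt_clm_comp (periodicPrimitive.comp inclL1) (hΦ'.analyticAt e))
  · conv_lhs => rw [(hd e).eq_mean_add]
    rw [map_add, map_smul, meanL1_inclL1]
    rfl

lemma mulB {R : E → (ℝ →ᵇ ℝ)} (hRan : ∀ e, AnalyticAt ℝ R e)
    (hR : AnalyticSobolev k fun e => toL2 (R e)) (hΦ : AnalyticSobolev k Φ) :
    AnalyticSobolev k fun e => RiccatiTorus.mulB (R e) (Φ e) := by
  induction k generalizing R Φ with
  | zero => exact fun e => (RiccatiTorus.mulB.analyticAt_bilinear _).comp₂ (hRan e) (hΦ e)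
  | succ k ih =>
    obtain ⟨S, hSan, hΦS⟩ := hΦ.exists_continuous
    have hS : AnalyticSobolev k fun e => toL2 (S e) := by simpa only [← hΦS] using hΦ.of_succ
    have hRk := hR.of_succ
    obtain ⟨-, R', hR', hRd⟩ := hR
    obtain ⟨hΦan, Φ', hΦ', hΦd⟩ := hΦ
    refine ⟨fun e => (RiccatiTorus.mulB.analyticAt_bilinear _).comp₂ (hRan e) (hΦan e), _,
      (ih hRan hRk hΦ').add (ih hSan hS hR'), fun e => ?_⟩
    have h := (hRd e).toL2_mul (hΦS e ▸ hΦd e)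
    rwa [← mulB_toL2, ← hΦS e] at h

lemma expQ (c : ℝ) (hΦ : AnalyticSobolev k Φ) (h0 : ∀ e, ∫ x in (0 : ℝ)..1, Φ e x = 0) :
    AnalyticSobolev k fun e => toL2 (RiccatiTorus.expQ c (Φ e)) := by
  have h_an (e : E) : AnalyticAt ℝ (fun e => RiccatiTorus.expQ c (Φ e)) e :=
    (analyticAt_expQ c (Φ e)).comp (hΦ.analyticAt e)
  induction k with
  | zero => exact fun e => analyticAt_clm_comp toL2 (h_an e)
  | succ k ih =>
    exact ⟨fun e => analyticAt_clm_comp toL2 (h_an e), _,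
      (mulB h_an (ih hΦ.of_succ) hΦ.of_succ).const_smul c, fun e => isWeakDeriv_expQ c (h0 e)⟩

lemma exists_isWeakDeriv (hΦ : AnalyticSobolev k Φ) :
    ∃ Φ' : E → L2T, (∀ e, AnalyticAt ℝ Φ' e) ∧ ∀ e, IsWeakDeriv k (Φ e) (Φ' e) := by
  induction k generalizing Φ with
  | zero => exact ⟨Φ, hΦ, fun e φ _ => by simp⟩
  | succ k ih =>
    obtain ⟨-, Φ', hΦ', hd⟩ := hΦ
    obtain ⟨Φ'', hΦ'', hd'⟩ := ih hΦ'
    refine ⟨Φ'', hΦ'', fun e => ?_⟩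
    rw [add_comm]
    exact (hd e).trans (hd' e)

end AnalyticSobolev

end AnalyticFamilies

/-! ### Analytic maps into and out of `ℋ_j` -/

lemma integral_invDerivL2_iterate (j : ℕ) {g : L2T} (hg : ∫ x in (0 : ℝ)..1, g x = 0) :
    ∫ x in (0 : ℝ)..1, (invDerivL2 ^ j) g x = 0 := by
  cases j with
  | zero => simpa using hg
  | succ j =>
    rw [pow_succ', mul_apply_eq_comp]
    exact integral_invDerivL2 _

lemma isWeakDeriv_invDerivL2_iterate (j : ℕ) {g : L2T} (hg : ∫ x in (0 : ℝ)..1, g x = 0) :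
    IsWeakDeriv j ((invDerivL2 ^ j) g) g := by
  induction j with
  | zero => exact fun φ _ => by simp
  | succ j ih =>
    rw [pow_succ', mul_apply_eq_comp, add_comm]
    exact (isWeakDeriv_invDerivL2 (integral_invDerivL2_iterate j hg)).trans ih

lemma AnalyticSobolev.invDerivL2_iterate {E : Type*} [NormedAddCommGroup E] [NormedSpace ℝ E]
    (j : ℕ) {Φ : E → L2T} (hΦ : ∀ e, AnalyticAt ℝ Φ e)
    (h0 : ∀ e, ∫ x in (0 : ℝ)..1, Φ e x = 0) :
    AnalyticSobolev j (fun e => (RiccatiTorus.invDerivL2 ^ j) (Φ e)) := by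
  induction j with
  | zero => exact hΦ
  | succ j ih =>
    simp only [pow_succ', mul_apply_eq_comp]
    exact ih.invDerivL2 fun e => integral_invDerivL2_iterate j (h0 e)

lemma Sob.integral_topDeriv {j : ℕ} (q : Sob j) : ∫ x in (0 : ℝ)..1, q.topDeriv x = 0 := by
  have h := q.topDeriv_spec (fun _ => 1) ⟨contDiff_const, fun _ => rfl⟩
  have h_const : ∫ x in (0 : ℝ)..1, q.toL2 x * iteratedDeriv j (fun _ : ℝ => (1 : ℝ)) x = 0 := by
    cases j with
    | zero => simpa using q.integral_eq_zero
    | succ j => simp [iteratedDeriv_const]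
  rw [h_const] at h
  simpa using h.symm

lemma Sob.toL2_eq {j : ℕ} (q : Sob j) : q.toL2 = (invDerivL2 ^ j) q.topDeriv :=
  q.topDeriv_spec.eq_of_integral_eq (isWeakDeriv_invDerivL2_iterate j q.integral_topDeriv)
    (by rw [q.integral_eq_zero, integral_invDerivL2_iterate j q.integral_topDeriv])

/-- The top derivative `q ↦ q⁽ʲ⁾` as a continuous linear map from `ℋ_j` to `L²`. -/
def topDerivL (j : ℕ) : Sob j →L[ℝ] L2T :=
  Sob.topDeriv.mkContinuous 1 fun q => by rw [one_mul, Sob.norm_def]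

lemma analyticSobolev_toL2 (j : ℕ) : AnalyticSobolev j (Sob.toL2 : Sob j → L2T) := by
  rw [show (Sob.toL2 : Sob j → L2T) = fun q => (invDerivL2 ^ j) (topDerivL j q) from
    funext Sob.toL2_eq]
  exact AnalyticSobolev.invDerivL2_iterate j (topDerivL j).analyticAt Sob.integral_topDeriv

/-- Subtraction of the mean value in `L²`. -/
def centerL2 : L2T →L[ℝ] L2T :=
  ContinuousLinearMap.id ℝ L2T - (meanL1.comp inclL1).smulRight (toL2 1)

lemma centerL2_apply (g : L2T) : centerL2 g = g - (∫ x in (0 : ℝ)..1, g x) • toL2 1 := by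
  rw [← meanL1_inclL1]
  rfl

lemma integral_centerL2 (g : L2T) : ∫ x in (0 : ℝ)..1, centerL2 g x = 0 := by
  rw [centerL2_apply, sub_eq_add_neg, ← neg_smul, integral_L2T_add, integral_L2T_smul,
    integral_toL2_one, mul_one, add_neg_cancel]

/-- The element of `ℋ_j` whose top derivative is the centred part of a given function in `L²`. -/
def ofTopDeriv (j : ℕ) : L2T →L[ℝ] Sob j :=
  LinearMap.mkContinuous
    { toFun := fun g => (⟨(invDerivL2 ^ j) (centerL2 g),
        ⟨_, isWeakDeriv_invDerivL2_iterate j (integral_centerL2 g)⟩,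
        integral_invDerivL2_iterate j (integral_centerL2 g)⟩ : sobolev j)
      map_add' := fun g h => Subtype.ext (by simp only [map_add]; rfl)
      map_smul' := fun c g => Subtype.ext (by simp only [map_smul]; rfl) } 1
    (fun g => by
      rw [one_mul, Sob.norm_def, (Sob.topDeriv_spec _).unique
        (isWeakDeriv_invDerivL2_iterate j (integral_centerL2 g)), centerL2_apply]
      simpa only [zero_smul, sub_zero] using norm_sub_mean_le g 0)

lemma toL2_ofTopDeriv (j : ℕ) (g : L2T) :
    (ofTopDeriv j g).toL2 = (invDerivL2 ^ j) (centerL2 g) := rfl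

lemma ofTopDeriv_topDeriv {j : ℕ} (q : Sob j) : ofTopDeriv j q.topDeriv = q :=
  Sob.toL2_injective <| by
    rw [toL2_ofTopDeriv, centerL2_apply, q.integral_topDeriv, zero_smul, sub_zero, ← q.toL2_eq]

lemma AnalyticSobolev.exists_lift {E : Type*} [NormedAddCommGroup E] [NormedSpace ℝ E] {k : ℕ}
    {Φ : E → L2T} (hΦ : AnalyticSobolev k Φ) (h0 : ∀ e, ∫ x in (0 : ℝ)..1, Φ e x = 0) :
    ∃ F : E → Sob k, AnalyticOnNhd ℝ F univ ∧ ∀ e, (F e).toL2 = Φ e := by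
  obtain ⟨Φ', hΦ'an, hd⟩ := hΦ.exists_isWeakDeriv
  let F (e : E) : Sob k := (⟨Φ e, ⟨_, hd e⟩, h0 e⟩ : sobolev k)
  have hF (e : E) : ofTopDeriv k (Φ' e) = F e := by
    rw [← (F e).topDeriv_spec.unique (hd e), ofTopDeriv_topDeriv]
  exact ⟨F, fun e _ => funext hF ▸ analyticAt_clm_comp (ofTopDeriv k) (hΦ'an e), fun _ => rfl⟩

/-! ### Regularity for the Riccati map -/

section Regularity

variable {α β A : ℝ}

lemma invDeriv_center (f : L1T) : invDeriv (center f) = invDeriv f := by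
  have h : center (center f) = center f := by
    rw [center_apply (center f), meanL1_center, zero_smul, sub_zero]
  simp only [invDeriv, periodicPrimitive, ContinuousLinearMap.comp_apply, sub_apply,
    ContinuousLinearMap.smulRight_apply, h]

lemma inclL1_lowerL2 {q : L2T} {ρ : ℝ →ᵇ ℝ} (hqρ : q =ᵐ[periodMeasure] ρ) :
    inclL1 (lowerL2 α β A q ρ) = center (lowerL1 α β A q) := by
  refine Lp.ext ?_
  filter_upwards [coeFn_inclL1 (lowerL2 α β A q ρ), coeFn_lowerL2 (α := α) (β := β) (A := A) hqρ,
    coeFn_center (lowerL1 α β A q), coeFn_lowerL1 α β A q] with x h1 h2 h3 h4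
  rw [h1, h2, h3, h4, meanL1_lowerL1]

lemma integral_lowerL2 {q : L2T} {ρ : ℝ →ᵇ ℝ} (hqρ : q =ᵐ[periodMeasure] ρ) :
    ∫ x in (0 : ℝ)..1, lowerL2 α β A q ρ x = 0 := by
  rw [← meanL1_inclL1, inclL1_lowerL2 hqρ, meanL1_center]

lemma riccati_eq_add_invDerivL2 {q : L2T} {ρ : ℝ →ᵇ ℝ} (hqρ : q =ᵐ[periodMeasure] ρ) :
    riccati α β A q = q + invDerivL2 (lowerL2 α β A q ρ) := by
  rw [riccati, ← invDeriv_center, ← inclL1_lowerL2 hqρ]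
  rfl

lemma isWeakDeriv_riccati {q dq p : L2T} (hd : IsWeakDeriv 1 q dq)
    (hp : ∀ᵐ x ∂periodMeasure, p x = dq x + lowerTerm α β A q x - meanTerm α β A q) :
    IsWeakDeriv 1 (riccati α β A q) p := by
  obtain ⟨ρ, hqρ, -⟩ := hd.exists_hasL1Deriv
  rw [riccati_eq_add_invDerivL2 hqρ, eq_add_lowerL2 hqρ hp]
  exact hd.add (isWeakDeriv_invDerivL2 (integral_lowerL2 hqρ))

variable {E : Type*} [NormedAddCommGroup E] [NormedSpace ℝ E] {k : ℕ} {Φ : E → L2T}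

namespace AnalyticSobolev

lemma lowerL2 (hΦ : AnalyticSobolev k Φ) {R : E → (ℝ →ᵇ ℝ)} (hRan : ∀ e, AnalyticAt ℝ R e)
    (hΦR : ∀ e, Φ e = toL2 (R e)) (h0 : ∀ e, ∫ x in (0 : ℝ)..1, Φ e x = 0) :
    AnalyticSobolev k fun e => RiccatiTorus.lowerL2 α β A (Φ e) (R e) := by
  have h_sq : AnalyticSobolev k fun e => toL2 (R e ^ 2) := by
    have h := mulB hRan (by simpa only [← hΦR] using hΦ) hΦ
    simpa only [hΦR, mulB_toL2, ← pow_two] using h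
  have h_exp : AnalyticSobolev k fun e => toL2 (expTerm β A (Φ e)) := by
    simpa only [expTerm, map_smul] using (hΦ.expQ (-β) h0).const_smul A
  have h_mean (e : E) : AnalyticAt ℝ (fun e => meanTerm α β A (Φ e)) e := by
    simp only [← meanL1_lowerL1]
    exact analyticAt_clm_comp meanL1
      ((analyticAt_lowerL1 α β A (Φ e)).comp (hΦ.analyticAt e))
  simpa only [RiccatiTorus.lowerL2, map_add, map_smul] using
    ((h_sq.const_smul α).add h_exp).sub (smul_one k h_mean)

lemma of_riccati (h0 : ∀ e, ∫ x in (0 : ℝ)..1, Φ e x = 0) (hΦ : ∀ e, AnalyticAt ℝ Φ e)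
    (hF : AnalyticSobolev k fun e => riccati α β A (Φ e)) : AnalyticSobolev k Φ := by
  induction k with
  | zero => exact hΦ
  | succ k ih =>
    obtain ⟨R, hRan, hFR⟩ := hF.exists_continuous
    set S : E → (ℝ →ᵇ ℝ) := fun e => R e - periodicPrimitive (lowerL1 α β A (Φ e))
    have hSan (e : E) : AnalyticAt ℝ S e := (hRan e).sub (analyticAt_clm_comp periodicPrimitive
      ((analyticAt_lowerL1 α β A (Φ e)).comp (hΦ e)))
    have hΦS (e : E) : Φ e = toL2 (S e) := by
      rw [map_sub, ← hFR e]
      exact (add_sub_cancel_right _ _).symm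
    have hae (e : E) : Φ e =ᵐ[periodMeasure] S e := hΦS e ▸ coeFn_toL2 (S e)
    have h_lower := (ih hF.of_succ).lowerL2 (α := α) (β := β) (A := A) hSan hΦS h0
    have h := hF.sub (h_lower.invDerivL2 fun e => integral_lowerL2 (hae e))
    simpa only [riccati_eq_add_invDerivL2 (hae _), add_sub_cancel_right] using h

end AnalyticSobolev

end Regularity

/-! ### The Riccati map from `ℋ_{j+1}` to `ℋ_j` -/

variable {α β A : ℝ}

lemma exists_isWeakDeriv_of_riccati {q f : L2T} (hq : ∫ x in (0 : ℝ)..1, q x = 0)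
    (hf : IsWeakDeriv 1 (riccati α β A q) f) : ∃ dq, IsWeakDeriv 1 q dq := by
  have h : AnalyticSobolev 1 (fun _ : ℝ => q) :=
    AnalyticSobolev.of_riccati (α := α) (β := β) (A := A) (fun _ => hq) (fun _ => analyticAt_const)
      ⟨fun _ => analyticAt_const, fun _ => f, fun _ => analyticAt_const, fun _ => hf⟩
  obtain ⟨-, Φ', -, hd⟩ := h
  exact ⟨Φ' 0, hd 0⟩

lemma norm_le_of_isWeakDeriv_riccati (hβ : 0 ≤ β) (hA : 0 ≤ A) {q f : L2T}
    (hq : ∫ x in (0 : ℝ)..1, q x = 0) (hf : IsWeakDeriv 1 (riccati α β A q) f) : ‖q‖ ≤ ‖f‖ := by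
  obtain ⟨dq, hd⟩ := exists_isWeakDeriv_of_riccati hq hf
  obtain ⟨ρ, hqρ, -⟩ := hd.exists_hasL1Deriv
  have hp := coeFn_add_lowerL2 (α := α) (β := β) (A := A) dq hqρ
  have hqd : ‖q‖ ≤ ‖dq‖ := by
    refine (congrArg norm (hd.eq_invDerivL2 hq)).trans_le ?_
    exact (norm_invDeriv_inclL1_le dq 0).trans_eq (by rw [zero_smul, sub_zero])
  have hdf : ‖dq‖ ^ 2 ≤ ‖f‖ ^ 2 := by
    rw [hf.unique (isWeakDeriv_riccati hd hp)]
    exact (norm_sq_riccati_bounds hβ hA hq hd hp).1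
  exact hqd.trans ((sq_le_sq₀ (norm_nonneg _) (norm_nonneg _)).1 hdf)

lemma invDerivL2_mem_range_riccati (hβ : 0 ≤ β) (hA : 0 ≤ A) {f : L2T}
    (hf : ∫ x in (0 : ℝ)..1, f x = 0) : invDerivL2 f ∈ range (riccati α β A) := by
  refine mem_range_riccati_of_forall_norm_le α hβ hA (R := ‖f‖) fun t ht q hq => ?_
  have hq0 : ∫ x in (0 : ℝ)..1, q x = 0 := by
    rw [← integral_riccati α β A, hq, integral_L2T_smul, integral_invDerivL2, mul_zero]
  have htf : IsWeakDeriv 1 (riccati α β A q) (t • f) := hq ▸ (isWeakDeriv_invDerivL2 hf).smul t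
  refine (norm_le_of_isWeakDeriv_riccati hβ hA hq0 htf).trans ?_
  rw [norm_smul, Real.norm_of_nonneg ht.1]
  exact mul_le_of_le_one_left (norm_nonneg f) ht.2

lemma exists_isRiccatiMap (α β A : ℝ) (j : ℕ) :
    ∃ P : Sob (j + 1) → Sob j, AnalyticOnNhd ℝ P univ ∧ IsRiccatiMap α β A P := by
  have h := analyticSobolev_toL2 (j + 1)
  obtain ⟨R, hRan, hR⟩ := h.exists_continuous
  have hae (q : Sob (j + 1)) : q.toL2 =ᵐ[periodMeasure] R q := hR q ▸ coeFn_toL2 (R q)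
  have h_lower := h.of_succ.lowerL2 (α := α) (β := β) (A := A) hRan hR Sob.integral_eq_zero
  obtain ⟨-, D, hD, hd⟩ := h
  obtain ⟨P, hPan, hP⟩ := (hD.add h_lower).exists_lift fun q => by
    rw [integral_L2T_add, (hd q).integral_eq_zero, integral_lowerL2 (hae q), add_zero]
  exact ⟨P, hPan, fun q => ⟨D q, hd q, hP q ▸ coeFn_add_lowerL2 (D q) (hae q)⟩⟩

namespace IsRiccatiMap

variable {j : ℕ} {P : Sob (j + 1) → Sob j}

lemma isWeakDeriv (hP : IsRiccatiMap α β A P) (q : Sob (j + 1)) :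
    IsWeakDeriv 1 (riccati α β A q.toL2) (P q).toL2 := by
  obtain ⟨dq, hd, hp⟩ := hP q
  exact isWeakDeriv_riccati hd hp

lemma norm_sq_bounds (hP : IsRiccatiMap α β A P) (hβ : 0 ≤ β) (hA : 0 ≤ A) (q : Sob (j + 1))
    {dq : L2T} (hd : IsWeakDeriv 1 q.toL2 dq) :
    ‖dq‖ ^ 2 ≤ ‖(P q).toL2‖ ^ 2 ∧
    ‖(P q).toL2‖ ^ 2 ≤ ‖dq‖ ^ 2 + 2 * α ^ 2 * ‖q.toL2‖ ^ 3 * ‖dq‖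
      + A * (β + |α|) * (2 + β * A) * ‖q.toL2‖ ^ 2 * Real.exp (2 * β * ‖q.toL2‖) := by
  obtain ⟨dq', hd', hp⟩ := hP q
  rw [hd.unique hd']
  exact norm_sq_riccati_bounds hβ hA q.integral_eq_zero hd' hp

lemma isRealAnalyticIso (hP : IsRiccatiMap α β A P) (hPan : AnalyticOnNhd ℝ P univ)
    (hβ : 0 ≤ β) (hA : 0 ≤ A) : IsRealAnalyticIso P := by
  set p : Sob j → L2T := fun f => invDerivL2 f.toL2
  set Φ : Sob j → L2T := fun f => Function.invFun (riccati α β A) (p f)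
  have hp : AnalyticSobolev (j + 1) p :=
    (analyticSobolev_toL2 j).invDerivL2 Sob.integral_eq_zero
  have hp_mem (f : Sob j) : p f ∈ range (riccati α β A) :=
    invDerivL2_mem_range_riccati hβ hA f.integral_eq_zero
  have hΦ_right (f : Sob j) : riccati α β A (Φ f) = p f := Function.invFun_eq (hp_mem f)
  have hΦ0 (f : Sob j) : ∫ x in (0 : ℝ)..1, Φ f x = 0 := by
    rw [← integral_riccati α β A, hΦ_right, integral_invDerivL2]
  have hΦ : AnalyticSobolev (j + 1) Φ :=
    AnalyticSobolev.of_riccati (α := α) (β := β) (A := A) hΦ0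
      (fun f => (analyticAt_invFun_riccati α hβ hA (hp_mem f)).comp (hp.analyticAt f))
      (by simpa only [hΦ_right] using hp)
  obtain ⟨G, hGan, hG⟩ := hΦ.exists_lift hΦ0
  refine ⟨hPan, G, fun q => Sob.toL2_injective ?_, fun f => Sob.toL2_injective ?_, hGan⟩
  · have hpq : p (P q) = riccati α β A q.toL2 :=
      ((hP.isWeakDeriv q).eq_invDerivL2 (by rw [integral_riccati, q.integral_eq_zero])).symm
    rw [hG, ← Function.leftInverse_invFun (riccati_injective α hβ hA) q.toL2, ← hpq]
  · have hd := hP.isWeakDeriv (G f)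
    rw [hG, hΦ_right] at hd
    exact hd.unique (isWeakDeriv_invDerivL2 f.integral_eq_zero)

end IsRiccatiMap

/-! ### The Riccati map from `ℋ₀` to `ℋ₋₁` -/

/-- The derivative `g ↦ g'`, as a continuous linear map from `ℋ₀` to `ℋ₋₁`. -/
def SobNeg.ofPrimitive : Sob 0 →L[ℝ] SobNeg :=
  SobNeg.primitive.symm.toLinearMap.mkContinuous 1 fun g => by
    rw [one_mul, SobNeg.norm_def, LinearEquiv.coe_coe, LinearEquiv.apply_symm_apply]

/-- The map `g' ↦ g`, as a continuous linear map from `ℋ₋₁` to `ℋ₀`. -/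
def SobNeg.primitiveL : SobNeg →L[ℝ] Sob 0 :=
  SobNeg.primitive.toLinearMap.mkContinuous 1 fun f => by
    rw [one_mul, SobNeg.norm_def, LinearEquiv.coe_coe]

lemma SobNeg.primitive_ofPrimitive (g : Sob 0) : (SobNeg.ofPrimitive g).primitive = g :=
  SobNeg.primitive.apply_symm_apply g

lemma Sob.norm_eq_norm_toL2 (q : Sob 0) : ‖q‖ = ‖q.toL2‖ := by
  rw [Sob.norm_def, q.toL2_eq]
  rfl

lemma toL2_ofTopDeriv_zero {g : L2T} (hg : ∫ x in (0 : ℝ)..1, g x = 0) :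
    (ofTopDeriv 0 g).toL2 = g := by
  rw [toL2_ofTopDeriv, centerL2_apply, hg, zero_smul, sub_zero]
  rfl

/-- The map `q ↦ q + D⁻¹(α q² + u - c₀)` on `ℋ₀`, see `riccati`. -/
def riccatiSob (α β A : ℝ) (q : Sob 0) : Sob 0 := ofTopDeriv 0 (riccati α β A q.toL2)

lemma toL2_riccatiSob (q : Sob 0) : (riccatiSob α β A q).toL2 = riccati α β A q.toL2 :=
  toL2_ofTopDeriv_zero (by rw [integral_riccati, q.integral_eq_zero])

lemma analyticAt_riccatiSob (q : Sob 0) : AnalyticAt ℝ (riccatiSob α β A) q :=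
  analyticAt_clm_comp (ofTopDeriv 0)
    ((analyticAt_riccati α β A q.toL2).comp ((analyticSobolev_toL2 0).analyticAt q))

lemma riccatiSob_injective (hβ : 0 ≤ β) (hA : 0 ≤ A) :
    Function.Injective (riccatiSob α β A) := fun q r h =>
  Sob.toL2_injective <| riccati_injective α hβ hA <| by
    rw [← toL2_riccatiSob, ← toL2_riccatiSob, h]

lemma integral_invDeriv_mul_deriv (f : L1T) {φ : ℝ → ℝ} (hφ : φ ∈ TestFn) :
    ∫ x in (0 : ℝ)..1, invDeriv f x * deriv φ x = -∫ x in (0 : ℝ)..1, center f x * φ x := by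
  have hc : Continuous (deriv φ) := (TestFn.deriv_mem hφ).1.continuous
  have hint : IntervalIntegrable (fun x => primitive (center f) x * deriv φ x) volume 0 1 :=
    ((primitive (center f)).continuous.mul hc).intervalIntegrable _ _
  set m := meanL1 (toL1 (primitive (center f)))
  calc ∫ x in (0 : ℝ)..1, invDeriv f x * deriv φ x
      = ∫ x in (0 : ℝ)..1, (primitive (center f) x * deriv φ x - m * deriv φ x) := by
        refine integral_period_congr ?_
        filter_upwards [coeFn_invDeriv f] with x hx
        rw [hx, periodicPrimitive_apply, sub_mul]
    _ = ∫ x in (0 : ℝ)..1, primitive (center f) x * deriv φ x := by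
        rw [intervalIntegral.integral_sub hint ((hc.intervalIntegrable _ _).const_mul _),
          intervalIntegral.integral_const_mul, TestFn.integral_deriv hφ, mul_zero, sub_zero]
    _ = -∫ x in (0 : ℝ)..1, center f x * φ x := by
        rw [integral_primitive_mul_deriv _ hφ, ← meanL1_eq_primitive, meanL1_center, mul_zero,
          zero_sub]

lemma distribDeriv_riccatiSob (q : Sob 0) (φ : TestFn) :
    distribDeriv (riccatiSob α β A q) φ
      = -(∫ x in (0 : ℝ)..1, q.toL2 x * deriv (φ : ℝ → ℝ) x)
        + ∫ x in (0 : ℝ)..1,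
            (lowerTerm α β A q.toL2 x - meanTerm α β A q.toL2) * (φ : ℝ → ℝ) x := by
  have h_lower : ∫ x in (0 : ℝ)..1, center (lowerL1 α β A q.toL2) x * (φ : ℝ → ℝ) x
      = ∫ x in (0 : ℝ)..1,
          (lowerTerm α β A q.toL2 x - meanTerm α β A q.toL2) * (φ : ℝ → ℝ) x := by
    refine integral_period_congr ?_
    filter_upwards [coeFn_center (lowerL1 α β A q.toL2), coeFn_lowerL1 α β A q.toL2] with x h1 h2
    rw [h1, h2, meanL1_lowerL1]
  have h_def : distribDeriv (riccatiSob α β A q) φ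
      = -∫ x in (0 : ℝ)..1, (riccatiSob α β A q).toL2 x * deriv (φ : ℝ → ℝ) x := rfl
  rw [h_def, toL2_riccatiSob, riccati,
    integral_add_mul _ _ (TestFn.deriv_mem φ.2).1.continuous,
    integral_invDeriv_mul_deriv _ φ.2, h_lower, neg_add, neg_neg]

lemma isSingularRiccatiMap_iff {P : Sob 0 → SobNeg} :
    IsSingularRiccatiMap α β A P ↔ ∀ q, P q = SobNeg.ofPrimitive (riccatiSob α β A q) := by
  refine forall_congr' fun q => ?_
  simp only [← distribDeriv_riccatiSob]
  rw [← LinearMap.ext_iff, ← SobNeg.distribDeriv_primitive, distribDeriv_injective.eq_iff,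
    ← SobNeg.primitive.injective.eq_iff, SobNeg.primitive_ofPrimitive]

lemma exists_isSingularRiccatiMap (α β A : ℝ) :
    ∃ P : Sob 0 → SobNeg, IsSingularRiccatiMap α β A P :=
  ⟨_, isSingularRiccatiMap_iff.2 fun _ => rfl⟩

lemma mem_range_riccati_of_integral_eq_zero (hα : 0 < α) (hβ : 0 ≤ β) (hA : 0 ≤ A) {p : L2T}
    (hp : ∫ x in (0 : ℝ)..1, p x = 0) : p ∈ range (riccati α β A) := by
  refine mem_range_riccati_of_forall_norm_le α hβ hA
    (R := Real.sqrt (2 * ‖p‖ ^ 2 * (1 + α ^ 2 * ‖p‖ ^ 2))) fun t ht q hq => ?_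
  have hq0 : ∫ x in (0 : ℝ)..1, q x = 0 := by
    rw [← integral_riccati α β A, hq, integral_L2T_smul, hp, mul_zero]
  have h_norm : ‖riccati α β A q‖ ≤ ‖p‖ := by
    rw [hq, norm_smul, Real.norm_of_nonneg ht.1]
    exact mul_le_of_le_one_left (norm_nonneg p) ht.2
  refine Real.le_sqrt_of_sq_le ((norm_sq_le_norm_riccati hα hβ hA hq0).trans ?_)
  gcongr

namespace IsSingularRiccatiMap

variable {P : Sob 0 → SobNeg}

lemma analyticOnNhd (hP : IsSingularRiccatiMap α β A P) : AnalyticOnNhd ℝ P univ := fun q _ =>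
  funext (isSingularRiccatiMap_iff.1 hP) ▸
    analyticAt_clm_comp SobNeg.ofPrimitive (analyticAt_riccatiSob q)

lemma primitive_apply (hP : IsSingularRiccatiMap α β A P) (q : Sob 0) :
    (P q).primitive = riccatiSob α β A q := by
  rw [isSingularRiccatiMap_iff.1 hP, SobNeg.primitive_ofPrimitive]

lemma injective (hP : IsSingularRiccatiMap α β A P) (hβ : 0 ≤ β) (hA : 0 ≤ A) :
    Function.Injective P := fun q r h =>
  riccatiSob_injective hβ hA (by rw [← hP.primitive_apply, ← hP.primitive_apply, h])

lemma norm_apply (hP : IsSingularRiccatiMap α β A P) (q : Sob 0) :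
    ‖P q‖ = ‖riccati α β A q.toL2‖ := by
  rw [SobNeg.norm_def, hP.primitive_apply, Sob.norm_eq_norm_toL2, toL2_riccatiSob]

lemma norm_apply_le (hP : IsSingularRiccatiMap α β A P) (hβ : 0 ≤ β) (hA : 0 ≤ A) (q : Sob 0) :
    ‖P q‖ ≤ ‖q.toL2‖ * (3 + 2 * |α| * ‖q.toL2‖ + β * A * Real.exp (β * ‖q.toL2‖)) :=
  (hP.norm_apply q).trans_le (norm_riccati_le hβ hA q.toL2)

lemma norm_sq_le (hP : IsSingularRiccatiMap α β A P) (hα : 0 < α) (hβ : 0 ≤ β) (hA : 0 ≤ A)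
    (q : Sob 0) : ‖q.toL2‖ ^ 2 ≤ 2 * ‖P q‖ ^ 2 * (1 + α ^ 2 * ‖P q‖ ^ 2) := by
  rw [hP.norm_apply]
  exact norm_sq_le_norm_riccati hα hβ hA q.integral_eq_zero

lemma isRealAnalyticIso (hP : IsSingularRiccatiMap α β A P) (hα : 0 < α) (hβ : 0 ≤ β)
    (hA : 0 ≤ A) : IsRealAnalyticIso P := by
  set p : SobNeg → L2T := fun f => f.primitive.toL2
  have hp_mem (f : SobNeg) : p f ∈ range (riccati α β A) :=
    mem_range_riccati_of_integral_eq_zero hα hβ hA f.primitive.integral_eq_zero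
  have hp_an (f : SobNeg) : AnalyticAt ℝ p f :=
    ((analyticSobolev_toL2 0).analyticAt f.primitive).comp (SobNeg.primitiveL.analyticAt f)
  set G : SobNeg → Sob 0 := fun f => ofTopDeriv 0 (Function.invFun (riccati α β A) (p f))
  have hGan (f : SobNeg) : AnalyticAt ℝ G f := analyticAt_clm_comp (ofTopDeriv 0)
    ((analyticAt_invFun_riccati α hβ hA (hp_mem f)).comp (hp_an f))
  have hG : Function.RightInverse G P := fun f => by
    have h_right : riccati α β A (Function.invFun (riccati α β A) (p f)) = p f :=
      Function.invFun_eq (hp_mem f)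
    refine SobNeg.primitive.injective (Sob.toL2_injective ?_)
    rw [hP.primitive_apply, toL2_riccatiSob, toL2_ofTopDeriv_zero, h_right]
    rw [← integral_riccati α β A, h_right, f.primitive.integral_eq_zero]
  exact ⟨hP.analyticOnNhd, G, hG.leftInverse_of_injective (hP.injective hβ hA), hG,
    fun f _ => hGan f⟩

end IsSingularRiccatiMap

end

end RiccatiTorus

theorem theorem2p3_general (α β A : ℝ) (hβ : 0 ≤ β) (hA : 0 ≤ A) :
    (∀ j : ℕ, ∃ P : Sob (j + 1) → Sob j,
      IsRiccatiMap α β A P ∧ IsRealAnalyticIso P ∧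
      ∀ (q : Sob (j + 1)) (dq : L2T), IsWeakDeriv 1 q.toL2 dq →
        ‖dq‖ ^ 2 ≤ ‖(P q).toL2‖ ^ 2 ∧
        ‖(P q).toL2‖ ^ 2 ≤ ‖dq‖ ^ 2 + 2 * α ^ 2 * ‖q.toL2‖ ^ 3 * ‖dq‖
          + A * (β + |α|) * (2 + β * A) * ‖q.toL2‖ ^ 2 * Real.exp (2 * β * ‖q.toL2‖)) ∧
    (∃ P : Sob 0 → SobNeg,
      IsSingularRiccatiMap α β A P ∧ AnalyticOnNhd ℝ P univ ∧ Function.Injective P ∧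
      (∀ q : Sob 0,
        ‖P q‖ ≤ ‖q.toL2‖ * (3 + 2 * |α| * ‖q.toL2‖ + β * A * Real.exp (β * ‖q.toL2‖))) ∧
      (0 < α →
        IsRealAnalyticIso P ∧
        ∀ q : Sob 0, ‖q.toL2‖ ^ 2 ≤ 2 * ‖P q‖ ^ 2 * (1 + α ^ 2 * ‖P q‖ ^ 2))) := by
  refine ⟨fun j => ?_, ?_⟩
  · obtain ⟨P, hPan, hP⟩ := exists_isRiccatiMap α β A j
    exact ⟨P, hP, hP.isRealAnalyticIso hPan hβ hA, fun q _ hd => hP.norm_sq_bounds hβ hA q hd⟩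
  · obtain ⟨P, hP⟩ := exists_isSingularRiccatiMap α β A
    exact ⟨P, hP, hP.analyticOnNhd, hP.injective hβ hA, hP.norm_apply_le hβ hA,
      fun hα => ⟨hP.isRealAnalyticIso hα hβ hA, hP.norm_sq_le hα hβ hA⟩⟩

theorem theorem2p3 (α β A : ℝ) (hα : 0 < α) (hβ : 0 < β) (hA : 0 ≤ A) :
    (∀ j : ℕ, ∃ P : Sob (j + 1) → Sob j,
      IsRiccatiMap α β A P ∧ IsRealAnalyticIso P ∧
      ∀ (q : Sob (j + 1)) (dq : L2T), IsWeakDeriv 1 q.toL2 dq →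
        ‖dq‖ ^ 2 ≤ ‖(P q).toL2‖ ^ 2 ∧
        ‖(P q).toL2‖ ^ 2 ≤ ‖dq‖ ^ 2 + 2 * α ^ 2 * ‖q.toL2‖ ^ 3 * ‖dq‖
          + A * (β + α) * (2 + β * A) * ‖q.toL2‖ ^ 2 * Real.exp (2 * β * ‖q.toL2‖)) ∧
    (∃ P : Sob 0 → SobNeg,
      IsSingularRiccatiMap α β A P ∧ AnalyticOnNhd ℝ P univ ∧ Function.Injective P ∧
      (∀ q : Sob 0,
        ‖P q‖ ≤ ‖q.toL2‖ * (3 + 2 * α * ‖q.toL2‖ + β * A * Real.exp (β * ‖q.toL2‖))) ∧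
      (α = 1 → β = 4 →
        IsRealAnalyticIso P ∧
        ∀ q : Sob 0, ‖q.toL2‖ ^ 2 ≤ 2 * ‖P q‖ ^ 2 * (1 + 2 * ‖P q‖ ^ 2))) := by
  obtain ⟨h_regular, P, hP, hPan, hPinj, h_upper, h_iso⟩ := theorem2p3_general α β A hβ.le hA
  rw [abs_of_pos hα] at h_regular h_upper
  exact ⟨h_regular, P, hP, hPan, hPinj, h_upper, fun hα1 _ => ⟨(h_iso hα).1,
    fun q => ((h_iso hα).2 q).trans (by rw [hα1]; gcongr; norm_num)⟩⟩
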